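/- Let $K$ be a field of characteristic $0$ (for instance $\mathbb R$ or $\mathbb C$). All spaces are finite-dimensional $\mathbb Z$-graded $K$-vector spaces; $|x|$ denotes the degree of a homogeneous element $x$, and the dual of $V^a$ has degree $-a$. **Big bracket.** For a graded space $V$ give $x\in V\oplus V^*$ the total degree $|x|-1$, and equip $V\oplus V^*$ with the natural pairing, for which $V$ and $V^*$ are isotropic and $\langle \xi,v\rangle=\xi(v)$, $\langle v,\xi\rangle=(-1)^{|v||\xi|}\xi(v)$ for $v\in V$, $\xi\in V^*$. Let $B=\bigoplus_{k,l\ge 0}\Lambda^kV^*\otimes\Lambda^lV$ be the exterior algebra of $V\oplus V^*$ in the graded sense: it is generated by $V\oplus V^*$, and homogeneous generators $x,y$ satisfy $xy=(-1)^{(|x|-1)(|y|-1)}yx$. A product $\xi_1\cdots\xi_kv_1\cdots v_l$ of homogeneous $\xi_i\in V^*$, $v_j\in V$ has total degree $\sum|\xi_i|+\sum|v_j|+(k+l-2)$. The big bracket $[\cdot,\cdot]$ on $B$ is the bilinear bracket of total degree $0$ that is graded skew-symmetric, satisfies the graded Leibniz rule $[T,ab]=[T,a]b+(-1)^{pq}a[T,b]$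 for $T$ of total degree $p$ and $a$ of total degree $q$, and is given by $[x,y]=\langle x,y\rangle$ on $V\oplus V^*$ (signs according to total degrees). **$L_\infty$-bialgebras.** An $L_\infty$-bialgebra structure on $V$ is a formal sum $T=\sum_{k,l\ge1}t_{kl}$ of elements $t_{kl}\in\Lambda^kV^*\otimes\Lambda^lV$ of total degree $1$ with $[T,T]=0$, that is, $\sum_{k+k'=p+1}\sum_{l+l'=q+1}[t_{kl},t_{k'l'}]=0$ for all $p,q$. An isomorphism $(V,T)\to(V',T')$ is a degree-preserving linear isomorphism $f:V\to V'$ such that the algebra homomorphism induced by $f\oplus (f^*)^{-1}:V\oplus V^*\to V'\oplus V'^*$ maps $t_{kl}$ to $t'_{kl}$ for all $k,l$. **$L_\infty$-algebras.** An $L_\infty$-algebra structure on $\mathfrak g$ is a family of $n$-linear maps $\lambda_n:\mathfrak g^n\to\mathfrak g$, $n\ge1$, of degree $2-n$, which are graded symmetric with respect to the shifted degrees $|x|-1$ (so they are maps on the graded exterior powers $\Lambda^n\mathfrak g\simeq \mathrm{Sym}^n(\mathfrak g[1])$) and satisfy, for all $n\geq 1$ and homogeneous $v_1,\dots,v_n$,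 $$\sum_{k=1}^{n}\ \sum_{\sigma}\ \varepsilon(\sigma)\,\lambda_{n-k+1}\bigl(\lambda_k(v_{\sigma(1)},\dots,v_{\sigma(k)}),v_{\sigma(k+1)},\dots,v_{\sigma(n)}\bigr)=0,$$ where $\sigma$ runs over the permutations with $\sigma(1)<\dots<\sigma(k)$, $\sigma(k+1)<\dots<\sigma(n)$, and $\varepsilon(\sigma)$ is the Koszul sign for the shifted degrees. **Manin $L_\infty$-triples.** A Manin $L_\infty$-triple $(\mathfrak g,\mathfrak g_+,\mathfrak g_-)$ is an $L_\infty$-algebra $\mathfrak g$ with a nondegenerate bilinear form $\langle\cdot,\cdot\rangle$ of degree $0$, graded symmetric ($\langle x,y\rangle=(-1)^{|x||y|}\langle y,x\rangle$), and graded subspaces $\mathfrak g_\pm$ such that $\mathfrak g=\mathfrak g_+\oplus\mathfrak g_-$, both $\mathfrak g_\pm$ are $L_\infty$-subalgebras (closed under all $\lambda_n$) and isotropic, and $$\langle\lambda_n(v_1,\dots,v_{n-1},x),y\rangle=(-1)^{(|x|-1)(|y|-1)}\langle\lambda_n(v_1,\dots,v_{n-1},y),x\rangle$$ for all $n\ge1$.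 Isomorphisms of Manin $L_\infty$-triples are degree-preserving linear isomorphisms that respect the form, the two subspaces and all brackets. **Theorem.** Manin $L_\infty$-triples and $L_\infty$-bialgebras are equivalent notions. Precisely: 1. For every $V$, assigning to $T=\sum t_{kl}$ the brackets $$\lambda_n(x_1,\dots,x_n)=\sum_{k+l=n+1}[[\cdots[[t_{kl},x_1],x_2]\cdots],x_n]\in V\oplus V^*$$ (iterated adjoint action) is a bijection from the $L_\infty$-bialgebra structures on $V$ to the families of brackets on $V\oplus V^*$ that make $(V\oplus V^*,V,V^*)$ with the natural pairing a Manin $L_\infty$-triple. 2. For every Manin $L_\infty$-triple $(\mathfrak g,\mathfrak g_+,\mathfrak g_-)$ there is a unique $L_\infty$-bialgebra structure $T$ on $\mathfrak g_+$ for which there is an isomorphism of Manin $L_\infty$-triples from the triple $(\mathfrak g_+\oplus\mathfrak g_+^*,\mathfrak g_+,\mathfrak g_+^*)$ defined by $T$ to $(\mathfrak g,\mathfrak g_+,\mathfrak g_-)$ that is the identity on $\mathfrak g_+$. 3. For $L_\infty$-bialgebras $(V,T)$ and $(V',T')$, the isomorphisms between the corresponding Manin $L_\infty$-triples are exactly the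 maps $f\oplus(f^*)^{-1}$ for isomorphisms $f$ from $(V,T)$ to $(V',T')$. -/

import Mathlib

namespace ManinLInfty

noncomputable section

/-! ### Graded spaces and their doubles

A graded space is a vector space `V` with a family `𝒱 : ℤ → Submodule K V` of which it is the
(internal) direct sum. -/

section Graded

variable {K : Type*} [Field K] {V : Type*} [AddCommGroup V] [Module K V]

open Classical in
/-- The parity involution of a graded space: multiplication by `(-1) ^ a` on the part of
degree `a`. (If `V` is not the direct sum of the `𝒱 a`, the identity, as a junk value.) -/
def parity (𝒱 : ℤ → Submodule K V) : V →ₗ[K] V :=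
  if h : DirectSum.IsInternal 𝒱 then
    (DirectSum.toModule K ℤ V fun a => (a.negOnePow : ℤ) • (𝒱 a).subtype) ∘ₗ
      (LinearEquiv.ofBijective (DirectSum.coeLinearMap 𝒱) h).symm.toLinearMap
  else LinearMap.id

theorem parity_of_mem {𝒱 : ℤ → Submodule K V} (h : DirectSum.IsInternal 𝒱) {a : ℤ} {v : V}
    (hv : v ∈ 𝒱 a) : parity 𝒱 v = (a.negOnePow : ℤ) • v := by
  have e : (LinearEquiv.ofBijective (DirectSum.coeLinearMap 𝒱) h).symm v =
      DirectSum.lof K ℤ (fun i => 𝒱 i) a ⟨v, hv⟩ := by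
    rw [LinearEquiv.symm_apply_eq]
    exact (DirectSum.coeLinearMap_of 𝒱 a ⟨v, hv⟩).symm
  simp only [parity, dif_pos h, LinearMap.comp_apply, LinearEquiv.coe_coe, e]
  rw [DirectSum.toModule_lof]
  simp

theorem parity_parity (𝒱 : ℤ → Submodule K V) (v : V) : parity 𝒱 (parity 𝒱 v) = v := by
  by_cases h : DirectSum.IsInternal 𝒱
  · have hv : v ∈ ⨆ a, 𝒱 a := by rw [h.submodule_iSup_eq_top]; trivial
    induction hv using Submodule.iSup_induction' with
    | mem a x hx =>
      rw [parity_of_mem h hx, map_zsmul, parity_of_mem h hx, smul_smul, ← Units.val_mul,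
        Int.units_mul_self]
      simp
    | zero => simp
    | add x y _ _ hx hy => rw [map_add, map_add, hx, hy]
  · simp [parity, dif_neg h]

/-- The grading of the dual space: the dual of `V ^ a` has degree `-a`. -/
def dualGrading (𝒱 : ℤ → Submodule K V) (a : ℤ) : Submodule K (Module.Dual K V) where
  carrier := {ξ | ∀ b, b ≠ -a → ∀ v ∈ 𝒱 b, ξ v = 0}
  add_mem' hx hy b hb v hv := by simp [hx b hb v hv, hy b hb v hv]
  zero_mem' := by simp
  smul_mem' c x hx b hb v hv := by simp [hx b hb v hv]

/-- The double `V ⊕ V*` of a vector space. -/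
abbrev Double (K V : Type*) [Field K] [AddCommGroup V] [Module K V] : Type _ :=
  V × Module.Dual K V

/-- The grading of `V ⊕ V*`. -/
def doubleGrading (𝒱 : ℤ → Submodule K V) (a : ℤ) : Submodule K (Double K V) :=
  (𝒱 a).prod (dualGrading 𝒱 a)

/-- The parity involution of `V ⊕ V*`; an element has even degree if it is fixed, and odd degree
if it changes sign. -/
def doubleParity (𝒱 : ℤ → Submodule K V) : Double K V →ₗ[K] Double K V :=
  (parity 𝒱).prodMap (parity 𝒱).dualMap

/-- The natural graded symmetric pairing of `V ⊕ V*`: `⟨ξ, v⟩ = ξ v` and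
`⟨v, ξ⟩ = (-1) ^ (|v| |ξ|) ξ v` for `v ∈ V` and `ξ ∈ V*`, while `V` and `V*` are isotropic. -/
def pairing (𝒱 : ℤ → Submodule K V) : LinearMap.BilinForm K (Double K V) :=
  LinearMap.mk₂ K (fun x y => x.2 y.1 + y.2 (parity 𝒱 x.1))
    (by intros; simp; ring) (by intros; simp; ring)
    (by intros; simp; ring) (by intros; simp; ring)

theorem doubleParity_doubleParity (𝒱 : ℤ → Submodule K V) (x : Double K V) :
    doubleParity 𝒱 (doubleParity 𝒱 x) = x := by
  refine Prod.ext (parity_parity 𝒱 x.1) ?_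
  ext v
  simp [doubleParity, LinearMap.dualMap_apply, parity_parity]

theorem pairing_parity (𝒱 : ℤ → Submodule K V) (x y : Double K V) :
    pairing 𝒱 (doubleParity 𝒱 x) (doubleParity 𝒱 y) = pairing 𝒱 x y := by
  simp [pairing, doubleParity, LinearMap.dualMap_apply, parity_parity]

theorem pairing_swap (𝒱 : ℤ → Submodule K V) (x y : Double K V) :
    pairing 𝒱 x y = pairing 𝒱 y (doubleParity 𝒱 x) := by
  simp [pairing, doubleParity, LinearMap.dualMap_apply, parity_parity, add_comm]

/-- The component of even degree, that is, of odd total degree. -/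
def evenPart (𝒱 : ℤ → Submodule K V) : Double K V →ₗ[K] Double K V :=
  (2⁻¹ : K) • (LinearMap.id + doubleParity 𝒱)

/-- The component of odd degree, that is, of even total degree. -/
def oddPart (𝒱 : ℤ → Submodule K V) : Double K V →ₗ[K] Double K V :=
  (2⁻¹ : K) • (LinearMap.id - doubleParity 𝒱)

theorem evenPart_add_oddPart [CharZero K] (𝒱 : ℤ → Submodule K V) (x : Double K V) :
    evenPart 𝒱 x + oddPart 𝒱 x = x := by
  simp only [evenPart, oddPart, LinearMap.smul_apply, LinearMap.add_apply, LinearMap.sub_apply,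
    LinearMap.id_apply]
  rw [← smul_add, add_add_sub_cancel, ← two_smul K, smul_smul]
  simp

theorem doubleParity_evenPart (𝒱 : ℤ → Submodule K V) (x : Double K V) :
    doubleParity 𝒱 (evenPart 𝒱 x) = evenPart 𝒱 x := by
  simp only [evenPart, LinearMap.smul_apply, LinearMap.add_apply, LinearMap.id_apply, map_smul,
    map_add, doubleParity_doubleParity, add_comm]

theorem doubleParity_oddPart (𝒱 : ℤ → Submodule K V) (x : Double K V) :
    doubleParity 𝒱 (oddPart 𝒱 x) = -oddPart 𝒱 x := by
  simp only [oddPart, LinearMap.smul_apply, LinearMap.sub_apply, LinearMap.id_apply, map_smul,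
    map_sub, doubleParity_doubleParity]
  rw [← smul_neg, neg_sub]

theorem evenPart_even {𝒱 : ℤ → Submodule K V} [CharZero K] {x : Double K V}
    (hx : doubleParity 𝒱 x = x) : evenPart 𝒱 x = x := by
  simp only [evenPart, LinearMap.smul_apply, LinearMap.add_apply, LinearMap.id_apply, hx]
  rw [← two_smul K, smul_smul]
  simp

theorem oddPart_even {𝒱 : ℤ → Submodule K V} {x : Double K V}
    (hx : doubleParity 𝒱 x = x) : oddPart 𝒱 x = 0 := by
  simp [oddPart, hx]

theorem evenPart_odd {𝒱 : ℤ → Submodule K V} {x : Double K V}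
    (hx : doubleParity 𝒱 x = -x) : evenPart 𝒱 x = 0 := by
  simp [evenPart, hx]

theorem oddPart_odd {𝒱 : ℤ → Submodule K V} [CharZero K] {x : Double K V}
    (hx : doubleParity 𝒱 x = -x) : oddPart 𝒱 x = x := by
  simp only [oddPart, LinearMap.smul_apply, LinearMap.sub_apply, LinearMap.id_apply, hx,
    sub_neg_eq_add]
  rw [← two_smul K, smul_smul]
  simp

/-- Elements of different parities are orthogonal. -/
theorem pairing_eq_zero {𝒱 : ℤ → Submodule K V} [CharZero K] {x y : Double K V}
    (hx : doubleParity 𝒱 x = x) (hy : doubleParity 𝒱 y = -y) : pairing 𝒱 x y = 0 := by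
  have h := pairing_parity 𝒱 x y
  rw [hx, hy, map_neg] at h
  exact self_eq_neg.1 h.symm

theorem pairing_eq_zero' {𝒱 : ℤ → Submodule K V} [CharZero K] {x y : Double K V}
    (hx : doubleParity 𝒱 x = -x) (hy : doubleParity 𝒱 y = y) : pairing 𝒱 x y = 0 := by
  have h := pairing_parity 𝒱 x y
  rw [hx, hy, map_neg, LinearMap.neg_apply] at h
  exact self_eq_neg.1 h.symm

end Graded

/-! ### The algebra of exterior powers of `V ⊕ V*`

An element of degree `a` of `V ⊕ V*` has total degree `a - 1`. The exterior algebra is taken in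
the graded sense: generators of total degrees `p` and `q` commute up to the sign `(-1) ^ (p q)`.
In particular it is the ordinary exterior algebra if `V` is concentrated in degree `0`. -/

section Algebra

variable {K : Type*} [Field K] {V : Type*} [AddCommGroup V] [Module K V]

/-- Graded commutativity: generators of odd total degree (even degree) anticommute with each other,
generators of even total degree (odd degree) commute with all generators. -/
inductive Rel (𝒱 : ℤ → Submodule K V) :
    TensorAlgebra K (Double K V) → TensorAlgebra K (Double K V) → Prop
  | odd (x y : Double K V) (hx : doubleParity 𝒱 x = x) (hy : doubleParity 𝒱 y = y) :
      Rel 𝒱 (TensorAlgebra.ι K x * TensorAlgebra.ι K y)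
        (-(TensorAlgebra.ι K y * TensorAlgebra.ι K x))
  | even (x y : Double K V) (hx : doubleParity 𝒱 x = -x) :
      Rel 𝒱 (TensorAlgebra.ι K x * TensorAlgebra.ι K y)
        (TensorAlgebra.ι K y * TensorAlgebra.ι K x)

/-- The algebra `⨁ Λ^k V* ⊗ Λ^l V` of exterior powers of `V ⊕ V*`. -/
def BigAlgebra (𝒱 : ℤ → Submodule K V) : Type _ := RingQuot (Rel 𝒱)

instance (𝒱 : ℤ → Submodule K V) : Ring (BigAlgebra 𝒱) :=
  inferInstanceAs (Ring (RingQuot (Rel 𝒱)))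

instance (𝒱 : ℤ → Submodule K V) : Algebra K (BigAlgebra 𝒱) :=
  inferInstanceAs (Algebra K (RingQuot (Rel 𝒱)))

namespace BigAlgebra

/-- The inclusion of the generators. -/
def gen (𝒱 : ℤ → Submodule K V) : Double K V →ₗ[K] BigAlgebra 𝒱 :=
  (RingQuot.mkAlgHom K (Rel 𝒱)).toLinearMap ∘ₗ TensorAlgebra.ι K

variable {𝒱 : ℤ → Submodule K V}

theorem gen_odd {x y : Double K V} (hx : doubleParity 𝒱 x = x) (hy : doubleParity 𝒱 y = y) :
    gen 𝒱 x * gen 𝒱 y = -(gen 𝒱 y * gen 𝒱 x) := by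
  have := RingQuot.mkAlgHom_rel K (Rel.odd (𝒱 := 𝒱) x y hx hy)
  rw [map_mul, map_neg, map_mul] at this
  exact this

theorem gen_even {x : Double K V} (hx : doubleParity 𝒱 x = -x) (y : Double K V) :
    gen 𝒱 x * gen 𝒱 y = gen 𝒱 y * gen 𝒱 x := by
  have := RingQuot.mkAlgHom_rel K (Rel.even (𝒱 := 𝒱) x y hx)
  rw [map_mul, map_mul] at this
  exact this

section Lift

variable {A : Type*} [Ring A] [Algebra K A] (f : Double K V →ₗ[K] A)
  (hodd : ∀ x y, doubleParity 𝒱 x = x → doubleParity 𝒱 y = y → f x * f y = -(f y * f x))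
  (heven : ∀ x y, doubleParity 𝒱 x = -x → f x * f y = f y * f x)

/-- The universal property of the algebra. -/
def lift : BigAlgebra 𝒱 →ₐ[K] A :=
  RingQuot.liftAlgHom K ⟨TensorAlgebra.lift K f, by
    rintro _ _ (⟨x, y, hx, hy⟩ | ⟨x, y, hx⟩)
    · simpa using hodd x y hx hy
    · simpa using heven x y hx⟩

@[simp]
theorem lift_gen (x : Double K V) : lift f hodd heven (gen 𝒱 x) = f x := by
  have : lift f hodd heven (gen 𝒱 x) = TensorAlgebra.lift K f (TensorAlgebra.ι K x) :=
    RingQuot.liftAlgHom_mkAlgHom_apply K _ _ _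
  simpa using this

end Lift

theorem induction {C : BigAlgebra 𝒱 → Prop} (hs : ∀ r, C (algebraMap K _ r))
    (hg : ∀ x, C (gen 𝒱 x)) (hm : ∀ a b, C a → C b → C (a * b))
    (ha : ∀ a b, C a → C b → C (a + b)) (b : BigAlgebra 𝒱) : C b := by
  obtain ⟨t, rfl⟩ := RingQuot.mkAlgHom_surjective K (Rel 𝒱) b
  induction t using TensorAlgebra.induction with
  | algebraMap r => rw [AlgHom.commutes]; exact hs r
  | ι x => exact hg x
  | mul a b h₁ h₂ => rw [map_mul]; exact hm _ _ h₁ h₂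
  | add a b h₁ h₂ => rw [map_add]; exact ha _ _ h₁ h₂

/-- The involution of the algebra that is `(-1) ^ d` on the elements of total degree `d`. -/
def invol (𝒱 : ℤ → Submodule K V) : BigAlgebra 𝒱 →ₐ[K] BigAlgebra 𝒱 :=
  lift (-(gen 𝒱 ∘ₗ doubleParity 𝒱))
    (fun x y hx hy => by simp [hx, hy, gen_odd hx hy])
    (fun x y hx => by simp [hx, gen_even hx])

@[simp]
theorem invol_gen (x : Double K V) : invol 𝒱 (gen 𝒱 x) = -gen 𝒱 (doubleParity 𝒱 x) := by
  simp [invol]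

theorem invol_invol (b : BigAlgebra 𝒱) : invol 𝒱 (invol 𝒱 b) = b := by
  induction b using induction with
  | hs r => simp
  | hg x => simp [doubleParity_doubleParity]
  | hm a b h₁ h₂ => simp [h₁, h₂]
  | ha a b h₁ h₂ => simp [h₁, h₂]

theorem gen_mul_odd {x : Double K V} (hx : doubleParity 𝒱 x = x) [CharZero K]
    (b : BigAlgebra 𝒱) : gen 𝒱 x * b = invol 𝒱 b * gen 𝒱 x := by
  induction b using induction with
  | hs r => simp [Algebra.commutes]
  | hg y =>
    have hpp := doubleParity_evenPart 𝒱 y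
    have hqq := doubleParity_oddPart 𝒱 y
    rw [← evenPart_add_oddPart 𝒱 y, map_add, mul_add, gen_odd hx hpp, ← gen_even hqq, map_add, invol_gen, invol_gen,
      hpp, hqq, add_mul]
    simp
  | hm a b h₁ h₂ => rw [← mul_assoc, h₁, mul_assoc, h₂, map_mul, mul_assoc]
  | ha a b h₁ h₂ => rw [mul_add, h₁, h₂, map_add, add_mul]

theorem gen_mul_even {x : Double K V} (hx : doubleParity 𝒱 x = -x) (b : BigAlgebra 𝒱) :
    gen 𝒱 x * b = b * gen 𝒱 x := by
  induction b using induction with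
  | hs r => exact (Algebra.commutes _ _).symm
  | hg y => exact gen_even hx y
  | hm a b h₁ h₂ => rw [← mul_assoc, h₁, mul_assoc, h₂, mul_assoc]
  | ha a b h₁ h₂ => rw [mul_add, h₁, h₂, add_mul]

/-! #### Graded derivations -/

/-- The condition under which a map `δ` on the generators extends to a derivation `D` of the
algebra with `D (a b) = σ a * D b + D a * b`. -/
structure Compat (σ : BigAlgebra 𝒱 →ₐ[K] BigAlgebra 𝒱) (δ : Double K V →ₗ[K] BigAlgebra 𝒱) :
    Prop where
  odd : ∀ x y, doubleParity 𝒱 x = x → doubleParity 𝒱 y = y →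
    σ (gen 𝒱 x) * δ y + δ x * gen 𝒱 y = -(σ (gen 𝒱 y) * δ x + δ y * gen 𝒱 x)
  even : ∀ x y, doubleParity 𝒱 x = -x →
    σ (gen 𝒱 x) * δ y + δ x * gen 𝒱 y = σ (gen 𝒱 y) * δ x + δ y * gen 𝒱 x

/-- A derivation as a homomorphism to triangular matrices. -/
def triangularGen (σ : BigAlgebra 𝒱 →ₐ[K] BigAlgebra 𝒱) (δ : Double K V →ₗ[K] BigAlgebra 𝒱) :
    Double K V →ₗ[K] Matrix (Fin 2) (Fin 2) (BigAlgebra 𝒱) where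
  toFun x := !![σ (gen 𝒱 x), δ x; 0, gen 𝒱 x]
  map_add' x y := by ext i j; fin_cases i <;> fin_cases j <;> simp
  map_smul' c x := by ext i j; fin_cases i <;> fin_cases j <;> simp

variable {σ : BigAlgebra 𝒱 →ₐ[K] BigAlgebra 𝒱} {δ : Double K V →ₗ[K] BigAlgebra 𝒱}

/-- See `triangularGen`. -/
def triangular (h : Compat σ δ) : BigAlgebra 𝒱 →ₐ[K] Matrix (Fin 2) (Fin 2) (BigAlgebra 𝒱) :=
  lift (triangularGen σ δ)
    (fun x y hx hy => by
      have h1 := congrArg σ (gen_odd hx hy)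
      rw [map_mul, map_neg, map_mul] at h1
      ext i j
      fin_cases i <;> fin_cases j
      · simpa [triangularGen] using h1
      · simpa [triangularGen, add_comm] using h.odd x y hx hy
      · simp [triangularGen]
      · simpa [triangularGen] using gen_odd hx hy)
    (fun x y hx => by
      have h1 := congrArg σ (gen_even hx y)
      rw [map_mul, map_mul] at h1
      ext i j
      fin_cases i <;> fin_cases j
      · simpa [triangularGen] using h1
      · simpa [triangularGen] using h.even x y hx
      · simp [triangularGen]
      · simpa [triangularGen] using gen_even hx y)

/-- The derivation `D` with `D (a b) = σ a * D b + D a * b` that extends `δ`. -/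
def derivation (h : Compat σ δ) : BigAlgebra 𝒱 →ₗ[K] BigAlgebra 𝒱 where
  toFun b := triangular h b 0 1
  map_add' a b := by simp
  map_smul' c a := by simp

@[simp]
theorem derivation_gen (h : Compat σ δ) (x : Double K V) : derivation h (gen 𝒱 x) = δ x := by
  simp [derivation, triangular, triangularGen]

@[simp]
theorem derivation_algebraMap (h : Compat σ δ) (r : K) :
    derivation h (algebraMap K _ r) = 0 := by
  simp [derivation, Matrix.algebraMap_matrix_apply]

theorem derivation_mul (h : Compat σ δ) (a b : BigAlgebra 𝒱) :
    derivation h (a * b) = σ a * derivation h b + derivation h a * b := by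
  have key : ∀ b, triangular h b 0 0 = σ b ∧ triangular h b 1 1 = b := by
    have h10 : ∀ b, triangular h b 1 0 = 0 := by
      intro b
      induction b using induction with
      | hs r => simp [Matrix.algebraMap_matrix_apply]
      | hg x => simp [triangular, triangularGen]
      | hm a b h₁ h₂ => simp [Matrix.mul_apply, Fin.sum_univ_two, h₁, h₂]
      | ha a b h₁ h₂ => simp [h₁, h₂]
    intro b
    induction b using induction with
    | hs r => simp [Matrix.algebraMap_matrix_apply]
    | hg x => simp [triangular, triangularGen]
    | hm a b h₁ h₂ => simp [Matrix.mul_apply, Fin.sum_univ_two, h₁, h₂, h10]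
    | ha a b h₁ h₂ => simp [h₁, h₂]
  simp [derivation, Matrix.mul_apply, Fin.sum_univ_two, key]

theorem derivation_unique (D D' : BigAlgebra 𝒱 →ₗ[K] BigAlgebra 𝒱)
    (hD : ∀ a b, D (a * b) = σ a * D b + D a * b)
    (hD' : ∀ a b, D' (a * b) = σ a * D' b + D' a * b)
    (hg : ∀ x, D (gen 𝒱 x) = D' (gen 𝒱 x)) : D = D' := by
  have one : ∀ E : BigAlgebra 𝒱 →ₗ[K] BigAlgebra 𝒱,
      (∀ a b, E (a * b) = σ a * E b + E a * b) → E 1 = 0 := by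
    intro E hE
    simpa using hE 1 1
  ext b
  induction b using induction with
  | hs r => rw [Algebra.algebraMap_eq_smul_one, map_smul, map_smul, one D hD, one D' hD']
  | hg x => exact hg x
  | hm a b h₁ h₂ => rw [hD, hD', h₁, h₂]
  | ha a b h₁ h₂ => rw [map_add, map_add, h₁, h₂]

/-! #### The big bracket -/

/-- The component of even total degree. -/
def evenComp (T : BigAlgebra 𝒱) : BigAlgebra 𝒱 := (2⁻¹ : K) • (T + invol 𝒱 T)

/-- The component of odd total degree. -/
def oddComp (T : BigAlgebra 𝒱) : BigAlgebra 𝒱 := (2⁻¹ : K) • (T - invol 𝒱 T)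

theorem invol_evenComp (T : BigAlgebra 𝒱) : invol 𝒱 (evenComp T) = evenComp T := by
  simp only [evenComp, map_smul, map_add, invol_invol, add_comm]

theorem invol_oddComp (T : BigAlgebra 𝒱) : invol 𝒱 (oddComp T) = -oddComp T := by
  simp only [oddComp, map_smul, map_sub, invol_invol]
  rw [← smul_neg, neg_sub]

section Bracket

variable [CharZero K]

variable (𝒱) in
/-- The bracket `[x, ·]` with a generator `x` of odd total degree (the even part of `x` is taken):
the derivation `D (a b) = ± a * D b + D a * b` with `D y = ⟨x, y⟩` on the generators. -/
def contractEven (x : Double K V) : BigAlgebra 𝒱 →ₗ[K] BigAlgebra 𝒱 :=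
  derivation (σ := invol 𝒱)
    (δ := (Algebra.linearMap K (BigAlgebra 𝒱)) ∘ₗ pairing 𝒱 (evenPart 𝒱 x))
    { odd := fun y z hy hz => by
        simp [hy, hz, ← Algebra.commutes, add_comm]
      even := fun y z hy => by
        simp [hy, pairing_eq_zero (doubleParity_evenPart 𝒱 x) hy, ← Algebra.commutes] }

variable (𝒱) in
/-- The bracket `[x, ·]` with a generator `x` of even total degree (the odd part of `x` is taken):
the derivation `D (a b) = a * D b + D a * b` with `D y = ⟨x, y⟩` on the generators. -/
def contractOdd (x : Double K V) : BigAlgebra 𝒱 →ₗ[K] BigAlgebra 𝒱 :=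
  derivation (σ := AlgHom.id K _)
    (δ := (Algebra.linearMap K (BigAlgebra 𝒱)) ∘ₗ pairing 𝒱 (oddPart 𝒱 x))
    { odd := fun y z hy hz => by
        simp [pairing_eq_zero' (doubleParity_oddPart 𝒱 x) hy,
          pairing_eq_zero' (doubleParity_oddPart 𝒱 x) hz]
      even := fun y z hy => by
        simp [← Algebra.commutes, add_comm] }

theorem contractEven_mul (x : Double K V) (a b : BigAlgebra 𝒱) :
    contractEven 𝒱 x (a * b) = invol 𝒱 a * contractEven 𝒱 x b + contractEven 𝒱 x a * b :=
  derivation_mul _ a b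

theorem contractOdd_mul (x : Double K V) (a b : BigAlgebra 𝒱) :
    contractOdd 𝒱 x (a * b) = a * contractOdd 𝒱 x b + contractOdd 𝒱 x a * b :=
  derivation_mul _ a b

theorem contractEven_gen (x y : Double K V) :
    contractEven 𝒱 x (gen 𝒱 y) = algebraMap K _ (pairing 𝒱 (evenPart 𝒱 x) y) := by
  simp [contractEven]

theorem contractOdd_gen (x y : Double K V) :
    contractOdd 𝒱 x (gen 𝒱 y) = algebraMap K _ (pairing 𝒱 (oddPart 𝒱 x) y) := by
  simp [contractOdd]

variable (𝒱) in
/-- `contractEven` as a bilinear map. -/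
def contractEvenHom : Double K V →ₗ[K] BigAlgebra 𝒱 →ₗ[K] BigAlgebra 𝒱 where
  toFun := contractEven 𝒱
  map_add' x y := derivation_unique (σ := invol 𝒱) _ _ (contractEven_mul _)
    (fun a b => by simp only [LinearMap.add_apply, contractEven_mul, mul_add, add_mul]; abel)
    (fun z => by simp [contractEven_gen])
  map_smul' c x := derivation_unique (σ := invol 𝒱) _ _ (contractEven_mul _)
    (fun a b => by simp [contractEven_mul])
    (fun z => by simp [contractEven_gen, Algebra.smul_def])

variable (𝒱) in
/-- `contractOdd` as a bilinear map. -/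
def contractOddHom : Double K V →ₗ[K] BigAlgebra 𝒱 →ₗ[K] BigAlgebra 𝒱 where
  toFun := contractOdd 𝒱
  map_add' x y := derivation_unique (σ := AlgHom.id K _) _ _ (contractOdd_mul _)
    (fun a b => by
      simp only [LinearMap.add_apply, contractOdd_mul, mul_add, add_mul, AlgHom.id_apply]; abel)
    (fun z => by simp [contractOdd_gen])
  map_smul' c x := derivation_unique (σ := AlgHom.id K _) _ _ (contractOdd_mul _)
    (fun a b => by simp [contractOdd_mul])
    (fun z => by simp [contractOdd_gen, Algebra.smul_def])

variable (𝒱) in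
/-- The bracket `[T, x]` with a generator `x` on the right, by graded skew-symmetry:
`[T, x] = -[x, T]` if `x` has even total degree, and `[T, x] = -(-1) ^ |T| [x, T]` if `x` has odd
total degree. -/
def bracketGen : BigAlgebra 𝒱 →ₗ[K] Double K V →ₗ[K] BigAlgebra 𝒱 :=
  -((contractOddHom 𝒱).flip + (contractEvenHom 𝒱).flip ∘ₗ (invol 𝒱).toLinearMap)

theorem bracketGen_apply (T : BigAlgebra 𝒱) (x : Double K V) :
    bracketGen 𝒱 T x = -(contractOdd 𝒱 x T + contractEven 𝒱 x (invol 𝒱 T)) := rfl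

theorem invol_contractEven (x : Double K V) (b : BigAlgebra 𝒱) :
    invol 𝒱 (contractEven 𝒱 x b) = -contractEven 𝒱 x (invol 𝒱 b) := by
  induction b using induction with
  | hs r => simp [contractEven]
  | hg y =>
    rw [invol_gen, contractEven_gen, map_neg, contractEven_gen, AlgHom.commutes, neg_neg]
    congr 1
    conv_rhs => rw [← doubleParity_evenPart 𝒱 x, pairing_parity]
  | hm a b h₁ h₂ => simp only [contractEven_mul, map_add, map_mul, h₁, h₂]; simp; abel
  | ha a b h₁ h₂ => simp only [map_add, h₁, h₂]; abel

theorem invol_contractOdd (x : Double K V) (b : BigAlgebra 𝒱) :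
    invol 𝒱 (contractOdd 𝒱 x b) = contractOdd 𝒱 x (invol 𝒱 b) := by
  induction b using induction with
  | hs r => simp [contractOdd]
  | hg y =>
    rw [invol_gen, contractOdd_gen, map_neg, contractOdd_gen, AlgHom.commutes, ← map_neg]
    congr 1
    conv_lhs => rw [← pairing_parity, doubleParity_oddPart]
    simp
  | hm a b h₁ h₂ => simp only [contractOdd_mul, map_add, map_mul, h₁, h₂]
  | ha a b h₁ h₂ => simp only [map_add, h₁, h₂]

theorem bracketGen_even (T : BigAlgebra 𝒱) {x : Double K V} (hx : doubleParity 𝒱 x = x) :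
    invol 𝒱 (bracketGen 𝒱 T x) = -bracketGen 𝒱 (invol 𝒱 T) x := by
  have h : contractOdd 𝒱 x = 0 := by
    change contractOddHom 𝒱 x = 0
    refine derivation_unique (σ := AlgHom.id K _) _ _ (contractOdd_mul _) (by simp) fun z => ?_
    change contractOdd 𝒱 x _ = _
    simp [contractOdd_gen, oddPart_even hx]
  simp [bracketGen_apply, h, invol_contractEven]

theorem bracketGen_odd (T : BigAlgebra 𝒱) {x : Double K V} (hx : doubleParity 𝒱 x = -x) :
    invol 𝒱 (bracketGen 𝒱 T x) = bracketGen 𝒱 (invol 𝒱 T) x := by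
  have h : contractEven 𝒱 x = 0 := by
    refine derivation_unique (σ := invol 𝒱) _ _ (contractEven_mul _) (by simp) fun z => ?_
    simp [contractEven_gen, evenPart_odd hx]
  simp [bracketGen_apply, h, invol_contractOdd]

theorem compat_even {T : BigAlgebra 𝒱} (hT : invol 𝒱 T = T) :
    Compat (AlgHom.id K _) (bracketGen 𝒱 T) where
  odd x y hx hy := by
    have h1 := bracketGen_even T hx
    have h2 := bracketGen_even T hy
    rw [hT] at h1 h2
    simp only [AlgHom.id_apply]
    rw [gen_mul_odd hx, gen_mul_odd hy, h1, h2]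
    simp
  even x y hx := by
    have h1 := bracketGen_odd T hx
    rw [hT] at h1
    simp only [AlgHom.id_apply]
    have h3 : gen 𝒱 y * bracketGen 𝒱 T x = bracketGen 𝒱 T x * gen 𝒱 y := by
      rw [← evenPart_add_oddPart 𝒱 y, map_add, add_mul,
        gen_mul_odd (doubleParity_evenPart 𝒱 y), gen_mul_even (doubleParity_oddPart 𝒱 y), h1,
        mul_add]
    rw [gen_mul_even hx, h3, add_comm]

theorem compat_odd {T : BigAlgebra 𝒱} (hT : invol 𝒱 T = -T) :
    Compat (invol 𝒱) (bracketGen 𝒱 T) where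
  odd x y hx hy := by
    have h1 := bracketGen_even T hx
    have h2 := bracketGen_even T hy
    simp only [hT, map_neg, LinearMap.neg_apply, neg_neg] at h1 h2
    rw [invol_gen, invol_gen, hx, hy, neg_mul, neg_mul, gen_mul_odd hx, gen_mul_odd hy, h1, h2]
    abel
  even x y hx := by
    have h1 := bracketGen_odd T hx
    simp only [hT, map_neg, LinearMap.neg_apply] at h1
    rw [invol_gen, hx, map_neg, neg_neg, gen_mul_even hx]
    have h3 : invol 𝒱 (gen 𝒱 y) * bracketGen 𝒱 T x = bracketGen 𝒱 T x * gen 𝒱 y := by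
      rw [← evenPart_add_oddPart 𝒱 y, map_add, map_add, add_mul, invol_gen, invol_gen,
        doubleParity_evenPart, doubleParity_oddPart, map_neg, neg_neg, neg_mul,
        gen_mul_odd (doubleParity_evenPart 𝒱 y),
        gen_mul_even (doubleParity_oddPart 𝒱 y), h1, mul_add]
      simp
    rw [h3, add_comm]

theorem evenComp_add_oddComp (T : BigAlgebra 𝒱) : evenComp T + oddComp T = T := by
  rw [evenComp, oddComp, ← smul_add, add_add_sub_cancel, ← two_smul K, smul_smul]
  simp

variable (𝒱) in
/-- The bracket with the component of even total degree of the first argument, as the derivation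
`[T, a b] = a * [T, b] + [T, a] * b`. -/
def bracketEven : BigAlgebra 𝒱 →ₗ[K] BigAlgebra 𝒱 →ₗ[K] BigAlgebra 𝒱 where
  toFun T := derivation (compat_even (invol_evenComp T))
  map_add' S T := derivation_unique (σ := AlgHom.id K _) _ _ (derivation_mul _)
    (fun a b => by simp only [LinearMap.add_apply, derivation_mul, mul_add, add_mul]; abel)
    (fun z => by
      simp only [derivation_gen, LinearMap.add_apply, evenComp, map_add, map_smul,
        LinearMap.smul_apply, smul_add]
      abel)
  map_smul' c T := derivation_unique (σ := AlgHom.id K _) _ _ (derivation_mul _)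
    (fun a b => by simp [derivation_mul])
    (fun z => by simp [evenComp, smul_comm c])

variable (𝒱) in
/-- The bracket with the component of odd total degree of the first argument, as the derivation
`[T, a b] = (-1) ^ |a| a * [T, b] + [T, a] * b`. -/
def bracketOdd : BigAlgebra 𝒱 →ₗ[K] BigAlgebra 𝒱 →ₗ[K] BigAlgebra 𝒱 where
  toFun T := derivation (compat_odd (invol_oddComp T))
  map_add' S T := derivation_unique (σ := invol 𝒱) _ _ (derivation_mul _)
    (fun a b => by simp only [LinearMap.add_apply, derivation_mul, mul_add, add_mul]; abel)
    (fun z => by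
      simp only [derivation_gen, LinearMap.add_apply, LinearMap.sub_apply, oddComp, map_add,
        map_smul, map_sub, LinearMap.smul_apply, smul_add, smul_sub]
      abel)
  map_smul' c T := derivation_unique (σ := invol 𝒱) _ _ (derivation_mul _)
    (fun a b => by simp [derivation_mul])
    (fun z => by simp [oddComp, smul_comm c, smul_sub])

variable (𝒱) in
/-- The big bracket: the bilinear bracket with `[x, y] = ⟨x, y⟩` for generators `x` and `y` that
satisfies the graded Leibniz rule `[T, a b] = [T, a] b + (-1) ^ (|T| |a|) a [T, b]` and is graded
skew-symmetric, all with respect to the total degree. -/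
def bigBracket : BigAlgebra 𝒱 →ₗ[K] BigAlgebra 𝒱 →ₗ[K] BigAlgebra 𝒱 :=
  bracketEven 𝒱 + bracketOdd 𝒱

theorem bigBracket_gen (T : BigAlgebra 𝒱) (x : Double K V) :
    bigBracket 𝒱 T (gen 𝒱 x) = bracketGen 𝒱 T x := by
  simp only [bigBracket, bracketEven, bracketOdd, LinearMap.add_apply, LinearMap.coe_mk,
    AddHom.coe_mk, derivation_gen]
  rw [← LinearMap.add_apply, ← map_add, evenComp_add_oddComp]

theorem bigBracket_gen_gen (x y : Double K V) :
    bigBracket 𝒱 (gen 𝒱 x) (gen 𝒱 y) = algebraMap K _ (pairing 𝒱 x y) := by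
  have h : pairing 𝒱 (oddPart 𝒱 y) x = -pairing 𝒱 x (oddPart 𝒱 y) := by
    rw [pairing_swap, doubleParity_oddPart, map_neg]
  rw [bigBracket_gen, bracketGen_apply, invol_gen, map_neg, contractOdd_gen, contractEven_gen,
    ← pairing_swap, h]
  conv_rhs => rw [← evenPart_add_oddPart 𝒱 y, map_add, map_add]
  rw [map_neg]
  abel

theorem bigBracket_gen_left (x : Double K V) :
    bigBracket 𝒱 (gen 𝒱 x) = contractOdd 𝒱 x + contractEven 𝒱 x := by
  have h1 : evenComp (gen 𝒱 x) = gen 𝒱 (oddPart 𝒱 x) := by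
    simp [evenComp, oddPart, sub_eq_add_neg]
  have h2 : oddComp (gen 𝒱 x) = gen 𝒱 (evenPart 𝒱 x) := by
    simp [oddComp, evenPart]
  refine congrArg₂ (fun D D' : BigAlgebra 𝒱 →ₗ[K] BigAlgebra 𝒱 => D + D') ?_ ?_
  · refine derivation_unique (σ := AlgHom.id K _) _ _ (derivation_mul _) (contractOdd_mul x) ?_
    intro y
    simp only [bracketEven, LinearMap.coe_mk, AddHom.coe_mk, derivation_gen, h1,
      ← bigBracket_gen, bigBracket_gen_gen, contractOdd_gen]
  · refine derivation_unique (σ := invol 𝒱) _ _ (derivation_mul _) (contractEven_mul x) ?_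
    intro y
    simp only [bracketOdd, LinearMap.coe_mk, AddHom.coe_mk, derivation_gen, h2,
      ← bigBracket_gen, bigBracket_gen_gen, contractEven_gen]

theorem bigBracket_mul_even {T : BigAlgebra 𝒱} (hT : invol 𝒱 T = T) (a b : BigAlgebra 𝒱) :
    bigBracket 𝒱 T (a * b) = bigBracket 𝒱 T a * b + a * bigBracket 𝒱 T b := by
  have h : bracketOdd 𝒱 T = 0 :=
    derivation_unique (σ := invol 𝒱) _ _ (derivation_mul _) (by simp)
      (fun x => by simp [bracketOdd, oddComp, hT])
  simp only [bigBracket, LinearMap.add_apply, h, add_zero]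
  simp only [bracketEven, LinearMap.coe_mk, AddHom.coe_mk, derivation_mul, AlgHom.id_apply]
  abel

theorem bigBracket_mul_odd {T : BigAlgebra 𝒱} (hT : invol 𝒱 T = -T) (a b : BigAlgebra 𝒱) :
    bigBracket 𝒱 T (a * b) = bigBracket 𝒱 T a * b + invol 𝒱 a * bigBracket 𝒱 T b := by
  have h : bracketEven 𝒱 T = 0 :=
    derivation_unique (σ := AlgHom.id K _) _ _ (derivation_mul _) (by simp)
      (fun x => by simp [bracketEven, evenComp, hT])
  simp only [bigBracket, LinearMap.add_apply, h, zero_add]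
  simp only [bracketOdd, LinearMap.coe_mk, AddHom.coe_mk, derivation_mul]
  abel

end Bracket

/-! #### Degrees, the linear part and the iterated adjoint action -/

variable (𝒱) in
/-- The elements of total degree `d` in `Λ^k V* ⊗ Λ^l V`: the span of the products
`ξ₁ ⋯ ξₖ v₁ ⋯ vₗ` of homogeneous `ξᵢ ∈ V*` and `vⱼ ∈ V` with
`∑ |ξᵢ| + ∑ |vⱼ| + (k + l - 2) = d`. -/
def homogeneousComponent (k l : ℕ) (d : ℤ) : Submodule K (BigAlgebra 𝒱) :=
  Submodule.span K {b | ∃ (ξ : Fin k → Module.Dual K V) (v : Fin l → V)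
    (a : Fin k → ℤ) (c : Fin l → ℤ),
    (∀ i, ξ i ∈ dualGrading 𝒱 (a i)) ∧ (∀ j, v j ∈ 𝒱 (c j)) ∧
    ∑ i, a i + ∑ j, c j + ((k : ℤ) + (l : ℤ) - 2) = d ∧
    b = (List.ofFn fun i => gen 𝒱 (0, ξ i)).prod * (List.ofFn fun j => gen 𝒱 (v j, 0)).prod}

variable (𝒱) in
/-- The projection of the algebra to its linear part `V ⊕ V*`, which vanishes on `Λ^k V* ⊗ Λ^l V`
if `k + l ≠ 1`. -/
def linearPart : BigAlgebra 𝒱 →ₗ[K] Double K V := by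
  letI : Module Kᵐᵒᵖ (Double K V) := Module.compHom _ ((RingHom.id K).fromOpposite mul_comm)
  haveI : IsCentralScalar K (Double K V) := ⟨fun r m => rfl⟩
  exact (TrivSqZeroExt.sndHom K (Double K V)).comp
    (lift (TrivSqZeroExt.inrHom K (Double K V)) (by simp) (by simp)).toLinearMap

theorem linearPart_gen (x : Double K V) : linearPart 𝒱 (gen 𝒱 x) = x := by
  simp [linearPart]

section Iad

variable [CharZero K]

variable (𝒱) in
/-- The iterated adjoint action `[[⋯[[T, x₁], x₂]⋯], xₙ]`. -/
def iad : (n : ℕ) → BigAlgebra 𝒱 →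
    MultilinearMap K (fun _ : Fin n => Double K V) (BigAlgebra 𝒱)
  | 0, T => MultilinearMap.constOfIsEmpty K _ T
  | n + 1, T => MultilinearMap.uncurryRight (M := fun _ : Fin (n + 1) => Double K V)
      (((bigBracket 𝒱).compl₂ (gen 𝒱)).compMultilinearMap (iad n T))

theorem iad_zero (T : BigAlgebra 𝒱) (x : Fin 0 → Double K V) : iad 𝒱 0 T x = T := rfl

theorem iad_succ (n : ℕ) (T : BigAlgebra 𝒱) (x : Fin (n + 1) → Double K V) :
    iad 𝒱 (n + 1) T x = bigBracket 𝒱 (iad 𝒱 n T (Fin.init x)) (gen 𝒱 (x (Fin.last n))) := rfl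

end Iad

end BigAlgebra

end Algebra

/-! ### `L∞`-algebras, Manin `L∞`-triples and `L∞`-bialgebras -/

section Structures

variable {K : Type*} [Field K]

/-- The Koszul sign of the unshuffle that moves the elements with index in `S` to the front, for
elements of degrees `a i`, that is, of total degrees `a i - 1`. -/
def koszulSign {n : ℕ} (a : Fin n → ℤ) (S : Finset (Fin n)) : ℤˣ :=
  ∏ i ∈ Sᶜ, ∏ j ∈ S, if i < j then ((a i - 1) * (a j - 1)).negOnePow else 1

/-- An `L∞`-algebra structure on a graded space: brackets `lam n` in `n ≥ 1` arguments of degree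
`2 - n` on the graded exterior powers `Λ^n g ≃ Sym^n (g[1])`, so that interchanging two adjacent
arguments gives the Koszul sign of their total degrees `|v| - 1`, with the higher Jacobi identities.
The sum over the unshuffles is written as a sum over the sets `S` of indices that are moved to the
front. -/
structure IsLInfty {g : Type*} [AddCommGroup g] [Module K g] (gr : ℤ → Submodule K g)
    (lam : (n : ℕ) → MultilinearMap K (fun _ : Fin n => g) g) : Prop where
  zero : lam 0 = 0
  degree : ∀ (n : ℕ) (v : Fin n → g) (a : Fin n → ℤ), (∀ i, v i ∈ gr (a i)) →
    lam n v ∈ gr (∑ i, a i + (2 - (n : ℤ)))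
  symm : ∀ (n : ℕ) (v : Fin n → g) (a : Fin n → ℤ), (∀ i, v i ∈ gr (a i)) →
    ∀ i j : Fin n, (i : ℕ) + 1 = j →
      lam n (v ∘ Equiv.swap i j) = (((a i - 1) * (a j - 1)).negOnePow : ℤ) • lam n v
  jacobi : ∀ (n : ℕ) (v : Fin n → g) (a : Fin n → ℤ), (∀ i, v i ∈ gr (a i)) →
    ∑ S : Finset (Fin n), (koszulSign a S : ℤ) •
      lam (Sᶜ.card + 1) (Fin.cons (α := fun _ => g)
        (lam S.card fun i => v (S.orderEmbOfFin rfl i))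
        (fun i => v (Sᶜ.orderEmbOfFin rfl i))) = 0

/-- The data of a Manin `L∞`-triple `(g, g₊, g₋)`. -/
structure TripleData (K g : Type*) [Field K] [AddCommGroup g] [Module K g] where
  grading : ℤ → Submodule K g
  plus : Submodule K g
  minus : Submodule K g
  form : LinearMap.BilinForm K g
  bracket : (n : ℕ) → MultilinearMap K (fun _ : Fin n => g) g

/-- The grading that a subspace inherits. -/
def inducedGrading {g : Type*} [AddCommGroup g] [Module K g] (gr : ℤ → Submodule K g)
    (W : Submodule K g) (a : ℤ) : Submodule K W :=
  (gr a).comap W.subtype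

/-- Manin `L∞`-triples: `g` is an `L∞`-algebra, `g = g₊ ⊕ g₋` for graded subspaces that are
`L∞`-subalgebras and isotropic for a nondegenerate graded symmetric form of degree `0` for which
the brackets are invariant. -/
structure IsManinTriple {g : Type*} [AddCommGroup g] [Module K g] (M : TripleData K g) :
    Prop where
  graded : DirectSum.IsInternal M.grading
  lInfty : IsLInfty M.grading M.bracket
  isCompl : IsCompl M.plus M.minus
  plus_graded : DirectSum.IsInternal (inducedGrading M.grading M.plus)
  minus_graded : DirectSum.IsInternal (inducedGrading M.grading M.minus)
  plus_closed : ∀ (n : ℕ) (v : Fin n → g), (∀ i, v i ∈ M.plus) → M.bracket n v ∈ M.plus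
  minus_closed : ∀ (n : ℕ) (v : Fin n → g), (∀ i, v i ∈ M.minus) → M.bracket n v ∈ M.minus
  form_degree : ∀ (a b : ℤ), a + b ≠ 0 → ∀ x ∈ M.grading a, ∀ y ∈ M.grading b, M.form x y = 0
  form_symm : ∀ (a b : ℤ), ∀ x ∈ M.grading a, ∀ y ∈ M.grading b,
    M.form x y = ((a * b).negOnePow : ℤ) • M.form y x
  form_nondegenerate : M.form.Nondegenerate
  plus_isotropic : ∀ x ∈ M.plus, ∀ y ∈ M.plus, M.form x y = 0
  minus_isotropic : ∀ x ∈ M.minus, ∀ y ∈ M.minus, M.form x y = 0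
  invariant : ∀ (n : ℕ) (v : Fin n → g) (a b : ℤ), ∀ x ∈ M.grading a, ∀ y ∈ M.grading b,
    M.form (M.bracket (n + 1) (Fin.snoc (α := fun _ => g) v x)) y =
      (((a - 1) * (b - 1)).negOnePow : ℤ) •
        M.form (M.bracket (n + 1) (Fin.snoc (α := fun _ => g) v y)) x

/-- Isomorphisms of triples. -/
structure IsTripleIso {g g' : Type*} [AddCommGroup g] [Module K g] [AddCommGroup g']
    [Module K g'] (M : TripleData K g) (N : TripleData K g') (F : g ≃ₗ[K] g') : Prop where
  grading : ∀ a, (M.grading a).map (F : g →ₗ[K] g') = N.grading a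
  plus : M.plus.map (F : g →ₗ[K] g') = N.plus
  minus : M.minus.map (F : g →ₗ[K] g') = N.minus
  form : ∀ x y, N.form (F x) (F y) = M.form x y
  bracket : ∀ (n : ℕ) (v : Fin n → g), N.bracket n (fun i => F (v i)) = F (M.bracket n v)

variable {V : Type*} [AddCommGroup V] [Module K V]

/-- The triple `(V ⊕ V*, V, V*)` with the natural pairing and given brackets. -/
def doubleTriple (𝒱 : ℤ → Submodule K V)
    (lam : (n : ℕ) → MultilinearMap K (fun _ : Fin n => Double K V) (Double K V)) :
    TripleData K (Double K V) where
  grading := doubleGrading 𝒱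
  plus := LinearMap.range (LinearMap.inl K V (Module.Dual K V))
  minus := LinearMap.range (LinearMap.inr K V (Module.Dual K V))
  form := pairing 𝒱
  bracket := lam

/-- An `L∞`-bialgebra structure on `V`: a formal sum `T = ∑ t k l` over `k, l ≥ 1` of elements
`t k l ∈ Λ^k V* ⊗ Λ^l V` of total degree `1` with `[T, T] = 0` for the big bracket, that is, with
vanishing components of `[T, T]` in all `Λ^p V* ⊗ Λ^q V`. -/
structure IsLInftyBialgebra [CharZero K] (𝒱 : ℤ → Submodule K V)
    (t : ℕ → ℕ → BigAlgebra 𝒱) : Prop where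
  degree : ∀ k l, t k l ∈ BigAlgebra.homogeneousComponent 𝒱 k l 1
  zero_left : ∀ l, t 0 l = 0
  zero_right : ∀ k, t k 0 = 0
  maurer_cartan : ∀ p q : ℕ,
    ∑ x ∈ Finset.HasAntidiagonal.antidiagonal (p + 1), ∑ y ∈ Finset.HasAntidiagonal.antidiagonal (q + 1),
      BigAlgebra.bigBracket 𝒱 (t x.1 y.1) (t x.2 y.2) = 0

/-- The brackets on `V ⊕ V*` given by the iterated adjoint action of `T = ∑ t k l`: the bracket of
`x₁, …, xₙ` is the component of `[[⋯[[T, x₁], x₂]⋯], xₙ]` in `V ⊕ V*`, to which exactly the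
`t k l` with `k + l = n + 1` contribute. -/
def derivedBrackets [CharZero K] (𝒱 : ℤ → Submodule K V) (t : ℕ → ℕ → BigAlgebra 𝒱) (n : ℕ) :
    MultilinearMap K (fun _ : Fin n => Double K V) (Double K V) :=
  ∑ x ∈ Finset.HasAntidiagonal.antidiagonal (n + 1),
    (BigAlgebra.linearPart 𝒱).compMultilinearMap (BigAlgebra.iad 𝒱 n (t x.1 x.2))

/-- The linear isomorphism `V ⊕ V* ≃ V' ⊕ V'*` induced by `f : V ≃ V'`. -/
def doubleEquiv {V' : Type*} [AddCommGroup V'] [Module K V'] (f : V ≃ₗ[K] V') :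
    Double K V ≃ₗ[K] Double K V' :=
  f.prodCongr f.dualMap.symm

/-- Isomorphisms of `L∞`-bialgebras: graded linear isomorphisms such that the induced homomorphism
`⨁ Λ^k V* ⊗ Λ^l V → ⨁ Λ^k V'* ⊗ Λ^l V'` maps one structure to the other. -/
structure IsBialgebraIso {V' : Type*} [AddCommGroup V'] [Module K V']
    {𝒱 : ℤ → Submodule K V} {𝒱' : ℤ → Submodule K V'} (t : ℕ → ℕ → BigAlgebra 𝒱)
    (t' : ℕ → ℕ → BigAlgebra 𝒱') (f : V ≃ₗ[K] V') : Prop where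
  grading : ∀ a, (𝒱 a).map (f : V →ₗ[K] V') = 𝒱' a
  structures : ∃ φ : BigAlgebra 𝒱 →ₐ[K] BigAlgebra 𝒱',
    (∀ x, φ (BigAlgebra.gen 𝒱 x) = BigAlgebra.gen 𝒱' (doubleEquiv f x)) ∧
      ∀ k l, φ (t k l) = t' k l

end Structures

end

end ManinLInfty

open ManinLInfty

/-! An element of `Λ^(n+1) (V ⊕ V*)` is the same thing as a graded symmetric form in `n + 1`
arguments on `V ⊕ V*`: bracket it on the right with `n + 1` generators, one after the other, until a
scalar is left. In characteristic `0` this rests on Euler's formula for homogeneous polynomials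
(`sum_ad_mul_codual`). The formula shows that an element is determined by its contractions
(`eq_zero_of_iadList`), and, divided by the degree, it constructs the element that belongs to a
given form (`exists_iadList_eq`). Stopping one step earlier leaves a generator, which is the bracket
`λ_n(x₁, …, xₙ)`; the form is its pairing with `xₙ₊₁`. Hence graded symmetry of the form is symmetry
of `λ_n` together with invariance of the pairing (`gradedSymm_bracketForm`), and total degree `1` is
degree `2 - n` of `λ_n`.

The equation `[T, T] = 0` corresponds to the Jacobi identities because contraction with a generator
is a graded derivation of the big bracket (`ad_bigBracket`). Contracting `[A, B]` with `x₁, …, xₙ`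
therefore distributes the `xᵢ` over the two factors, and a linear part survives only where one
factor has itself become linear (`linearPart_bigBracket`). What remains is the sum over unshuffles
(`linearPart_iadList_bigBracket`), twice for `A = B = T` (`linearPart_iadList_squareComponent`).

The components `t 0 l` and `t k 0` are the ones seen by contractions with `V*` alone or with `V`
alone. They vanish exactly when the two isotropic summands are closed under the brackets
(`IsLInftyBialgebra.plus_closed`, `IsLInftyBialgebra.minus_closed`, `eq_zero_of_extreme_weight`).
All bookkeeping of bidegrees is done with eigenvalues of derivations (`weightDer`) that count
factors or multiply by the degree, so no basis of the exterior algebra is needed.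

For a general triple the form identifies `g₋` with the dual of `g₊`, and the brackets are
transported to the double of `g₊`. An isomorphism that is the identity on `g₊` is forced by the form
(`IsManinTriple.eq_doubleEquivTriple`). Likewise an isomorphism between doubles is `f ⊕ (f*)⁻¹`
(`IsTripleIso.exists_eq_doubleEquiv`), and it respects the structures because the brackets determine
them (`eq_of_derivedBrackets_eq`). -/

namespace ManinLInfty

/-! ### Gradings of finite-dimensional spaces and the Euler operator -/

section Gradings

variable {K : Type*} [Field K] {X : Type*} [AddCommGroup X] [Module K X]
  {Y : Type*} [AddCommGroup Y] [Module K Y]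

/-- A basis of homogeneous vectors, with their degrees. -/
structure HomogeneousBasis (gr : ℤ → Submodule K X) (ι : Type*) where
  vec : Module.Basis ι K X
  deg : ι → ℤ
  mem : ∀ i, vec i ∈ gr (deg i)
  repr_eq_zero : ∀ a, ∀ x ∈ gr a, ∀ i, deg i ≠ a → vec.repr x i = 0

theorem exists_homogeneousBasis [FiniteDimensional K X] {gr : ℤ → Submodule K X}
    (h : DirectSum.IsInternal gr) : ∃ n : ℕ, Nonempty (HomogeneousBasis gr (Fin n)) := by
  let B := h.collectedBasis (fun a => Module.finBasis K (gr a))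
  have : Finite (Σ a, Fin (Module.finrank K (gr a))) := Module.Finite.finite_basis B
  let f := Finite.equivFin (Σ a, Fin (Module.finrank K (gr a)))
  refine ⟨_, ⟨⟨B.reindex f, fun i => (f.symm i).1, fun i => ?_, fun a x hx i hi => ?_⟩⟩⟩
  · rw [Module.Basis.reindex_apply]
    exact h.collectedBasis_mem _ _
  · rw [Module.Basis.repr_reindex_apply]
    exact h.collectedBasis_repr_of_mem_ne _ hi.symm hx

namespace HomogeneousBasis

variable {gr : ℤ → Submodule K X} {ι : Type*} (b : HomogeneousBasis gr ι)

/-- The operator that multiplies elements by their degree. -/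
noncomputable def euler : X →ₗ[K] X := b.vec.constr K fun i => (b.deg i : K) • b.vec i

theorem euler_vec (i : ι) : b.euler (b.vec i) = (b.deg i : K) • b.vec i := by
  simp [euler]

theorem euler_of_mem [Fintype ι] {a : ℤ} {x : X} (hx : x ∈ gr a) : b.euler x = (a : K) • x := by
  conv_lhs => rw [← b.vec.sum_repr x]
  conv_rhs => rw [← b.vec.sum_repr x]
  rw [map_sum, Finset.smul_sum]
  refine Finset.sum_congr rfl fun i _ => ?_
  by_cases hi : b.deg i = a
  · rw [map_smul, euler_vec, hi, smul_comm]
  · rw [b.repr_eq_zero a x hx i hi]; simp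

/-- The Euler operator has eigenvalue `a` on the part of degree `a`. In characteristic `0` these
eigenvalues are distinct, so the parts are independent, and the basis shows that they span. -/
theorem isInternal (b : HomogeneousBasis gr ι) [Fintype ι] [CharZero K] :
    DirectSum.IsInternal gr := by
  refine DirectSum.isInternal_submodule_of_iSupIndep_of_iSup_eq_top ?_ ?_
  · refine ((Module.End.eigenspaces_iSupIndep b.euler).comp
      (Int.cast_injective (α := K))).mono fun a x hx => ?_
    exact Module.End.mem_eigenspace_iff.2 (b.euler_of_mem hx)
  · rw [eq_top_iff, ← b.vec.span_eq, Submodule.span_le]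
    rintro _ ⟨i, rfl⟩
    exact Submodule.mem_iSup_of_mem _ (b.mem i)

end HomogeneousBasis

theorem iSup_induction_top {α : Type*} {gr : α → Submodule K X} (h : ⨆ a, gr a = ⊤)
    {C : X → Prop} (h0 : C 0) (ha : ∀ x y, C x → C y → C (x + y))
    (hm : ∀ a, ∀ x ∈ gr a, C x) (x : X) : C x :=
  Submodule.iSup_induction gr (motive := C) (x := x) (by rw [h]; trivial) hm h0 ha

/-- A spanning family inside an independent one fills it: split `x` along `gr`; the remainder
outside index `a` lies in `gr' a` and in the sum of the other `gr' b`, hence is `0`. This serves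
both to compare gradings and to show that elements of polynomial degree `0` are scalars. -/
theorem mem_of_le_of_iSup_eq_top {α : Type*} {gr gr' : α → Submodule K X}
    (h : ⨆ a, gr a = ⊤) (h' : iSupIndep gr') (hle : ∀ a, gr a ≤ gr' a) {a : α} {x : X}
    (hx : x ∈ gr' a) : x ∈ gr a := by
  classical
  have hx' : x ∈ gr a ⊔ ⨆ (b) (_ : b ≠ a), gr b := by
    have : gr a ⊔ ⨆ (b) (_ : b ≠ a), gr b = ⊤ := by
      rw [← h, iSup_split_single gr a]
    rw [this]; trivial
  obtain ⟨y, hy, z, hz, rfl⟩ := Submodule.mem_sup.1 hx'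
  have hz' : z ∈ ⨆ (b) (_ : b ≠ a), gr' b := (iSup₂_mono fun b _ => hle b) hz
  have hza : z ∈ gr' a := by
    have := Submodule.sub_mem _ hx (hle a hy)
    rwa [add_sub_cancel_left] at this
  rw [Submodule.disjoint_def.1 (h' a) z hza hz', add_zero]
  exact hy

theorem map_eq_of_map_le {gr : ℤ → Submodule K X} {gr' : ℤ → Submodule K Y}
    (h : DirectSum.IsInternal gr) (h' : DirectSum.IsInternal gr') (e : X ≃ₗ[K] Y)
    (hle : ∀ a, (gr a).map (e : X →ₗ[K] Y) ≤ gr' a) (a : ℤ) :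
    (gr a).map (e : X →ₗ[K] Y) = gr' a := by
  refine le_antisymm (hle a) fun y hy => ?_
  refine mem_of_le_of_iSup_eq_top (gr := fun a => (gr a).map (e : X →ₗ[K] Y)) ?_
    h'.submodule_iSupIndep hle hy
  rw [← Submodule.map_iSup, h.submodule_iSup_eq_top, Submodule.map_top, LinearEquiv.range]

theorem isInternal_of_map {gr : ℤ → Submodule K X} {gr' : ℤ → Submodule K Y}
    (h : DirectSum.IsInternal gr) (e : X ≃ₗ[K] Y)
    (he : ∀ a, (gr a).map (e : X →ₗ[K] Y) = gr' a) : DirectSum.IsInternal gr' := by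
  refine DirectSum.isInternal_submodule_of_iSupIndep_of_iSup_eq_top ?_ ?_
  · have := h.submodule_iSupIndep.map_orderIso (Submodule.orderIsoMapComap e)
    convert this using 1
    ext1 a
    exact (he a).symm
  · rw [← funext he, ← Submodule.map_iSup, h.submodule_iSup_eq_top, Submodule.map_top,
      LinearEquiv.range]

end Gradings

/-! ### The grading, the pairing and dual bases on the double -/

section DoubleGradings

variable {K : Type*} [Field K] {V : Type*} [AddCommGroup V] [Module K V]
  {𝒱 : ℤ → Submodule K V}

theorem dual_parity_of_mem (h : DirectSum.IsInternal 𝒱) {a : ℤ} {ξ : Module.Dual K V}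
    (hξ : ξ ∈ dualGrading 𝒱 a) : (parity 𝒱).dualMap ξ = (a.negOnePow : ℤ) • ξ := by
  ext v
  induction v using iSup_induction_top h.submodule_iSup_eq_top with
  | h0 => simp
  | ha x y hx hy => rw [map_add, map_add, hx, hy]
  | hm b x hx =>
    rw [LinearMap.dualMap_apply, parity_of_mem h hx, map_zsmul, LinearMap.smul_apply]
    by_cases hb : b = -a
    · rw [hb, Int.negOnePow_neg]
    · rw [hξ b hb x hx]; simp

theorem doubleParity_of_mem (h : DirectSum.IsInternal 𝒱) {a : ℤ} {x : Double K V}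
    (hx : x ∈ doubleGrading 𝒱 a) : doubleParity 𝒱 x = (a.negOnePow : ℤ) • x :=
  Prod.ext (parity_of_mem h hx.1) (dual_parity_of_mem h hx.2)

theorem pairing_apply (x y : Double K V) :
    pairing 𝒱 x y = x.2 y.1 + y.2 (parity 𝒱 x.1) := rfl

theorem pairing_degree (h : DirectSum.IsInternal 𝒱) {a b : ℤ} (hab : a + b ≠ 0)
    {x y : Double K V} (hx : x ∈ doubleGrading 𝒱 a) (hy : y ∈ doubleGrading 𝒱 b) :
    pairing 𝒱 x y = 0 := by
  rw [pairing_apply, parity_of_mem h hx.1, map_zsmul, hx.2 b (by omega) _ hy.1,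
    hy.2 a (by omega) _ hx.1]
  simp

theorem pairing_symm (h : DirectSum.IsInternal 𝒱) {a b : ℤ}
    {x y : Double K V} (hx : x ∈ doubleGrading 𝒱 a) (hy : y ∈ doubleGrading 𝒱 b) :
    pairing 𝒱 x y = ((a * b).negOnePow : ℤ) • pairing 𝒱 y x := by
  by_cases hab : a + b = 0
  · obtain rfl : b = -a := by omega
    rw [pairing_swap, doubleParity_of_mem h hx, map_zsmul, mul_neg, Int.negOnePow_neg]
    -- Only the sign is left: `a * a` and `a` have the same parity.
    congr 2
    rcases Int.even_or_odd a with ha | ha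
    · rw [Int.negOnePow_even _ ha, Int.negOnePow_even _ (ha.mul_left a)]
    · rw [Int.negOnePow_odd _ ha, Int.negOnePow_odd _ (ha.mul ha)]
  · rw [pairing_degree h hab hx hy, pairing_degree h (by omega) hy hx, smul_zero]

theorem parity_bijective (𝒱 : ℤ → Submodule K V) : Function.Bijective (parity 𝒱) :=
  Function.Involutive.bijective (parity_parity 𝒱)

theorem pairing_nondegenerate (𝒱 : ℤ → Submodule K V) : (pairing 𝒱).Nondegenerate := by
  constructor
  · intro x hx
    refine Prod.ext ?_ (LinearMap.ext fun v => by simpa [pairing_apply] using hx (v, 0))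
    have : parity 𝒱 x.1 = 0 := (Module.forall_dual_apply_eq_zero_iff K _).1 fun φ => by
      simpa [pairing_apply] using hx (0, φ)
    exact (map_eq_zero_iff _ (parity_bijective 𝒱).1).1 this
  · intro x hx
    refine Prod.ext ?_ (LinearMap.ext fun v => ?_)
    · exact (Module.forall_dual_apply_eq_zero_iff K _).1 fun φ => by
        simpa [pairing_apply] using hx (0, φ)
    · simpa [pairing_apply, parity_parity] using hx (parity 𝒱 v, 0)

variable {ι : Type*} [Fintype ι] [DecidableEq ι]

namespace HomogeneousBasis

variable (b : HomogeneousBasis 𝒱 ι)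

/-- The dual basis is homogeneous. -/
noncomputable def dual : HomogeneousBasis (dualGrading 𝒱) ι where
  vec := b.vec.dualBasis
  deg i := -b.deg i
  mem i := fun c hc v hv => by
    simpa using b.repr_eq_zero c v hv i (by omega)
  repr_eq_zero a ξ hξ i hi := by
    simpa using hξ (b.deg i) (by omega) _ (b.mem i)

/-- The basis of the double. -/
noncomputable def double : HomogeneousBasis (doubleGrading 𝒱) (ι ⊕ ι) where
  vec := b.vec.prod b.dual.vec
  deg := Sum.elim b.deg b.dual.deg
  mem := by
    rintro (i | i)
    · simpa [doubleGrading] using b.mem i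
    · simpa [doubleGrading] using b.dual.mem i
  repr_eq_zero := by
    rintro a x hx (i | i) hi
    · simpa using b.repr_eq_zero a x.1 hx.1 i hi
    · simpa only [Module.Basis.prod_repr_inr] using b.dual.repr_eq_zero a x.2 hx.2 i hi

theorem double_inl (i : ι) : b.double.vec (Sum.inl i) = (b.vec i, 0) := by
  simp [double]

theorem double_inr (i : ι) : b.double.vec (Sum.inr i) = (0, b.vec.dualBasis i) := by
  simp [double, dual]

theorem double_deg_inr (i : ι) : b.double.deg (Sum.inr i) = -b.deg i := rfl

/-- The family dual to the basis of the double. -/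
noncomputable def codual : ι ⊕ ι → Double K V :=
  Sum.elim (fun i => (0, b.vec.dualBasis i)) (fun i => (parity 𝒱 (b.vec i), 0))

/-- The parity in the second half of `codual` compensates the sign in `⟨v, ξ⟩`, so that `codual` is
dual to the basis when it stands in the first slot of the pairing. This reproducing formula is the
degree-one case of Euler's formula below. -/
theorem sum_pairing_smul_codual (y : Double K V) :
    ∑ j, pairing 𝒱 y (b.double.vec j) • b.codual j = y := by
  rw [Fintype.sum_sum_type]
  simp only [double_inl, double_inr, codual, Sum.elim_inl, Sum.elim_inr, pairing_apply]
  refine Prod.ext ?_ ?_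
  · simp only [Prod.fst_add, Prod.fst_sum, Prod.smul_fst, smul_zero, Finset.sum_const_zero,
      zero_add, map_zero, ← map_smul, ← map_sum]
    have := b.vec.sum_repr (parity 𝒱 y.1)
    simp only [Module.Basis.dualBasis_apply]
    rw [this, parity_parity]
  · ext v
    simp only [Prod.snd_add, Prod.snd_sum, Prod.smul_snd, smul_zero, Finset.sum_const_zero,
      add_zero, LinearMap.zero_apply, LinearMap.sum_apply, LinearMap.smul_apply]
    conv_rhs => rw [← b.vec.sum_repr v, map_sum]
    simp [mul_comm]

theorem codual_mem (h : DirectSum.IsInternal 𝒱) (j : ι ⊕ ι) :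
    b.codual j ∈ doubleGrading 𝒱 (-b.double.deg j) := by
  rcases j with i | i
  · exact ⟨Submodule.zero_mem _, b.dual.mem i⟩
  · refine ⟨?_, Submodule.zero_mem _⟩
    simp only [codual, Sum.elim_inr, double_deg_inr, neg_neg, parity_of_mem h (b.mem i)]
    exact Submodule.smul_of_tower_mem _ _ (b.mem i)

theorem pairing_codual (h : DirectSum.IsInternal 𝒱) (i j : ι ⊕ ι) :
    pairing 𝒱 (b.codual i) (b.double.vec j) = if i = j then 1 else 0 := by
  have := h
  rcases i with i | i <;> rcases j with j | j <;>
    simp [double_inl, double_inr, codual, pairing_apply, parity_parity, Finsupp.single_apply,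
      eq_comm]

end HomogeneousBasis

section Internal

variable [CharZero K] [FiniteDimensional K V]

theorem isInternal_dualGrading (h : DirectSum.IsInternal 𝒱) :
    DirectSum.IsInternal (dualGrading 𝒱) :=
  let ⟨_, ⟨b⟩⟩ := exists_homogeneousBasis h
  b.dual.isInternal

theorem isInternal_doubleGrading (h : DirectSum.IsInternal 𝒱) :
    DirectSum.IsInternal (doubleGrading 𝒱) :=
  let ⟨_, ⟨b⟩⟩ := exists_homogeneousBasis h
  b.double.isInternal

end Internal

end DoubleGradings

namespace BigAlgebra

variable {K : Type*} [Field K] {V : Type*} [AddCommGroup V] [Module K V]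
  {𝒱 : ℤ → Submodule K V}

/-! ### Parities and signs -/

/-- `x` has total degree congruent to `p` modulo `2`. -/
def GenParity (𝒱 : ℤ → Submodule K V) (p : ℤ) (x : Double K V) : Prop :=
  doubleParity 𝒱 x = -((p.negOnePow : ℤ) • x)

/-- `b` has total degree congruent to `p` modulo `2`. -/
def HasParity (p : ℤ) (b : BigAlgebra 𝒱) : Prop := invol 𝒱 b = (p.negOnePow : ℤ) • b

theorem genParity_of_mem (h : DirectSum.IsInternal 𝒱) {a : ℤ} {x : Double K V}
    (hx : x ∈ doubleGrading 𝒱 a) : GenParity 𝒱 (a - 1) x := by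
  rw [GenParity, doubleParity_of_mem h hx, Int.negOnePow_sub]
  simp

theorem GenParity.hasParity {p : ℤ} {x : Double K V} (hx : GenParity 𝒱 p x) :
    HasParity p (gen 𝒱 x) := by
  rw [HasParity, invol_gen, hx, map_neg, neg_neg, map_zsmul]

theorem GenParity.even {p : ℤ} {x : Double K V} (hx : GenParity 𝒱 p x) (hp : Even p) :
    doubleParity 𝒱 x = -x := by
  rw [hx, Int.negOnePow_even _ hp]; simp

theorem GenParity.odd {p : ℤ} {x : Double K V} (hx : GenParity 𝒱 p x) (hp : Odd p) :
    doubleParity 𝒱 x = x := by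
  rw [hx, Int.negOnePow_odd _ hp]; simp

theorem HasParity.even {p : ℤ} {x : BigAlgebra 𝒱} (hx : HasParity p x) (hp : Even p) :
    invol 𝒱 x = x := by
  rw [hx, Int.negOnePow_even _ hp]; simp

theorem HasParity.odd {p : ℤ} {x : BigAlgebra 𝒱} (hx : HasParity p x) (hp : Odd p) :
    invol 𝒱 x = -x := by
  rw [hx, Int.negOnePow_odd _ hp]; simp

open Classical in
/-- Multiplication by `(-1) ^ (p q)` on the elements of total degree `q`. -/
noncomputable def signInvol (𝒱 : ℤ → Submodule K V) (p : ℤ) : BigAlgebra 𝒱 →ₐ[K] BigAlgebra 𝒱 :=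
  if Even p then AlgHom.id K _ else invol 𝒱

theorem signInvol_even {p : ℤ} (hp : Even p) (b : BigAlgebra 𝒱) : signInvol 𝒱 p b = b := by
  simp [signInvol, hp]

theorem signInvol_odd {p : ℤ} (hp : Odd p) (b : BigAlgebra 𝒱) :
    signInvol 𝒱 p b = invol 𝒱 b := by
  simp [signInvol, Int.not_even_iff_odd.2 hp]

theorem HasParity.signInvol {q : ℤ} {b : BigAlgebra 𝒱} (hb : HasParity q b) (p : ℤ) :
    signInvol 𝒱 p b = ((p * q).negOnePow : ℤ) • b := by
  rcases Int.even_or_odd p with hp | hp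
  · rw [signInvol_even hp, Int.negOnePow_even _ (hp.mul_right q)]; simp
  · rw [signInvol_odd hp, hb]
    rcases Int.even_or_odd q with hq | hq
    · rw [Int.negOnePow_even _ hq, Int.negOnePow_even _ (hq.mul_left p)]
    · rw [Int.negOnePow_odd _ hq, Int.negOnePow_odd _ (hp.mul hq)]

theorem signInvol_signInvol (p q : ℤ) (b : BigAlgebra 𝒱) :
    signInvol 𝒱 p (signInvol 𝒱 q b) = signInvol 𝒱 (p + q) b := by
  rcases Int.even_or_odd p with hp | hp <;> rcases Int.even_or_odd q with hq | hq
  · rw [signInvol_even hp, signInvol_even hq, signInvol_even (hp.add hq)]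
  · rw [signInvol_even hp, signInvol_odd hq, signInvol_odd (hp.add_odd hq)]
  · rw [signInvol_odd hp, signInvol_even hq, signInvol_odd (hp.add_even hq)]
  · rw [signInvol_odd hp, signInvol_odd hq, signInvol_even (hp.add_odd hq), invol_invol]

theorem gen_mul_comm [CharZero K] {p : ℤ} {x : Double K V} (hx : GenParity 𝒱 p x)
    (b : BigAlgebra 𝒱) : gen 𝒱 x * b = signInvol 𝒱 p b * gen 𝒱 x := by
  rcases Int.even_or_odd p with hp | hp
  · rw [signInvol_even hp, gen_mul_even (hx.even hp)]
  · rw [signInvol_odd hp, gen_mul_odd (hx.odd hp)]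

theorem mul_gen_comm [CharZero K] {p : ℤ} {x : Double K V} (hx : GenParity 𝒱 p x)
    (b : BigAlgebra 𝒱) : b * gen 𝒱 x = gen 𝒱 x * signInvol 𝒱 p b := by
  rw [gen_mul_comm hx, signInvol_signInvol, signInvol_even ⟨p, rfl⟩]

theorem induction_genParity [CharZero K] {C : Double K V → Prop}
    (ha : ∀ x y, C x → C y → C (x + y)) (hC : ∀ p x, GenParity 𝒱 p x → C x) (x : Double K V) :
    C x := by
  rw [← evenPart_add_oddPart 𝒱 x]
  refine ha _ _ (hC 1 _ ?_) (hC 0 _ ?_)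
  · simp [GenParity, doubleParity_evenPart]
  · simp [GenParity, doubleParity_oddPart]

/-! ### The bracket with a generator -/

section Bracket

variable [CharZero K]

/-- The bracket `[·, x]` with a generator. -/
noncomputable def ad (𝒱 : ℤ → Submodule K V) : Double K V →ₗ[K] BigAlgebra 𝒱 →ₗ[K] BigAlgebra 𝒱 :=
  (bracketGen 𝒱).flip

theorem ad_apply (x : Double K V) (b : BigAlgebra 𝒱) :
    ad 𝒱 x b = bigBracket 𝒱 b (gen 𝒱 x) := (bigBracket_gen b x).symm

theorem contractEven_eq_zero {x : Double K V} (hx : doubleParity 𝒱 x = -x) :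
    contractEven 𝒱 x = 0 :=
  derivation_unique (σ := invol 𝒱) _ _ (contractEven_mul _) (by simp) fun z => by
    simp [contractEven_gen, evenPart_odd hx]

theorem contractOdd_eq_zero {x : Double K V} (hx : doubleParity 𝒱 x = x) :
    contractOdd 𝒱 x = 0 :=
  derivation_unique (σ := AlgHom.id K _) _ _ (contractOdd_mul _) (by simp) fun z => by
    simp [contractOdd_gen, oddPart_even hx]

theorem ad_of_even {x : Double K V} (hx : doubleParity 𝒱 x = -x) (b : BigAlgebra 𝒱) :
    ad 𝒱 x b = -contractOdd 𝒱 x b := by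
  change bracketGen 𝒱 b x = _
  rw [bracketGen_apply, contractEven_eq_zero hx]; simp

theorem ad_of_odd {x : Double K V} (hx : doubleParity 𝒱 x = x) (b : BigAlgebra 𝒱) :
    ad 𝒱 x b = -contractEven 𝒱 x (invol 𝒱 b) := by
  change bracketGen 𝒱 b x = _
  rw [bracketGen_apply, contractOdd_eq_zero hx]; simp

/-- This is the only case of skew-symmetry of the big bracket that the argument needs. -/
theorem bigBracket_gen_left_eq {p q : ℤ} {x : Double K V} {b : BigAlgebra 𝒱}
    (hx : GenParity 𝒱 p x) (hb : HasParity q b) :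
    bigBracket 𝒱 (gen 𝒱 x) b = -(((p * q).negOnePow : ℤ) • bigBracket 𝒱 b (gen 𝒱 x)) := by
  rw [← ad_apply, bigBracket_gen_left, LinearMap.add_apply]
  rcases Int.even_or_odd p with hp | hp
  · rw [ad_of_even (hx.even hp), contractEven_eq_zero (hx.even hp),
      Int.negOnePow_even _ (hp.mul_right q)]
    simp
  · rw [ad_of_odd (hx.odd hp), contractOdd_eq_zero (hx.odd hp), ← signInvol_odd hp,
      hb.signInvol, map_zsmul, smul_neg, neg_neg, smul_smul, ← Units.val_mul,
      Int.units_mul_self]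
    simp

theorem ad_gen (x y : Double K V) : ad 𝒱 x (gen 𝒱 y) = algebraMap K _ (pairing 𝒱 y x) := by
  rw [ad_apply, bigBracket_gen_gen]

/-- Since `x` acts from the right, it reaches `c` without a sign and has to pass `c` to reach `b`.
-/
theorem ad_mul {p : ℤ} {x : Double K V} (hx : GenParity 𝒱 p x) (b c : BigAlgebra 𝒱) :
    ad 𝒱 x (b * c) = b * ad 𝒱 x c + ad 𝒱 x b * signInvol 𝒱 p c := by
  rcases Int.even_or_odd p with hp | hp
  · simp only [ad_of_even (hx.even hp), contractOdd_mul, signInvol_even hp]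
    simp; abel
  · simp only [ad_of_odd (hx.odd hp), contractEven_mul, signInvol_odd hp, map_mul, invol_invol]
    simp; abel

theorem ad_algebraMap (x : Double K V) (r : K) : ad 𝒱 x (algebraMap K _ r) = 0 := by
  change bracketGen 𝒱 _ x = _
  rw [bracketGen_apply, AlgHom.commutes]
  simp [contractOdd, contractEven]

theorem bigBracket_algebraMap_right (b : BigAlgebra 𝒱) (r : K) :
    bigBracket 𝒱 b (algebraMap K _ r) = 0 := by
  simp [bigBracket, bracketEven, bracketOdd]

theorem ad_signInvol {p : ℤ} {x : Double K V} (hx : GenParity 𝒱 p x) (q : ℤ)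
    (b : BigAlgebra 𝒱) :
    ad 𝒱 x (signInvol 𝒱 q b) = ((p * q).negOnePow : ℤ) • signInvol 𝒱 q (ad 𝒱 x b) := by
  rcases Int.even_or_odd q with hq | hq
  · rw [signInvol_even hq, signInvol_even hq, Int.negOnePow_even _ (hq.mul_left p)]; simp
  · rw [signInvol_odd hq, signInvol_odd hq]
    change bracketGen 𝒱 _ x = _ • invol 𝒱 (bracketGen 𝒱 b x)
    rcases Int.even_or_odd p with hp | hp
    · rw [bracketGen_odd _ (hx.even hp), Int.negOnePow_even _ (hp.mul_right q)]; simp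
    · rw [bracketGen_even _ (hx.odd hp), Int.negOnePow_odd _ (hp.mul hq)]; simp

theorem HasParity.ad {p q : ℤ} {x : Double K V} {b : BigAlgebra 𝒱} (hx : GenParity 𝒱 p x)
    (hb : HasParity q b) : HasParity (q + p) (ad 𝒱 x b) := by
  have h := ad_signInvol hx 1 b
  rw [signInvol_odd odd_one, signInvol_odd odd_one, hb, map_zsmul, mul_one] at h
  rw [HasParity, Int.negOnePow_add, Units.val_mul, mul_smul, smul_comm, h, smul_smul,
    ← Units.val_mul, Int.units_mul_self]
  simp

theorem bigBracket_mul {p : ℤ} {A : BigAlgebra 𝒱} (hA : HasParity p A) (b c : BigAlgebra 𝒱) :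
    bigBracket 𝒱 A (b * c) = bigBracket 𝒱 A b * c + signInvol 𝒱 p b * bigBracket 𝒱 A c := by
  rcases Int.even_or_odd p with hp | hp
  · rw [bigBracket_mul_even (hA.even hp), signInvol_even hp]
  · rw [bigBracket_mul_odd (hA.odd hp), signInvol_odd hp]

theorem bigBracket_signInvol {p : ℤ} {A : BigAlgebra 𝒱} (hA : HasParity p A) (q : ℤ)
    (b : BigAlgebra 𝒱) : bigBracket 𝒱 A (signInvol 𝒱 q b) =
      ((p * q).negOnePow : ℤ) • signInvol 𝒱 q (bigBracket 𝒱 A b) := by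
  induction b using induction with
  | hs r => simp [bigBracket_algebraMap_right]
  | hg x =>
    induction x using induction_genParity (𝒱 := 𝒱) with
    | ha x y hx hy => simp only [map_add, hx, hy, smul_add]
    | hC r x hx =>
      rw [hx.hasParity.signInvol, map_zsmul, ← ad_apply, (hA.ad hx).signInvol, smul_smul,
        ← Units.val_mul, ← Int.negOnePow_add,
        show p * q + q * (p + r) = q * r + 2 * (p * q) by ring,
        Int.negOnePow_add, Int.negOnePow_even (2 * _) (even_two_mul _), mul_one]
  | hm b c h₁ h₂ =>
    simp only [map_mul, bigBracket_mul hA, h₁, h₂, map_add, smul_add, smul_mul_assoc,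
      mul_smul_comm, signInvol_signInvol, add_comm p q]
  | ha b c h₁ h₂ => simp only [map_add, h₁, h₂, smul_add]

/-- The graded commutator of two contractions is contraction with `[x, y]`, which is a scalar and so
acts as zero. Concretely, both sides vanish on generators, and the Leibniz rule carries this to
products. Symmetry and invariance of the derived brackets both come from here. -/
theorem ad_comm {p q : ℤ} {x y : Double K V} (hx : GenParity 𝒱 p x) (hy : GenParity 𝒱 q y)
    (b : BigAlgebra 𝒱) :
    ad 𝒱 x (ad 𝒱 y b) = ((p * q).negOnePow : ℤ) • ad 𝒱 y (ad 𝒱 x b) := by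
  induction b using induction with
  | hs r => simp [ad_algebraMap]
  | hg y => simp [ad_algebraMap, ad_gen]
  | hm b c h₁ h₂ =>
    simp only [map_add, ad_mul hx, ad_mul hy, h₁, h₂, ad_signInvol hx, ad_signInvol hy,
      signInvol_signInvol, mul_comm q p, add_comm q p]
    rcases Int.units_eq_one_or (p * q).negOnePow with h | h <;> simp [h] <;> abel
  | ha b c h₁ h₂ => simp only [map_add, h₁, h₂, smul_add]

/-- The graded Jacobi identity of the big bracket with a generator as third entry, the only instance
needed. Both sides obey the same Leibniz rule in `B`, and on a generator `B` the identity reduces to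
`ad_comm`. -/
theorem ad_bigBracket {p q : ℤ} {A : BigAlgebra 𝒱} {x : Double K V} (hA : HasParity q A)
    (hx : GenParity 𝒱 p x) (B : BigAlgebra 𝒱) :
    ad 𝒱 x (bigBracket 𝒱 A B) =
      bigBracket 𝒱 A (ad 𝒱 x B) + bigBracket 𝒱 (ad 𝒱 x A) (signInvol 𝒱 p B) := by
  induction B using induction with
  | hs r => simp [ad_algebraMap, bigBracket_algebraMap_right]
  | hg y =>
    induction y using induction_genParity (𝒱 := 𝒱) with
    | ha y z hy hz => simp only [map_add, hy, hz]; abel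
    | hC r y hy =>
      rw [ad_gen, bigBracket_algebraMap_right, zero_add, hy.hasParity.signInvol, map_zsmul,
        ← ad_apply, ← ad_apply, ad_comm hx hy]
  | hm b c h₁ h₂ =>
    simp only [map_mul, map_add, bigBracket_mul hA, ad_mul hx, h₁, h₂,
      bigBracket_mul (hA.ad hx), ad_signInvol hx, bigBracket_signInvol hA, signInvol_signInvol,
      add_mul, mul_add, smul_mul_assoc, mul_smul_comm, mul_comm q p]
    -- The sign of `x` is picked up twice and cancels.
    rw [show q + p + p = q + 2 * p by ring, ← signInvol_signInvol q (2 * p),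
      signInvol_even (even_two_mul p)]
    abel
  | ha b c h₁ h₂ => simp only [map_add, h₁, h₂]; abel

end Bracket
end BigAlgebra

namespace BigAlgebra

variable {K : Type*} [Field K] {V : Type*} [AddCommGroup V] [Module K V]
  {𝒱 : ℤ → Submodule K V}

theorem eq_zero_of_eq_smul {X : Type*} [AddCommGroup X] [Module K X] {m : K} (hm : m ≠ 1) {x : X}
    (h : x = m • x) : x = 0 := by
  have h' : (m - 1) • x = 0 := by rw [sub_smul, ← h, one_smul, sub_self]
  exact (smul_eq_zero.1 h').resolve_left (sub_ne_zero.2 hm)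

/-! ### Weights -/

/-- `w` preserves parities, and the pairing has weight `-c` with respect to `w`. -/
structure IsWeight (𝒱 : ℤ → Submodule K V) (w : Double K V →ₗ[K] Double K V) (c : K) : Prop where
  parity : ∀ x, doubleParity 𝒱 (w x) = w (doubleParity 𝒱 x)
  pairing : ∀ x y, pairing 𝒱 (w x) y + pairing 𝒱 x (w y) = c * pairing 𝒱 x y

/-- The associated derivation counts all factors; `c = 2` because the pairing consumes two
generators. For the two projections below `c = 1`, since it consumes one factor from each summand,
and for the Euler operator `c = 0`, since the pairing has degree `0`. -/
theorem isWeight_id (𝒱 : ℤ → Submodule K V) : IsWeight 𝒱 LinearMap.id 2 :=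
  ⟨fun _ => rfl, fun x y => by simp [two_mul]⟩

/-- The projection of the double to `V`. -/
def projPlus (K V : Type*) [Field K] [AddCommGroup V] [Module K V] : Double K V →ₗ[K] Double K V :=
  LinearMap.inl K V _ ∘ₗ LinearMap.fst K V _

/-- The projection of the double to `V*`. -/
def projMinus (K V : Type*) [Field K] [AddCommGroup V] [Module K V] : Double K V →ₗ[K] Double K V :=
  LinearMap.inr K V _ ∘ₗ LinearMap.snd K V _

theorem isWeight_projPlus (𝒱 : ℤ → Submodule K V) : IsWeight 𝒱 (projPlus K V) 1 :=
  ⟨fun x => by simp [projPlus, doubleParity], fun x y => by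
    simp [projPlus, pairing_apply, add_comm]⟩

theorem isWeight_projMinus (𝒱 : ℤ → Submodule K V) : IsWeight 𝒱 (projMinus K V) 1 :=
  ⟨fun x => by simp [projMinus, doubleParity], fun x y => by
    simp [projMinus, pairing_apply]⟩

theorem isWeight_euler (h : DirectSum.IsInternal 𝒱) {ι : Type*} [Fintype ι] [DecidableEq ι]
    (b : HomogeneousBasis 𝒱 ι) : IsWeight 𝒱 b.double.euler 0 := by
  constructor
  · suffices doubleParity 𝒱 ∘ₗ b.double.euler = b.double.euler ∘ₗ doubleParity 𝒱 from
      fun x => LinearMap.congr_fun this x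
    refine b.double.vec.ext fun i => ?_
    simp only [LinearMap.comp_apply, b.double.euler_vec, map_smul,
      doubleParity_of_mem h (b.double.mem i), map_zsmul]
    exact smul_comm _ _ _
  · suffices (pairing 𝒱) ∘ₗ b.double.euler + ((pairing 𝒱).compl₂ b.double.euler) = 0 by
      intro x y
      simpa using LinearMap.congr_fun₂ this x y
    refine b.double.vec.ext fun i => b.double.vec.ext fun j => ?_
    simp only [LinearMap.add_apply, LinearMap.comp_apply, LinearMap.compl₂_apply,
      b.double.euler_vec, map_smul, LinearMap.smul_apply, LinearMap.zero_apply]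
    rw [← add_smul, ← Int.cast_add]
    by_cases hij : b.double.deg i + b.double.deg j = 0
    · simp [hij]
    · rw [pairing_degree h hij (b.double.mem i) (b.double.mem j), smul_zero]

section WeightDer

variable {w : Double K V →ₗ[K] Double K V} {c : K}

theorem IsWeight.compat (hw : IsWeight 𝒱 w c) : Compat (AlgHom.id K _) (gen 𝒱 ∘ₗ w) where
  odd x y hx hy := by
    have hx' : doubleParity 𝒱 (w x) = w x := by rw [hw.parity, hx]
    have hy' : doubleParity 𝒱 (w y) = w y := by rw [hw.parity, hy]
    simp only [AlgHom.id_apply, LinearMap.comp_apply]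
    rw [gen_odd hx hy', gen_odd hx' hy]; abel
  even x y hx := by
    have hx' : doubleParity 𝒱 (w x) = -w x := by rw [hw.parity, hx, map_neg]
    simp only [AlgHom.id_apply, LinearMap.comp_apply]
    rw [gen_even hx, gen_even hx', add_comm]

/-- The derivation of the algebra that extends an operator on the generators. -/
noncomputable def weightDer (hw : IsWeight 𝒱 w c) : Module.End K (BigAlgebra 𝒱) :=
  derivation hw.compat

variable (hw : IsWeight 𝒱 w c)

theorem weightDer_gen (x : Double K V) : weightDer hw (gen 𝒱 x) = gen 𝒱 (w x) :=
  derivation_gen _ _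

theorem weightDer_algebraMap (r : K) : weightDer hw (algebraMap K _ r) = 0 :=
  derivation_algebraMap _ _

theorem weightDer_mul (a b : BigAlgebra 𝒱) :
    weightDer hw (a * b) = a * weightDer hw b + weightDer hw a * b :=
  derivation_mul _ _ _

theorem weightDer_invol (b : BigAlgebra 𝒱) :
    weightDer hw (invol 𝒱 b) = invol 𝒱 (weightDer hw b) := by
  induction b using induction with
  | hs r => simp [weightDer_algebraMap]
  | hg x => simp [weightDer_gen, hw.parity]
  | hm a b h₁ h₂ => simp [weightDer_mul, h₁, h₂]
  | ha a b h₁ h₂ => simp [h₁, h₂]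

theorem weightDer_signInvol (p : ℤ) (b : BigAlgebra 𝒱) :
    weightDer hw (signInvol 𝒱 p b) = signInvol 𝒱 p (weightDer hw b) := by
  rcases Int.even_or_odd p with hp | hp
  · simp only [signInvol_even hp]
  · simp only [signInvol_odd hp, weightDer_invol]

theorem HasParity.weightDer {p : ℤ} {b : BigAlgebra 𝒱} (hb : HasParity p b) :
    HasParity p (weightDer hw b) := by
  rw [HasParity, ← weightDer_invol, hb, map_zsmul]

theorem IsWeight.genParity {p : ℤ} {x : Double K V} (hw : IsWeight 𝒱 w c)
    (hx : GenParity 𝒱 p x) : GenParity 𝒱 p (w x) := by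
  rw [GenParity, hw.parity, hx, map_neg, map_zsmul]

theorem induction_hasParity [CharZero K] {C : BigAlgebra 𝒱 → Prop}
    (ha : ∀ x y, C x → C y → C (x + y)) (hC : ∀ p x, HasParity p x → C x) (x : BigAlgebra 𝒱) :
    C x := by
  rw [← evenComp_add_oddComp x]
  refine ha _ _ (hC 0 _ ?_) (hC 1 _ ?_)
  · simp [HasParity, invol_evenComp]
  · simp [HasParity, invol_oddComp]

/-- The elements of weight `r`. -/
noncomputable abbrev weightSpace (hw : IsWeight 𝒱 w c) (r : K) : Submodule K (BigAlgebra 𝒱) :=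
  (weightDer hw).eigenspace r

theorem mem_weightSpace {hw : IsWeight 𝒱 w c} {r : K} {b : BigAlgebra 𝒱} :
    b ∈ weightSpace hw r ↔ weightDer hw b = r • b := Module.End.mem_eigenspace_iff

variable {hw}

theorem mul_mem_weightSpace {r s : K} {a b : BigAlgebra 𝒱} (ha : a ∈ weightSpace hw r)
    (hb : b ∈ weightSpace hw s) : a * b ∈ weightSpace hw (r + s) := by
  rw [mem_weightSpace] at *
  rw [weightDer_mul, ha, hb, add_smul, mul_smul_comm, smul_mul_assoc, add_comm]

theorem algebraMap_mem_weightSpace (r : K) : algebraMap K _ r ∈ weightSpace hw 0 := by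
  rw [mem_weightSpace, weightDer_algebraMap, zero_smul]

theorem gen_mem_weightSpace {r : K} {x : Double K V} (hx : w x = r • x) :
    gen 𝒱 x ∈ weightSpace hw r := by
  rw [mem_weightSpace, weightDer_gen, hx, map_smul]

theorem eq_zero_of_mem_weightSpace {r s : K} {b : BigAlgebra 𝒱} (hr : b ∈ weightSpace hw r)
    (hs : b ∈ weightSpace hw s) (hrs : r ≠ s) : b = 0 := by
  rw [mem_weightSpace] at *
  rw [hr, ← sub_eq_zero, ← sub_smul, smul_eq_zero] at hs
  exact hs.resolve_left (sub_ne_zero.2 hrs)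

theorem prod_mem_weightSpace {n : ℕ} {b : Fin n → BigAlgebra 𝒱} {r : Fin n → K}
    (hb : ∀ i, b i ∈ weightSpace hw (r i)) :
    (List.ofFn b).prod ∈ weightSpace hw (∑ i, r i) := by
  induction n with
  | zero => simpa using algebraMap_mem_weightSpace (hw := hw) 1
  | succ n ih =>
    rw [List.ofFn_succ, List.prod_cons, Fin.sum_univ_succ]
    exact mul_mem_weightSpace (hb 0) (ih fun i => hb _)

variable (hw) [CharZero K]

/-- The weights of `x` and `b` add up, except that a pairing of weight `c` is replaced by a scalar
of weight `0`; this accounts for the loss of `c`. The same computation holds for the bracket of two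
arbitrary elements. -/
theorem weightDer_ad (x : Double K V) (b : BigAlgebra 𝒱) :
    weightDer hw (ad 𝒱 x b) = ad 𝒱 x (weightDer hw b) + ad 𝒱 (w x) b - c • ad 𝒱 x b := by
  induction x using induction_genParity (𝒱 := 𝒱) with
  | ha x y hx hy => simp only [map_add, LinearMap.add_apply, hx, hy, smul_add]; abel
  | hC p x hx =>
    induction b using induction with
    | hs r => simp [ad_algebraMap, weightDer_algebraMap]
    | hg y =>
      rw [weightDer_gen, ad_gen, ad_gen, ad_gen, weightDer_algebraMap, ← map_add, hw.pairing,
        map_mul, Algebra.smul_def, sub_self]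
    | hm a b h₁ h₂ =>
      simp only [weightDer_mul, ad_mul hx, map_add, h₁, h₂, ad_mul (hw.genParity hx),
        weightDer_signInvol, smul_add, mul_add, add_mul, mul_sub, sub_mul, mul_smul_comm,
        smul_mul_assoc]
      abel
    | ha a b h₁ h₂ => simp only [map_add, h₁, h₂, smul_add]; abel

theorem weightDer_bigBracket (a b : BigAlgebra 𝒱) :
    weightDer hw (bigBracket 𝒱 a b) = bigBracket 𝒱 a (weightDer hw b) +
      bigBracket 𝒱 (weightDer hw a) b - c • bigBracket 𝒱 a b := by
  induction a using induction_hasParity with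
  | ha x y hx hy => simp only [map_add, LinearMap.add_apply, hx, hy, smul_add]; abel
  | hC p A hA =>
    induction b using induction with
    | hs r => simp [bigBracket_algebraMap_right, weightDer_algebraMap]
    | hg y =>
      rw [weightDer_gen, ← ad_apply, weightDer_ad, ← ad_apply, ← ad_apply]
      abel
    | hm a b h₁ h₂ =>
      simp only [weightDer_mul, bigBracket_mul hA, map_add, h₁, h₂,
        bigBracket_mul (hA.weightDer hw),
        weightDer_signInvol, smul_add, mul_add, add_mul, mul_sub, sub_mul, mul_smul_comm,
        smul_mul_assoc]
      abel
    | ha a b h₁ h₂ => simp only [map_add, h₁, h₂, smul_add]; abel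

variable {hw}

theorem ad_mem_weightSpace {r s : K} {b : BigAlgebra 𝒱} {x : Double K V}
    (hb : b ∈ weightSpace hw r) (hx : w x = s • x) : ad 𝒱 x b ∈ weightSpace hw (r + s - c) := by
  rw [mem_weightSpace] at *
  rw [weightDer_ad, hb, hx, map_smul, map_smul, LinearMap.smul_apply, sub_smul, add_smul]

theorem bigBracket_mem_weightSpace {r s : K} {a b : BigAlgebra 𝒱}
    (ha : a ∈ weightSpace hw r) (hb : b ∈ weightSpace hw s) :
    bigBracket 𝒱 a b ∈ weightSpace hw (r + s - c) := by
  rw [mem_weightSpace] at *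
  rw [weightDer_bigBracket, ha, hb, map_smul, map_smul, LinearMap.smul_apply, sub_smul, add_smul,
    add_comm (s • _)]

end WeightDer

/-! ### The augmentation and the linear part -/

section LinearPart

/-- The augmentation, which vanishes on the generators. -/
noncomputable def augmentation (𝒱 : ℤ → Submodule K V) : BigAlgebra 𝒱 →ₐ[K] K :=
  lift 0 (by simp) (by simp)

theorem algebraMap_injective (𝒱 : ℤ → Submodule K V) :
    Function.Injective (algebraMap K (BigAlgebra 𝒱)) := fun r s h => by
  simpa using congrArg (augmentation 𝒱) h

theorem linearPart_algebraMap (r : K) : linearPart 𝒱 (algebraMap K _ r) = 0 := by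
  simp only [linearPart, LinearMap.comp_apply, AlgHom.toLinearMap_apply, AlgHom.commutes]
  rfl

/-- `linearPart` is the second component of a homomorphism to the square-zero extension of `K` by
the generators, whose first component is the augmentation. -/
theorem linearPart_mul (a b : BigAlgebra 𝒱) : linearPart 𝒱 (a * b) =
    augmentation 𝒱 a • linearPart 𝒱 b + augmentation 𝒱 b • linearPart 𝒱 a := by
  -- The instances have to be those in the definition of `linearPart`, so that `h1` holds
  -- definitionally.
  let _ : Module Kᵐᵒᵖ (Double K V) := Module.compHom _ ((RingHom.id K).fromOpposite mul_comm)
  have : IsCentralScalar K (Double K V) := ⟨fun r m => rfl⟩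
  let φ : BigAlgebra 𝒱 →ₐ[K] TrivSqZeroExt K (Double K V) :=
    lift (TrivSqZeroExt.inrHom K (Double K V)) (by simp) (by simp)
  have h1 : ∀ b, linearPart 𝒱 b = (φ b).snd := fun b => rfl
  have h2 : ∀ b, (φ b).fst = augmentation 𝒱 b := fun b => by
    induction b using induction with
    | hs r => simp only [AlgHom.commutes]; rfl
    | hg x => simp [φ, augmentation]
    | hm a b h₁ h₂ => simp [h₁, h₂]
    | ha a b h₁ h₂ => simp [h₁, h₂]
  rw [h1, h1, h1, map_mul, TrivSqZeroExt.snd_mul, h2, h2]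
  rfl

theorem augmentation_weightDer {w : Double K V →ₗ[K] Double K V} {c : K} (hw : IsWeight 𝒱 w c)
    (b : BigAlgebra 𝒱) : augmentation 𝒱 (weightDer hw b) = 0 := by
  induction b using induction with
  | hs r => simp [weightDer_algebraMap]
  | hg x => simp [weightDer_gen, augmentation]
  | hm a b h₁ h₂ => simp [weightDer_mul, h₁, h₂]
  | ha a b h₁ h₂ => simp [h₁, h₂]

theorem linearPart_weightDer {w : Double K V →ₗ[K] Double K V} {c : K} (hw : IsWeight 𝒱 w c)
    (b : BigAlgebra 𝒱) : linearPart 𝒱 (weightDer hw b) = w (linearPart 𝒱 b) := by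
  induction b using induction with
  | hs r => simp [weightDer_algebraMap, linearPart_algebraMap]
  | hg x => simp [weightDer_gen, linearPart_gen]
  | hm a b h₁ h₂ => simp [weightDer_mul, linearPart_mul, augmentation_weightDer, h₁, h₂]
  | ha a b h₁ h₂ => simp [h₁, h₂]

theorem weight_linearPart {w : Double K V →ₗ[K] Double K V} {c r : K} {hw : IsWeight 𝒱 w c}
    {b : BigAlgebra 𝒱} (hb : b ∈ weightSpace hw r) :
    w (linearPart 𝒱 b) = r • linearPart 𝒱 b := by
  rw [← linearPart_weightDer hw, mem_weightSpace.1 hb, map_smul]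

theorem linearPart_eq_zero {m : K} (hm : m ≠ 1) {b : BigAlgebra 𝒱}
    (hb : b ∈ weightSpace (isWeight_id 𝒱) m) : linearPart 𝒱 b = 0 := by
  have h : linearPart 𝒱 b = m • linearPart 𝒱 b := weight_linearPart hb
  exact eq_zero_of_eq_smul hm h

theorem linearPart_invol (b : BigAlgebra 𝒱) :
    linearPart 𝒱 (invol 𝒱 b) = -doubleParity 𝒱 (linearPart 𝒱 b) := by
  have haug : ∀ b, augmentation 𝒱 (invol 𝒱 b) = augmentation 𝒱 b := fun b => by
    induction b using induction with
    | hs r => simp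
    | hg x => simp [augmentation]
    | hm a b h₁ h₂ => simp [h₁, h₂]
    | ha a b h₁ h₂ => simp [h₁, h₂]
  induction b using induction with
  | hs r => simp [linearPart_algebraMap]
  | hg x => simp [linearPart_gen]
  | hm a b h₁ h₂ => simp [linearPart_mul, haug, h₁, h₂, add_comm]
  | ha a b h₁ h₂ => simp [h₁, h₂, add_comm]

theorem HasParity.linearPart {p : ℤ} {b : BigAlgebra 𝒱} (hb : HasParity p b) :
    GenParity 𝒱 p (linearPart 𝒱 b) := by
  rw [GenParity, ← map_zsmul, ← hb, linearPart_invol, neg_neg]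

end LinearPart

/-! ### The polynomial degree -/

/-- Dual vectors have opposite degrees, hence the same parity. They therefore pass other elements
with the same signs, which makes the signs in Euler's formula cancel. -/
theorem codual_genParity {ι : Type*} [Fintype ι] [DecidableEq ι]
    (e : HomogeneousBasis 𝒱 ι) (h : DirectSum.IsInternal 𝒱) (j : ι ⊕ ι) :
    GenParity 𝒱 (e.double.deg j - 1) (e.codual j) := by
  have := genParity_of_mem h (e.codual_mem h j)
  rwa [GenParity, Int.negOnePow_sub, Int.negOnePow_neg, ← Int.negOnePow_sub] at this

section PolyDegree

/-- The elements of `Λ^m (V ⊕ V*)`. -/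
noncomputable abbrev polySpace (𝒱 : ℤ → Submodule K V) (m : ℕ) : Submodule K (BigAlgebra 𝒱) :=
  weightSpace (isWeight_id 𝒱) (m : K)

theorem gen_mem_polySpace (x : Double K V) : gen 𝒱 x ∈ polySpace 𝒱 1 :=
  gen_mem_weightSpace (by simp)

variable [CharZero K]

theorem iSupIndep_polySpace (𝒱 : ℤ → Submodule K V) : iSupIndep (polySpace 𝒱) :=
  (Module.End.eigenspaces_iSupIndep (weightDer (isWeight_id 𝒱))).comp
    (Nat.cast_injective (R := K))

/-- The powers of the space of generators. -/
noncomputable def genPower (𝒱 : ℤ → Submodule K V) (m : ℕ) : Submodule K (BigAlgebra 𝒱) :=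
  if m = 0 then LinearMap.range (Algebra.linearMap K (BigAlgebra 𝒱)) else polySpace 𝒱 m

theorem genPower_le (m : ℕ) : genPower 𝒱 m ≤ polySpace 𝒱 m := by
  rcases eq_or_ne m 0 with rfl | hm
  · rintro _ ⟨r, rfl⟩
    simpa using algebraMap_mem_weightSpace (hw := isWeight_id 𝒱) r
  · simp [genPower, hm]

/-- `genPower` differs from `polySpace` only in degree `0`, where it contains just the scalars. It
still contains all generators and is compatible with products, so it spans the algebra. -/
theorem iSup_genPower (𝒱 : ℤ → Submodule K V) : ⨆ m, genPower 𝒱 m = ⊤ := by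
  refine eq_top_iff.2 fun b _ => ?_
  induction b using induction with
  | hs r => exact Submodule.mem_iSup_of_mem 0 (by simp [genPower])
  | hg x =>
    exact Submodule.mem_iSup_of_mem 1 (by
      simpa [genPower] using gen_mem_weightSpace (hw := isWeight_id 𝒱) (r := 1) (x := x) (by simp))
  | hm a b ha hb =>
    refine Submodule.iSup_induction _ (motive := fun a => a * b ∈ ⨆ m, genPower 𝒱 m) (ha trivial)
      (fun m a ha => ?_) (by simp) (fun x y hx hy => by rw [add_mul]; exact add_mem hx hy)
    refine Submodule.iSup_induction _ (motive := fun b => a * b ∈ ⨆ m, genPower 𝒱 m) (hb trivial)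
      (fun n b hb => ?_) (by simp) (fun x y hx hy => by rw [mul_add]; exact add_mem hx hy)
    rcases eq_or_ne m 0 with rfl | hm
    · obtain ⟨r, rfl⟩ : ∃ r, algebraMap K _ r = a := by simpa [genPower] using ha
      rw [← Algebra.smul_def]
      exact Submodule.smul_mem _ _ (Submodule.mem_iSup_of_mem n hb)
    · refine Submodule.mem_iSup_of_mem (m + n) ?_
      have := mul_mem_weightSpace (genPower_le m ha) (genPower_le n hb)
      simpa [genPower, hm] using this
  | ha a b ha hb => exact add_mem (ha trivial) (hb trivial)

theorem iSup_polySpace (𝒱 : ℤ → Submodule K V) : ⨆ m, polySpace 𝒱 m = ⊤ :=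
  top_unique ((iSup_genPower 𝒱).ge.trans (iSup_mono genPower_le))

/-- The spanning family `genPower` lies inside the independent family `polySpace`, so the two agree,
in particular in degree `0`. -/
theorem exists_algebraMap_of_mem {b : BigAlgebra 𝒱} (hb : b ∈ polySpace 𝒱 0) :
    ∃ r, algebraMap K _ r = b := by
  have := mem_of_le_of_iSup_eq_top (iSup_genPower 𝒱) (iSupIndep_polySpace 𝒱) genPower_le hb
  simpa [genPower] using this

section Basis

variable {ι : Type*} [Fintype ι] [DecidableEq ι] (e : HomogeneousBasis 𝒱 ι)

/-- The analogue of Euler's formula for homogeneous polynomials. -/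
theorem sum_ad_mul_codual (h : DirectSum.IsInternal 𝒱) (b : BigAlgebra 𝒱) :
    ∑ j, ad 𝒱 (e.double.vec j) b * gen 𝒱 (e.codual j) = weightDer (isWeight_id 𝒱) b := by
  induction b using induction with
  | hs r => simp [ad_algebraMap, weightDer_algebraMap]
  | hg x =>
    simp only [ad_gen, ← Algebra.smul_def, ← map_smul, ← map_sum, e.sum_pairing_smul_codual,
      weightDer_gen, LinearMap.id_apply]
  | hm a b h₁ h₂ =>
    rw [weightDer_mul, ← h₁, ← h₂, Finset.mul_sum, Finset.sum_mul, ← Finset.sum_add_distrib]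
    refine Finset.sum_congr rfl fun j _ => ?_
    -- The sign from moving `e_j` past the second factor is undone by moving its dual vector back
    -- past that factor.
    rw [ad_mul (genParity_of_mem h (e.double.mem j)), add_mul, mul_assoc, mul_assoc,
      mul_assoc, ← gen_mul_comm (codual_genParity e h j)]
  | ha a b h₁ h₂ => simp only [map_add, add_mul, Finset.sum_add_distrib, h₁, h₂]

/-- By Euler's formula `m • b = 0`, and `m` is invertible in characteristic `0`. -/
theorem eq_zero_of_ad (h : DirectSum.IsInternal 𝒱) {m : ℕ} (hm : m ≠ 0) {b : BigAlgebra 𝒱}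
    (hb : b ∈ polySpace 𝒱 m) (h0 : ∀ j, ad 𝒱 (e.double.vec j) b = 0) : b = 0 := by
  have := sum_ad_mul_codual e h b
  simp only [h0, zero_mul, Finset.sum_const_zero, mem_weightSpace.1 hb] at this
  exact (smul_eq_zero.1 this.symm).resolve_left (Nat.cast_ne_zero.2 hm)

end Basis

theorem ad_mem_polySpace {m : ℕ} {b : BigAlgebra 𝒱} (hb : b ∈ polySpace 𝒱 (m + 1))
    (x : Double K V) : ad 𝒱 x b ∈ polySpace 𝒱 m := by
  have := ad_mem_weightSpace (s := 1) hb (x := x) (by simp)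
  convert this using 2
  push_cast; ring

/-- In polynomial degree `1` all contractions are scalars, so Euler's formula writes `b` as a linear
combination of generators. -/
theorem gen_linearPart [FiniteDimensional K V] (h : DirectSum.IsInternal 𝒱) {b : BigAlgebra 𝒱}
    (hb : b ∈ polySpace 𝒱 1) : gen 𝒱 (linearPart 𝒱 b) = b := by
  obtain ⟨n, ⟨e⟩⟩ := exists_homogeneousBasis h
  choose r hr using fun j => exists_algebraMap_of_mem
    (ad_mem_polySpace (m := 0) hb (e.double.vec j))
  have := sum_ad_mul_codual e h b
  rw [mem_weightSpace.1 hb] at this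
  simp only [← hr, ← Algebra.smul_def, ← map_smul, ← map_sum, Nat.cast_one, one_smul] at this
  rw [← this, linearPart_gen]

theorem bigBracket_algebraMap_left (r : K) (b : BigAlgebra 𝒱) :
    bigBracket 𝒱 (algebraMap K _ r) b = 0 := by
  have hA : HasParity 0 (algebraMap K (BigAlgebra 𝒱) r) := by simp [HasParity]
  induction b using induction with
  | hs r => simp [bigBracket_algebraMap_right]
  | hg y => rw [← ad_apply, ad_algebraMap]
  | hm a b h₁ h₂ => rw [bigBracket_mul hA, h₁, h₂]; simp
  | ha a b h₁ h₂ => simp [h₁, h₂]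

/-- The linear part of a bracket comes from the brackets with one linear argument. -/
theorem linearPart_bigBracket [FiniteDimensional K V] (h : DirectSum.IsInternal 𝒱)
    (a b : BigAlgebra 𝒱) : linearPart 𝒱 (bigBracket 𝒱 a b) =
      linearPart 𝒱 (bigBracket 𝒱 a (gen 𝒱 (linearPart 𝒱 b))) +
      linearPart 𝒱 (bigBracket 𝒱 (gen 𝒱 (linearPart 𝒱 a)) b) := by
  induction a using iSup_induction_top (iSup_polySpace 𝒱) with
  | h0 => simp
  | ha x y hx hy => simp only [map_add, LinearMap.add_apply, hx, hy]; abel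
  | hm m a ha =>
    induction b using iSup_induction_top (iSup_polySpace 𝒱) with
    | h0 => simp
    | ha x y hx hy => simp only [map_add, hx, hy]; abel
    | hm n b hb =>
      have hlin : ∀ {k : ℕ} {u : BigAlgebra 𝒱}, u ∈ polySpace 𝒱 k → k ≠ 1 → linearPart 𝒱 u = 0 :=
        fun hu hk => linearPart_eq_zero (by exact_mod_cast hk) hu
      -- The bracket has polynomial degree `m + n - 2`, which is `1` exactly here. Then one entry is
      -- linear, or it is a scalar and the bracket vanishes.
      by_cases hmn : m + n = 3
      · obtain rfl | rfl | rfl | rfl : m = 0 ∨ m = 1 ∨ m = 2 ∨ m = 3 := by omega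
        · obtain ⟨r, rfl⟩ := exists_algebraMap_of_mem ha
          simp [bigBracket_algebraMap_left, linearPart_algebraMap]
        · rw [gen_linearPart h ha, hlin hb (by omega)]; simp
        · obtain rfl : n = 1 := by omega
          rw [gen_linearPart h hb, hlin ha (by omega)]; simp
        · obtain rfl : n = 0 := by omega
          obtain ⟨r, rfl⟩ := exists_algebraMap_of_mem hb
          simp [bigBracket_algebraMap_right, linearPart_algebraMap]
      · have key : ∀ {u v : BigAlgebra 𝒱}, u ∈ polySpace 𝒱 m → v ∈ polySpace 𝒱 n →
            linearPart 𝒱 (bigBracket 𝒱 u v) = 0 := fun hu hv =>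
          linearPart_eq_zero (fun hc => hmn (by
            have : ((m + n : ℕ) : K) = (3 : ℕ) := by
              push_cast; linear_combination hc
            exact_mod_cast this)) (bigBracket_mem_weightSpace hu hv)
        have hg : ∀ {k : ℕ} {u : BigAlgebra 𝒱}, u ∈ polySpace 𝒱 k →
            gen 𝒱 (linearPart 𝒱 u) ∈ polySpace 𝒱 k := fun {k u} hu => by
          rcases eq_or_ne k 1 with rfl | hk
          · exact gen_mem_polySpace _
          · rw [hlin hu hk, map_zero]; exact zero_mem _
        rw [key ha hb, key ha (hg hb), key (hg ha) hb, add_zero]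

end PolyDegree

end BigAlgebra

namespace BigAlgebra

variable {K : Type*} [Field K] {V : Type*} [AddCommGroup V] [Module K V]
  {𝒱 : ℤ → Submodule K V}

/-! ### The homogeneous components -/

section Components

theorem HasParity.mul {p q : ℤ} {a b : BigAlgebra 𝒱} (ha : HasParity p a) (hb : HasParity q b) :
    HasParity (p + q) (a * b) := by
  rw [HasParity, map_mul, ha, hb, smul_mul_smul_comm, Int.negOnePow_add, Units.val_mul]

theorem HasParity.prod {n : ℕ} {b : Fin n → BigAlgebra 𝒱} {p : Fin n → ℤ}
    (hb : ∀ i, HasParity (p i) (b i)) : HasParity (∑ i, p i) (List.ofFn b).prod := by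
  induction n with
  | zero => simp [HasParity]
  | succ n ih =>
    rw [List.ofFn_succ, List.prod_cons, Fin.sum_univ_succ]
    exact (hb 0).mul (ih fun i => hb _)

/-- Here `φ a` and `ψ a` are the eigenvalues of `w` on the factors of degree `a` from `V*` and from
`V`; the eigenvalue of a product is their sum. The counting operators and the Euler operator are the
special cases that follow. -/
theorem homogeneousComponent_le_weightSpace {w : Double K V →ₗ[K] Double K V} {c : K}
    {hw : IsWeight 𝒱 w c} {k l : ℕ} {d : ℤ} {r : K} (φ ψ : ℤ → K)
    (hφ : ∀ a, ∀ ξ ∈ dualGrading 𝒱 a, w (0, ξ) = φ a • ((0, ξ) : Double K V))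
    (hψ : ∀ a, ∀ v ∈ 𝒱 a, w (v, 0) = ψ a • ((v, 0) : Double K V))
    (hr : ∀ (a : Fin k → ℤ) (c : Fin l → ℤ), ∑ i, a i + ∑ j, c j + ((k : ℤ) + (l : ℤ) - 2) = d →
      ∑ i, φ (a i) + ∑ j, ψ (c j) = r) :
    homogeneousComponent 𝒱 k l d ≤ weightSpace hw r := by
  refine Submodule.span_le.2 ?_
  rintro _ ⟨ξ, v, a, c, hξ, hv, hd, rfl⟩
  rw [← hr a c hd]
  exact mul_mem_weightSpace
    (prod_mem_weightSpace fun i => gen_mem_weightSpace (hφ _ _ (hξ i)))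
    (prod_mem_weightSpace fun i => gen_mem_weightSpace (hψ _ _ (hv i)))

theorem homogeneousComponent_le_minus {k l : ℕ} {d : ℤ} :
    homogeneousComponent 𝒱 k l d ≤ weightSpace (isWeight_projMinus 𝒱) (k : K) :=
  homogeneousComponent_le_weightSpace (fun _ => 1) (fun _ => 0)
    (fun _ _ _ => by simp [projMinus]) (fun _ _ _ => by simp [projMinus]) (by simp)

theorem homogeneousComponent_le_plus {k l : ℕ} {d : ℤ} :
    homogeneousComponent 𝒱 k l d ≤ weightSpace (isWeight_projPlus 𝒱) (l : K) :=
  homogeneousComponent_le_weightSpace (fun _ => 0) (fun _ => 1)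
    (fun _ _ _ => by simp [projPlus]) (fun _ _ _ => by simp [projPlus]) (by simp)

theorem homogeneousComponent_le_polySpace {k l : ℕ} {d : ℤ} :
    homogeneousComponent 𝒱 k l d ≤ polySpace 𝒱 (k + l) :=
  homogeneousComponent_le_weightSpace (fun _ => 1) (fun _ => 1)
    (fun _ _ _ => by simp) (fun _ _ _ => by simp) (by simp)

theorem homogeneousComponent_le_euler (h : DirectSum.IsInternal 𝒱) {ι : Type*} [Fintype ι]
    [DecidableEq ι] (e : HomogeneousBasis 𝒱 ι) {k l : ℕ} {d : ℤ} :
    homogeneousComponent 𝒱 k l d ≤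
      weightSpace (isWeight_euler h e) ((d - (k + l - 2) : ℤ) : K) := by
  refine homogeneousComponent_le_weightSpace (fun a => (a : K)) (fun a => (a : K))
    (fun a ξ hξ => e.double.euler_of_mem ⟨Submodule.zero_mem _, hξ⟩)
    (fun a v hv => e.double.euler_of_mem ⟨hv, Submodule.zero_mem _⟩) fun a c hac => ?_
  rw [← hac, ← Int.cast_sum, ← Int.cast_sum, ← Int.cast_add]
  congr 1
  ring

/-- The sum of the total degrees `|x| - 1` of the factors differs from `d` by the even number `2 (k
+ l - 1)`. -/
theorem hasParity_of_mem (h : DirectSum.IsInternal 𝒱) {k l : ℕ} {d : ℤ} {b : BigAlgebra 𝒱}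
    (hb : b ∈ homogeneousComponent 𝒱 k l d) : HasParity d b := by
  induction hb using Submodule.span_induction with
  | mem b hb =>
    obtain ⟨ξ, v, a, c, hξ, hv, hd, rfl⟩ := hb
    have h1 := HasParity.prod (b := fun i => gen 𝒱 (0, ξ i)) (p := fun i => a i - 1)
      fun i => (genParity_of_mem h (x := (0, ξ i)) ⟨Submodule.zero_mem _, hξ i⟩).hasParity
    have h2 := HasParity.prod (b := fun i => gen 𝒱 (v i, 0)) (p := fun i => c i - 1)
      fun i => (genParity_of_mem h (x := (v i, 0)) ⟨hv i, Submodule.zero_mem _⟩).hasParity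
    have h3 := h1.mul h2
    rw [HasParity] at h3 ⊢
    rw [h3]
    congr 2
    have : ∑ i, (a i - 1) + ∑ i, (c i - 1) = d - 2 * (k + l - 1) := by
      rw [← hd]; simp; ring
    rw [this, Int.negOnePow_sub, Int.negOnePow_even _ (even_two_mul _), mul_one]
  | zero => simp [HasParity]
  | add x y _ _ hx hy => rw [HasParity] at *; rw [map_add, hx, hy, smul_add]
  | smul r x _ hx => rw [HasParity] at *; rw [map_smul, hx, smul_comm]

theorem mul_gen_plus_mem {k l : ℕ} {d a : ℤ} {b : BigAlgebra 𝒱} {v : V}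
    (hb : b ∈ homogeneousComponent 𝒱 k l d) (hv : v ∈ 𝒱 a) :
    b * gen 𝒱 (v, 0) ∈ homogeneousComponent 𝒱 k (l + 1) (d + a + 1) := by
  induction hb using Submodule.span_induction with
  | mem b hb =>
    obtain ⟨ξ, w, α, c, hξ, hw, hd, rfl⟩ := hb
    refine Submodule.subset_span ⟨ξ, Fin.snoc (α := fun _ => V) w v, α,
      Fin.snoc (α := fun _ => ℤ) c a, hξ, ?_, ?_, ?_⟩
    · intro j
      induction j using Fin.lastCases <;> simp [hw, hv]
    · rw [Fin.sum_univ_castSucc]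
      simp only [Fin.snoc_castSucc, Fin.snoc_last]
      push_cast
      rw [← hd]; ring
    · rw [List.ofFn_succ' (n := l)]
      simp [mul_assoc]
  | zero => simp
  | add x y _ _ hx hy => rw [add_mul]; exact add_mem hx hy
  | smul r x _ hx => rw [smul_mul_assoc]; exact Submodule.smul_mem _ _ hx

theorem gen_minus_mul_mem {k l : ℕ} {d a : ℤ} {b : BigAlgebra 𝒱} {η : Module.Dual K V}
    (hb : b ∈ homogeneousComponent 𝒱 k l d) (hη : η ∈ dualGrading 𝒱 a) :
    gen 𝒱 (0, η) * b ∈ homogeneousComponent 𝒱 (k + 1) l (d + a + 1) := by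
  induction hb using Submodule.span_induction with
  | mem b hb =>
    obtain ⟨ξ, w, α, c, hξ, hw, hd, rfl⟩ := hb
    refine Submodule.subset_span ⟨Fin.cons (α := fun _ => Module.Dual K V) η ξ, w,
      Fin.cons (α := fun _ => ℤ) a α, c, ?_, hw, ?_, ?_⟩
    · intro j
      induction j using Fin.cases <;> simp [hξ, hη]
    · rw [Fin.sum_univ_succ]
      simp only [Fin.cons_succ, Fin.cons_zero]
      push_cast
      rw [← hd]; ring
    · rw [List.ofFn_succ (n := k)]
      simp [mul_assoc]
  | zero => simp
  | add x y _ _ hx hy => rw [mul_add]; exact add_mem hx hy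
  | smul r x _ hx => rw [mul_smul_comm]; exact Submodule.smul_mem _ _ hx

theorem algebraMap_mem_homogeneousComponent (r : K) :
    algebraMap K (BigAlgebra 𝒱) r ∈ homogeneousComponent 𝒱 0 0 (-2) := by
  rw [Algebra.algebraMap_eq_smul_one]
  refine Submodule.smul_mem _ _ (Submodule.subset_span ⟨0, 0, 0, 0, ?_⟩)
  simp

/-- The elements of total degree `d` in `Λ^m (V ⊕ V*)`. -/
noncomputable def polyComponent (𝒱 : ℤ → Submodule K V) (m : ℕ) (d : ℤ) :
    Submodule K (BigAlgebra 𝒱) :=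
  ⨆ x ∈ Finset.HasAntidiagonal.antidiagonal m, homogeneousComponent 𝒱 x.1 x.2 d

theorem homogeneousComponent_le_polyComponent {k l m : ℕ} {d : ℤ} (hm : k + l = m) :
    homogeneousComponent 𝒱 k l d ≤ polyComponent 𝒱 m d :=
  le_iSup₂_of_le (f := fun (x : ℕ × ℕ) (_ : x ∈ Finset.HasAntidiagonal.antidiagonal m) =>
    homogeneousComponent 𝒱 x.1 x.2 d) (k, l) (by simpa using hm) le_rfl

theorem polyComponent_le {m : ℕ} {d : ℤ} {S : Submodule K (BigAlgebra 𝒱)}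
    (hS : ∀ k l, k + l = m → homogeneousComponent 𝒱 k l d ≤ S) : polyComponent 𝒱 m d ≤ S :=
  iSup₂_le fun x hx => hS _ _ (by simpa using hx)

theorem exists_of_mem_polyComponent {m : ℕ} {d : ℤ} {b : BigAlgebra 𝒱}
    (hb : b ∈ polyComponent 𝒱 m d) : ∃ t : ℕ → ℕ → BigAlgebra 𝒱,
      (∀ k l, t k l ∈ homogeneousComponent 𝒱 k l d) ∧
        b = ∑ x ∈ Finset.HasAntidiagonal.antidiagonal m, t x.1 x.2 := by
  obtain ⟨t, ht⟩ := (Submodule.mem_iSup_finset_iff_exists_sum _ _).1 hb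
  exact ⟨fun k l => t (k, l), fun k l => (t (k, l)).2, ht.symm⟩

theorem polyComponent_le_polySpace {m : ℕ} {d : ℤ} : polyComponent 𝒱 m d ≤ polySpace 𝒱 m :=
  polyComponent_le fun k l hm => by
    subst hm; exact_mod_cast homogeneousComponent_le_polySpace

theorem mul_codual_mem [CharZero K] (h : DirectSum.IsInternal 𝒱) {ι : Type*} [Fintype ι]
    [DecidableEq ι] (e : HomogeneousBasis 𝒱 ι) {m : ℕ} {d : ℤ} {b : BigAlgebra 𝒱}
    (hb : b ∈ polyComponent 𝒱 m d) (j : ι ⊕ ι) :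
    b * gen 𝒱 (e.codual j) ∈ polyComponent 𝒱 (m + 1) (d - e.double.deg j + 1) := by
  suffices polyComponent 𝒱 m d ≤ (polyComponent 𝒱 (m + 1) (d - e.double.deg j + 1)).comap
      (LinearMap.mulRight K (gen 𝒱 (e.codual j))) from this hb
  refine polyComponent_le fun k l hm b hb => ?_
  have hj := e.codual_mem h j
  rw [Submodule.mem_comap, LinearMap.mulRight_apply]
  rcases j with i | i
  -- A factor from `V*` has to be moved to the front, where the factors from `V*` stand; the sign is
  -- harmless in a subspace.
  · rw [mul_gen_comm (codual_genParity e h _), (hasParity_of_mem h hb).signInvol]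
    refine homogeneousComponent_le_polyComponent (k := k + 1) (l := l) (by omega) ?_
    exact gen_minus_mul_mem (Submodule.smul_of_tower_mem _ _ hb) hj.2
  · refine homogeneousComponent_le_polyComponent (k := k) (l := l + 1) (by omega) ?_
    exact mul_gen_plus_mem hb hj.1

end Components

/-! ### Iterated brackets with generators -/

theorem cons_mem {m : ℕ} {v : Fin m → Double K V} {a : Fin m → ℤ}
    (hv : ∀ i, v i ∈ doubleGrading 𝒱 (a i)) {x : Double K V} {c : ℤ}
    (hx : x ∈ doubleGrading 𝒱 c) (i : Fin (m + 1)) :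
    Fin.cons (α := fun _ => Double K V) x v i ∈
      doubleGrading 𝒱 (Fin.cons (α := fun _ => ℤ) c a i) := by
  induction i using Fin.cases <;> simp [hv, hx]

/-- Graded symmetry with respect to the total degrees. -/
def GradedSymm (𝒱 : ℤ → Submodule K V) {m : ℕ}
    (f : MultilinearMap K (fun _ : Fin m => Double K V) K) : Prop :=
  ∀ (v : Fin m → Double K V) (a : Fin m → ℤ), (∀ i, v i ∈ doubleGrading 𝒱 (a i)) →
    ∀ i j : Fin m, (i : ℕ) + 1 = j →
      f (v ∘ Equiv.swap i j) = (((a i - 1) * (a j - 1)).negOnePow : ℤ) • f v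

/-- `f` is homogeneous of degree `-s`. -/
def HasDegree (𝒱 : ℤ → Submodule K V) {m : ℕ}
    (f : MultilinearMap K (fun _ : Fin m => Double K V) K) (s : ℤ) : Prop :=
  ∀ (v : Fin m → Double K V) (a : Fin m → ℤ), (∀ i, v i ∈ doubleGrading 𝒱 (a i)) →
    ∑ i, a i ≠ s → f v = 0

theorem GradedSymm.curryLeft {m : ℕ}
    {f : MultilinearMap K (fun _ : Fin (m + 1) => Double K V) K} (hf : GradedSymm 𝒱 f)
    {x : Double K V} {c : ℤ} (hx : x ∈ doubleGrading 𝒱 c) : GradedSymm 𝒱 (f.curryLeft x) := by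
  intro v a hv i j hij
  have := hf _ _ (cons_mem hv hx) i.succ j.succ (by simp [hij])
  simp only [Fin.cons_succ] at this
  rw [MultilinearMap.curryLeft_apply, MultilinearMap.curryLeft_apply, ← this]
  congr 1
  ext1 k
  induction k using Fin.cases with
  | zero =>
    rw [Function.comp_apply, Equiv.swap_apply_of_ne_of_ne (Fin.succ_ne_zero i).symm
      (Fin.succ_ne_zero j).symm]
    rfl
  | succ k =>
    have : Equiv.swap i.succ j.succ k.succ = (Equiv.swap i j k).succ :=
      ((Fin.succ_injective m).map_swap i j k).symm
    simp [this]

theorem HasDegree.curryLeft {m : ℕ}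
    {f : MultilinearMap K (fun _ : Fin (m + 1) => Double K V) K} {s : ℤ} (hf : HasDegree 𝒱 f s)
    {x : Double K V} {c : ℤ} (hx : x ∈ doubleGrading 𝒱 c) :
    HasDegree 𝒱 (f.curryLeft x) (s - c) := by
  intro v a hv hs
  refine hf _ _ (cons_mem hv hx) fun h => hs ?_
  rw [Fin.sum_univ_succ] at h
  simp only [Fin.cons_zero, Fin.cons_succ] at h
  omega

theorem GradedSymm.curryLeft_curryLeft {m : ℕ}
    {f : MultilinearMap K (fun _ : Fin (m + 1 + 1) => Double K V) K} (hf : GradedSymm 𝒱 f)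
    {x y : Double K V} {c d : ℤ} (hx : x ∈ doubleGrading 𝒱 c) (hy : y ∈ doubleGrading 𝒱 d)
    {v : Fin m → Double K V} {a : Fin m → ℤ} (hv : ∀ i, v i ∈ doubleGrading 𝒱 (a i)) :
    (f.curryLeft x).curryLeft y v =
      (((c - 1) * (d - 1)).negOnePow : ℤ) • (f.curryLeft y).curryLeft x v := by
  have := hf _ _ (cons_mem (cons_mem hv hx) hy) 0 1 (by simp)
  rw [mul_comm (c - 1)]
  simp only [MultilinearMap.curryLeft_apply]
  refine Eq.trans (congrArg f ?_) this
  ext1 k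
  induction k using Fin.cases with
  | zero => simp
  | succ k =>
    induction k using Fin.cases with
    | zero => simp
    | succ k =>
      rw [Function.comp_apply, Equiv.swap_apply_of_ne_of_ne]
      · simp
      · exact Fin.succ_ne_zero _
      · exact fun h => Fin.succ_ne_zero _ (Fin.succ_injective _ h)

section Iterated

variable [CharZero K]

/-- The iterated adjoint action of a list. -/
noncomputable def iadList (𝒱 : ℤ → Submodule K V) :
    List (Double K V) → BigAlgebra 𝒱 →ₗ[K] BigAlgebra 𝒱
  | [] => LinearMap.id
  | x :: l => iadList 𝒱 l ∘ₗ ad 𝒱 x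

@[simp]
theorem iadList_nil (b : BigAlgebra 𝒱) : iadList 𝒱 [] b = b := rfl

@[simp]
theorem iadList_cons (x : Double K V) (l : List (Double K V)) (b : BigAlgebra 𝒱) :
    iadList 𝒱 (x :: l) b = iadList 𝒱 l (ad 𝒱 x b) := rfl

theorem iadList_append (l l' : List (Double K V)) (b : BigAlgebra 𝒱) :
    iadList 𝒱 (l ++ l') b = iadList 𝒱 l' (iadList 𝒱 l b) := by
  induction l generalizing b with
  | nil => rfl
  | cons x l ih => simp [ih]

theorem iad_eq_iadList (n : ℕ) (b : BigAlgebra 𝒱) (v : Fin n → Double K V) :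
    iad 𝒱 n b v = iadList 𝒱 (List.ofFn v) b := by
  induction n with
  | zero => simp [iad_zero]
  | succ n ih =>
    rw [iad_succ, ih, List.ofFn_succ', List.concat_eq_append, iadList_append, iadList_cons,
      iadList_nil, ad_apply]
    rfl

theorem iadList_mem_polySpace {m : ℕ} {b : BigAlgebra 𝒱} (l : List (Double K V))
    (hb : b ∈ polySpace 𝒱 (m + l.length)) : iadList 𝒱 l b ∈ polySpace 𝒱 m := by
  induction l generalizing b with
  | nil => exact hb
  | cons x l ih => exact ih (ad_mem_polySpace (by simpa [add_assoc] using hb) x)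

theorem linearPart_iadList_weight_eq_zero {r : K} {b : BigAlgebra 𝒱}
    (hb : b ∈ weightSpace (isWeight_id 𝒱) r) (l : List (Double K V)) (hr : r ≠ l.length + 1) :
    linearPart 𝒱 (iadList 𝒱 l b) = 0 := by
  induction l generalizing b r with
  | nil => exact linearPart_eq_zero (by simpa using hr) hb
  | cons x l ih =>
    refine ih (ad_mem_weightSpace (s := 1) hb (x := x) (by simp)) fun hc => hr ?_
    simp only [List.length_cons]
    push_cast
    linear_combination hc

theorem linearPart_iadList_eq_zero {m : ℕ} {b : BigAlgebra 𝒱} (hb : b ∈ polySpace 𝒱 m)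
    (l : List (Double K V)) (hm : m ≠ l.length + 1) : linearPart 𝒱 (iadList 𝒱 l b) = 0 :=
  linearPart_iadList_weight_eq_zero hb l (by exact_mod_cast hm)

section Basis

variable {ι : Type*} [Fintype ι] [DecidableEq ι] (e : HomogeneousBasis 𝒱 ι)

/-- Iterating `eq_zero_of_ad` reduces the degree to `0`; thus elements of degree `m` embed into
`m`-linear forms. -/
theorem eq_zero_of_iadList (h : DirectSum.IsInternal 𝒱) {m : ℕ} {b : BigAlgebra 𝒱}
    (hb : b ∈ polySpace 𝒱 m)
    (h0 : ∀ u : Fin m → ι ⊕ ι, iadList 𝒱 (List.ofFn fun i => e.double.vec (u i)) b = 0) :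
    b = 0 := by
  induction m generalizing b with
  | zero => simpa using h0 Fin.elim0
  | succ m ih =>
    refine eq_zero_of_ad e h (Nat.succ_ne_zero m) hb fun j => ih (ad_mem_polySpace hb _) fun u => ?_
    simpa [List.ofFn_succ] using h0 (Fin.cons j u)

theorem eq_zero_of_linearPart_iadList [FiniteDimensional K V] (h : DirectSum.IsInternal 𝒱) {m : ℕ}
    {b : BigAlgebra 𝒱} (hb : b ∈ polySpace 𝒱 (m + 1))
    (h0 : ∀ u : Fin m → ι ⊕ ι,
      linearPart 𝒱 (iadList 𝒱 (List.ofFn fun i => e.double.vec (u i)) b) = 0) : b = 0 := by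
  refine eq_zero_of_iadList e h hb fun u => ?_
  have := h0 fun i => u i.castSucc
  have hm : iadList 𝒱 (List.ofFn fun i => e.double.vec (u (Fin.castSucc i))) b ∈
      polySpace 𝒱 1 := iadList_mem_polySpace _ (by simpa [add_comm] using hb)
  rw [List.ofFn_succ', List.concat_eq_append, iadList_append, ← gen_linearPart h hm, this]
  simp

end Basis

/-- Graded symmetric multilinear forms are iterated brackets. -/
theorem exists_iadList_eq [FiniteDimensional K V] (h : DirectSum.IsInternal 𝒱) {m : ℕ}
    (f : MultilinearMap K (fun _ : Fin m => Double K V) K) {s : ℤ} (hs : GradedSymm 𝒱 f)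
    (hd : HasDegree 𝒱 f s) :
    ∃ b ∈ polyComponent 𝒱 m (m - 2 - s), ∀ v, iadList 𝒱 (List.ofFn v) b = algebraMap K _ (f v) := by
  obtain ⟨n, ⟨e⟩⟩ := exists_homogeneousBasis h
  induction m generalizing s with
  | zero =>
    have hf : ∀ v, f v = f Fin.elim0 := fun v => congrArg f (Subsingleton.elim _ _)
    refine ⟨algebraMap K _ (f Fin.elim0), ?_, fun v => by simp [hf v]⟩
    -- A constant form can be nonzero only if `s = 0`, and then total degree `-2` is that of a
    -- scalar.
    by_cases h0 : s = 0
    · subst h0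
      exact homogeneousComponent_le_polyComponent (k := 0) (l := 0) rfl
        (by simpa using algebraMap_mem_homogeneousComponent _)
    · rw [hd Fin.elim0 Fin.elim0 (fun i => i.elim0) (by simpa using Ne.symm h0), map_zero]
      exact zero_mem _
  | succ m ih =>
    have hmem := e.double.mem
    choose b hb hbf using fun i => ih (f.curryLeft (e.double.vec i)) (hs.curryLeft (hmem i))
      (hd.curryLeft (hmem i))
    -- Euler's formula read backwards: `b i` represents `f` with `e_i` inserted first, so it should
    -- be the contraction of the element sought with `e_i`.
    refine ⟨((m : K) + 1)⁻¹ • ∑ i, b i * gen 𝒱 (e.codual i), ?_, ?_⟩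
    · refine Submodule.smul_mem _ _ (Submodule.sum_mem _ fun i _ => ?_)
      convert mul_codual_mem h e (hb i) i using 2
      push_cast; ring
    have hpar := fun i => genParity_of_mem h (hmem i)
    -- The analogue of the symmetry of second partial derivatives, the integrability condition for
    -- the `b i`. It comes from the symmetry of `f` in its first two arguments.
    have hswap : ∀ i j, ad 𝒱 (e.double.vec j) (b i) =
        (((e.double.deg i - 1) * (e.double.deg j - 1)).negOnePow : ℤ) •
          ad 𝒱 (e.double.vec i) (b j) := by
      intro i j
      cases m with
      | zero =>
        have h0 : ∀ i, b i = algebraMap K _ (f.curryLeft (e.double.vec i) Fin.elim0) := fun i => by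
          simpa using hbf i Fin.elim0
        simp [h0, ad_algebraMap]
      | succ m =>
        have hpoly := fun i j =>
          ad_mem_polySpace (polyComponent_le_polySpace (hb i)) (e.double.vec j)
        rw [← sub_eq_zero]
        refine eq_zero_of_iadList e h
          (sub_mem (hpoly i j) (Submodule.smul_of_tower_mem _ _ (hpoly j i))) fun u => ?_
        have key : ∀ i j, iadList 𝒱 (List.ofFn fun k => e.double.vec (u k))
            (ad 𝒱 (e.double.vec j) (b i)) = algebraMap K _ (((f.curryLeft
              (e.double.vec i)).curryLeft (e.double.vec j)) fun k => e.double.vec (u k)) := by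
          intro i j
          rw [MultilinearMap.curryLeft_apply, ← hbf i, List.ofFn_succ, iadList_cons]
          simp
        rw [map_sub, map_zsmul, key, key,
          hs.curryLeft_curryLeft (hmem i) (hmem j) (fun k => hmem (u k)), map_zsmul, sub_self]
    -- Contraction of the dual vectors contributes `b j` once. By `hswap` the other terms form the
    -- Euler sum of `b j`, which is `m • b j`.
    have had : ∀ j, ad 𝒱 (e.double.vec j)
        (((m : K) + 1)⁻¹ • ∑ i, b i * gen 𝒱 (e.codual i)) = b j := by
      intro j
      have hterm : ∀ i, ad 𝒱 (e.double.vec j) (b i * gen 𝒱 (e.codual i)) =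
          (if i = j then b i else 0) + ad 𝒱 (e.double.vec i) (b j) * gen 𝒱 (e.codual i) := by
        intro i
        rw [ad_mul (hpar j), ad_gen, e.pairing_codual h,
          (codual_genParity e h i).hasParity.signInvol, hswap, mul_comm (e.double.deg j - 1),
          smul_mul_smul_comm, ← Units.val_mul, Int.units_mul_self]
        split_ifs <;> simp
      rw [map_smul, map_sum, Finset.sum_congr rfl fun i _ => hterm i, Finset.sum_add_distrib,
        sum_ad_mul_codual e h, Finset.sum_ite_eq' Finset.univ j b, if_pos (Finset.mem_univ _),
        mem_weightSpace.1 (polyComponent_le_polySpace (hb j))]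
      have : b j + (m : K) • b j = ((m : K) + 1) • b j := by rw [add_smul, one_smul, add_comm]
      rw [this, smul_smul, inv_mul_cancel₀ (by exact_mod_cast Nat.succ_ne_zero m), one_smul]
    intro v
    rw [List.ofFn_succ, iadList_cons]
    suffices iadList 𝒱 (List.ofFn fun i => v (Fin.succ i)) ∘ₗ (ad 𝒱).flip
        (((m : K) + 1)⁻¹ • ∑ i, b i * gen 𝒱 (e.codual i)) = Algebra.linearMap K _ ∘ₗ
          (f.toLinearMap v 0) by
      have h2 := LinearMap.congr_fun this (v 0)
      simpa using h2
    refine e.double.vec.ext fun j => ?_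
    simp only [LinearMap.comp_apply, LinearMap.flip_apply, had, hbf, Algebra.linearMap_apply,
      MultilinearMap.curryLeft_apply, MultilinearMap.toLinearMap_apply]
    congr 2
    ext1 k
    induction k using Fin.cases <;> simp

end Iterated

end BigAlgebra
/-! ### Unshuffles as subsets -/

section Subsets

theorem sum_finset_fin_succ {M : Type*} [AddCommMonoid M] {n : ℕ} (F : Finset (Fin (n + 1)) → M) :
    ∑ S, F S = ∑ S : Finset (Fin n),
      (F (S.map (Fin.succEmb n)) + F (insert 0 (S.map (Fin.succEmb n)))) := by
  classical
  have h0 : (0 : Fin (n + 1)) ∉ Finset.univ.image Fin.succ := by simp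
  have hu : (Finset.univ : Finset (Fin (n + 1))) = insert 0 (Finset.univ.image Fin.succ) := by
    ext i; induction i using Fin.cases <;> simp
  have hinj : Function.Injective (fun S : Finset (Fin n) => S.image Fin.succ) :=
    Finset.image_injective (Fin.succ_injective n)
  rw [← Finset.powerset_univ, hu, Finset.sum_powerset_insert h0, Finset.powerset_image,
    Finset.sum_image hinj.injOn, Finset.sum_image hinj.injOn, Finset.powerset_univ,
    ← Finset.sum_add_distrib]
  simp only [Finset.map_eq_image, Fin.coe_succEmb]

theorem compl_map_succEmb {n : ℕ} (S : Finset (Fin n)) :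
    (S.map (Fin.succEmb n))ᶜ = insert 0 (Sᶜ.map (Fin.succEmb n)) := by
  ext i; induction i using Fin.cases <;> simp

theorem compl_insert_map_succEmb {n : ℕ} (S : Finset (Fin n)) :
    (insert 0 (S.map (Fin.succEmb n)))ᶜ = Sᶜ.map (Fin.succEmb n) := by
  ext i; induction i using Fin.cases <;> simp

theorem sort_map_succEmb {n : ℕ} (S : Finset (Fin n)) :
    (S.map (Fin.succEmb n)).sort = S.sort.map Fin.succ :=
  (StrictMonoOn.map_finsetSort (f := Fin.succEmb n) S
    (Fin.strictMono_succ.strictMonoOn _)).symm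

theorem sort_insert_map_succEmb {n : ℕ} (S : Finset (Fin n)) :
    (insert 0 (S.map (Fin.succEmb n))).sort = 0 :: S.sort.map Fin.succ := by
  rw [Finset.sort_insert _ (fun b _ => Fin.zero_le b) (by simp), sort_map_succEmb]

theorem ofFn_orderEmbOfFin {X : Type*} {n : ℕ} (v : Fin n → X) (S : Finset (Fin n)) :
    List.ofFn (fun i => v (S.orderEmbOfFin rfl i)) = S.sort.map v := by
  rw [List.ofFn_eq_map, ← Finset.listMap_orderEmbOfFin_finRange S rfl, List.map_map]
  rfl

theorem koszulSign_insert {n : ℕ} (a : Fin (n + 1) → ℤ) (S : Finset (Fin n)) :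
    koszulSign a (insert 0 (S.map (Fin.succEmb n))) = koszulSign (fun i => a i.succ) S := by
  rw [koszulSign, koszulSign, compl_insert_map_succEmb]
  simp [Finset.prod_insert]

/-- The index `0` is not selected, so every element of `S` passes it. If it is selected, as in
`koszulSign_insert`, it stays in front without a sign. -/
theorem koszulSign_map {n : ℕ} (a : Fin (n + 1) → ℤ) (S : Finset (Fin n)) :
    koszulSign a (S.map (Fin.succEmb n)) =
      ((a 0 - 1) * ∑ j ∈ S, (a j.succ - 1)).negOnePow * koszulSign (fun i => a i.succ) S := by
  have h : ∀ S : Finset (Fin n), ∏ j ∈ S, ((a 0 - 1) * (a j.succ - 1)).negOnePow =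
      ((a 0 - 1) * ∑ j ∈ S, (a j.succ - 1)).negOnePow := fun S => by
    induction S using Finset.induction_on with
    | empty => simp
    | insert i S hi ih => rw [Finset.prod_insert hi, Finset.sum_insert hi, ih, mul_add,
        Int.negOnePow_add]
  simp [koszulSign, compl_map_succEmb, Finset.prod_insert, h]

end Subsets

namespace BigAlgebra

variable {K : Type*} [Field K] {V : Type*} [AddCommGroup V] [Module K V]
  {𝒱 : ℤ → Submodule K V} [CharZero K]

/-! ### The higher Jacobi identities -/

theorem HasParity.iadList {n : ℕ} {v : Fin n → Double K V} {p : Fin n → ℤ}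
    (hv : ∀ i, GenParity 𝒱 (p i) (v i)) (l : List (Fin n)) {q : ℤ} {b : BigAlgebra 𝒱}
    (hb : HasParity q b) : HasParity (q + (l.map p).sum) (iadList 𝒱 (l.map v) b) := by
  induction l generalizing q b with
  | nil => simpa using hb
  | cons i l ih =>
    have := ih (hb.ad (hv i))
    rwa [List.map_cons, List.map_cons, iadList_cons, List.sum_cons, ← add_assoc]

/-- The sum over unshuffles in the higher Jacobi identities, for two elements of the algebra. -/
noncomputable def jacobiator (𝒱 : ℤ → Submodule K V) {n : ℕ} (v : Fin n → Double K V)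
    (a : Fin n → ℤ) (A B : BigAlgebra 𝒱) : Double K V :=
  ∑ S : Finset (Fin n), (koszulSign a S : ℤ) • linearPart 𝒱 (iadList 𝒱 (Sᶜ.sort.map v)
    (ad 𝒱 (linearPart 𝒱 (iadList 𝒱 (S.sort.map v) B)) A))

/-- The sets `S` are split according to whether they contain `0`: the first argument goes either
into `B` or into `A`. This is the recursion that `ad_bigBracket` produces for the bracket `[A, B]`.
-/
theorem jacobiator_succ {n : ℕ} {v : Fin (n + 1) → Double K V}
    {a : Fin (n + 1) → ℤ} (hv : ∀ i, GenParity 𝒱 (a i - 1) (v i)) {q : ℤ} {A B : BigAlgebra 𝒱}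
    (hB : HasParity q B) :
    jacobiator 𝒱 v a A B =
      jacobiator 𝒱 (fun i => v i.succ) (fun i => a i.succ) A (ad 𝒱 (v 0) B) +
      ((q * (a 0 - 1)).negOnePow : ℤ) •
        jacobiator 𝒱 (fun i => v i.succ) (fun i => a i.succ) (ad 𝒱 (v 0) A) B := by
  rw [jacobiator, sum_finset_fin_succ, Finset.sum_add_distrib, add_comm]
  congr 1
  · refine Finset.sum_congr rfl fun S _ => ?_
    rw [koszulSign_insert, compl_insert_map_succEmb, sort_insert_map_succEmb, sort_map_succEmb]
    simp [Function.comp_def]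
  · rw [jacobiator, Finset.smul_sum]
    refine Finset.sum_congr rfl fun S _ => ?_
    have hS : ((S.sort).map fun i => a i.succ - 1).sum = ∑ j ∈ S, (a j.succ - 1) := by
      rw [← List.sum_toFinset _ (Finset.sort_nodup S _), Finset.sort_toFinset]
    have hpar := (HasParity.iadList (fun i => hv i.succ) S.sort hB).linearPart
    rw [koszulSign_map, compl_map_succEmb, sort_insert_map_succEmb, sort_map_succEmb]
    simp only [List.map_cons, List.map_map, iadList_cons, Function.comp_def]
    -- In the Jacobi sum the inner bracket acts on `A` before `v 0`. Exchanging them gives a sign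
    -- that involves all of `S`; this part cancels against the unshuffle sign, and only `q * (a 0 -
    -- 1)` survives.
    rw [ad_comm (hv 0) hpar, hS, map_zsmul, map_zsmul, smul_smul, smul_smul, ← Units.val_mul,
      ← Units.val_mul]
    congr 2
    rw [mul_right_comm, ← Int.negOnePow_add, show (a 0 - 1) * ∑ j ∈ S, (a j.succ - 1) +
      (a 0 - 1) * (q + ∑ j ∈ S, (a j.succ - 1)) =
        q * (a 0 - 1) + 2 * ((a 0 - 1) * ∑ j ∈ S, (a j.succ - 1)) by ring, Int.negOnePow_add,
      Int.negOnePow_even _ (even_two_mul _), mul_one]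

/-- Each contraction acts on `[A, B]` as a derivation, matching the recursion of `jacobiator` in
both orders. Without arguments, the linear part of `[A, B]` needs a linear entry on one side, and
skew-symmetry brings it to the right. -/
theorem linearPart_iadList_bigBracket [FiniteDimensional K V] (h : DirectSum.IsInternal 𝒱)
    {n : ℕ} {v : Fin n → Double K V} {a : Fin n → ℤ} (hv : ∀ i, GenParity 𝒱 (a i - 1) (v i))
    {p q : ℤ} {A B : BigAlgebra 𝒱} (hA : HasParity p A) (hB : HasParity q B) :
    linearPart 𝒱 (iadList 𝒱 (List.ofFn v) (bigBracket 𝒱 A B)) =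
      jacobiator 𝒱 v a A B - ((p * q).negOnePow : ℤ) • jacobiator 𝒱 v a B A := by
  induction n generalizing p q A B with
  | zero =>
    have hs : ∀ S : Finset (Fin 0), S.sort = [] := fun S => by
      rw [Subsingleton.elim S ∅, Finset.sort_empty]
    have hk : ∀ S : Finset (Fin 0), koszulSign a S = 1 := fun S => by
      rw [Subsingleton.elim S ∅]; simp [koszulSign]
    simp only [jacobiator, hs, hk, List.ofFn_zero, List.map_nil, iadList_nil, Finset.univ_unique,
      Finset.sum_singleton]
    rw [linearPart_bigBracket h,
      bigBracket_gen_left_eq hA.linearPart hB, ad_apply, ad_apply, map_neg, map_zsmul,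
      ← sub_eq_add_neg]
    simp
  | succ n ih =>
    rw [List.ofFn_succ, iadList_cons, ad_bigBracket hA (hv 0), hB.signInvol, map_add, map_add,
      map_zsmul, map_zsmul, map_zsmul, ih (fun i => hv i.succ) hA (hB.ad (hv 0)),
      ih (fun i => hv i.succ) (hA.ad (hv 0)) hB, jacobiator_succ hv hB, jacobiator_succ hv hA,
      mul_add, add_mul, Int.negOnePow_add, Int.negOnePow_add, mul_comm q (a 0 - 1)]
    rcases Int.units_eq_one_or (p * q).negOnePow with h1 | h1 <;>
    rcases Int.units_eq_one_or (p * (a 0 - 1)).negOnePow with h2 | h2 <;>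
    rcases Int.units_eq_one_or ((a 0 - 1) * q).negOnePow with h3 | h3 <;>
    simp [h1, h2, h3] <;> abel

/-! ### Truncated sums -/

/-- A truncation of the formal sum `∑ t k l`. -/
noncomputable def truncation (t : ℕ → ℕ → BigAlgebra 𝒱) (N : ℕ) : BigAlgebra 𝒱 :=
  ∑ x ∈ Finset.range N ×ˢ Finset.range N, t x.1 x.2

theorem derivedBrackets_apply (t : ℕ → ℕ → BigAlgebra 𝒱) {n : ℕ} (v : Fin n → Double K V) :
    derivedBrackets 𝒱 t n v = linearPart 𝒱 (iadList 𝒱 (List.ofFn v)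
      (∑ x ∈ Finset.HasAntidiagonal.antidiagonal (n + 1), t x.1 x.2)) := by
  simp [derivedBrackets, iad_eq_iadList, map_sum]

variable {t : ℕ → ℕ → BigAlgebra 𝒱} {d : ℤ}

/-- After `n` contractions only the components with `k + l = n + 1` have a linear part, and all of
them have indices below `N`. A finite sum can therefore replace the formal sum `T`. -/
theorem linearPart_iadList_truncation (ht : ∀ k l, t k l ∈ homogeneousComponent 𝒱 k l d)
    {n N : ℕ} (hN : n + 2 ≤ N) (v : Fin n → Double K V) :
    linearPart 𝒱 (iadList 𝒱 (List.ofFn v) (truncation t N)) = derivedBrackets 𝒱 t n v := by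
  rw [derivedBrackets_apply, truncation]
  simp only [map_sum]
  refine (Finset.sum_subset (fun x hx => ?_) fun x hx hx' => ?_).symm
  · have := Finset.HasAntidiagonal.mem_antidiagonal.1 hx
    simp only [Finset.mem_product, Finset.mem_range]
    omega
  · refine linearPart_iadList_eq_zero (m := x.1 + x.2)
      (by exact_mod_cast homogeneousComponent_le_polySpace (ht x.1 x.2)) _ ?_
    rw [List.length_ofFn]
    exact fun hc => hx' (Finset.HasAntidiagonal.mem_antidiagonal.2 hc)

/-- The component of `[T, T]` in `Λ^(p-1) V* ⊗ Λ^(q-1) V` for `T = ∑ t k l`. -/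
noncomputable def squareComponent (t : ℕ → ℕ → BigAlgebra 𝒱) (p q : ℕ) : BigAlgebra 𝒱 :=
  ∑ x ∈ Finset.HasAntidiagonal.antidiagonal p, ∑ y ∈ Finset.HasAntidiagonal.antidiagonal q,
    bigBracket 𝒱 (t x.1 y.1) (t x.2 y.2)

theorem bigBracket_mem_polySpace {k l k' l' : ℕ} {a b : BigAlgebra 𝒱} {d d' : ℤ}
    (ha : a ∈ homogeneousComponent 𝒱 k l d) (hb : b ∈ homogeneousComponent 𝒱 k' l' d') :
    bigBracket 𝒱 a b ∈ weightSpace (isWeight_id 𝒱) (((k + k') + (l + l') : ℕ) - 2 : K) := by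
  have := bigBracket_mem_weightSpace (homogeneousComponent_le_polySpace ha)
    (homogeneousComponent_le_polySpace hb)
  convert this using 2
  push_cast; ring

theorem linearPart_iadList_bigBracket_truncation
    (ht : ∀ k l, t k l ∈ homogeneousComponent 𝒱 k l d) {n N : ℕ} (hN : n + 4 ≤ N)
    (v : Fin n → Double K V) :
    linearPart 𝒱 (iadList 𝒱 (List.ofFn v) (bigBracket 𝒱 (truncation t N) (truncation t N))) =
    linearPart 𝒱 (iadList 𝒱 (List.ofFn v)
      (∑ z ∈ Finset.HasAntidiagonal.antidiagonal (n + 3), squareComponent t z.1 z.2)) := by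
  simp only [truncation, squareComponent, map_sum, LinearMap.sum_apply]
  rw [← Finset.sum_product', Finset.sum_sigma', Finset.sum_sigma']
  symm
  -- The outer index of the expanded sum belongs to the second entry of the bracket, hence the
  -- exchange of pairs. Only terms with `k + k' + l + l' = n + 3` are nonzero, since the bracket
  -- removes two factors and the contractions remove `n`.
  refine Finset.sum_bij_ne_zero
    (fun z _ _ => ((z.1.2.2, z.2.2), (z.1.2.1, z.2.1))) ?_ ?_ ?_ ?_
  · rintro ⟨⟨⟨p, q⟩, ⟨k, k'⟩⟩, ⟨l, l'⟩⟩ hz _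
    simp only [Finset.mem_sigma, Finset.HasAntidiagonal.mem_antidiagonal] at hz
    simp only [Finset.mem_product, Finset.mem_range]
    omega
  · rintro ⟨⟨⟨p, q⟩, ⟨k, k'⟩⟩, ⟨l, l'⟩⟩ hz _ ⟨⟨⟨p₁, q₁⟩, ⟨k₁, k₁'⟩⟩, ⟨l₁, l₁'⟩⟩ hz₁ _ heq
    simp only [Finset.mem_sigma, Finset.HasAntidiagonal.mem_antidiagonal] at hz hz₁
    simp only [Prod.mk.injEq] at heq
    obtain ⟨⟨rfl, rfl⟩, rfl, rfl⟩ := heq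
    obtain ⟨⟨-, rfl⟩, rfl⟩ := hz
    obtain ⟨⟨-, rfl⟩, rfl⟩ := hz₁
    rfl
  · rintro ⟨⟨k', l'⟩, ⟨k, l⟩⟩ _ h0
    have hsum : k + k' + (l + l') = n + 3 := by
      by_contra hc
      refine h0 (linearPart_iadList_weight_eq_zero (bigBracket_mem_polySpace (ht k l) (ht k' l')) _
        fun he => hc ?_)
      have : ((k + k' + (l + l') : ℕ) : K) = (n + 3 : ℕ) := by
        rw [List.length_ofFn] at he
        push_cast at he ⊢
        linear_combination he
      exact_mod_cast this
    refine ⟨⟨⟨(k + k', l + l'), (k, k')⟩, (l, l')⟩, ?_, h0, rfl⟩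
    simpa using hsum
  · intros
    rfl

/-- The iterated brackets of `½ [T, T]` are the sums in the higher Jacobi identities. -/
theorem linearPart_iadList_squareComponent [FiniteDimensional K V]
    (h : DirectSum.IsInternal 𝒱) (ht : ∀ k l, t k l ∈ homogeneousComponent 𝒱 k l 1) {n : ℕ}
    {v : Fin n → Double K V} {a : Fin n → ℤ} (hv : ∀ i, v i ∈ doubleGrading 𝒱 (a i)) :
    linearPart 𝒱 (iadList 𝒱 (List.ofFn v)
      (∑ z ∈ Finset.HasAntidiagonal.antidiagonal (n + 3), squareComponent t z.1 z.2)) =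
    (2 : K) • ∑ S : Finset (Fin n), (koszulSign a S : ℤ) •
      derivedBrackets 𝒱 t (Sᶜ.card + 1) (Fin.cons (α := fun _ => Double K V)
        (derivedBrackets 𝒱 t S.card fun i => v (S.orderEmbOfFin rfl i))
        (fun i => v (Sᶜ.orderEmbOfFin rfl i))) := by
  -- As `T` is odd, the relative sign between the two Jacobi sums is `+`, and they are equal; this
  -- is the factor `2`.
  have hU : HasParity 1 (truncation t (n + 4)) := by
    rw [HasParity, truncation, map_sum, Finset.smul_sum]
    exact Finset.sum_congr rfl fun x _ => hasParity_of_mem h (ht x.1 x.2)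
  rw [← linearPart_iadList_bigBracket_truncation ht le_rfl,
    linearPart_iadList_bigBracket h (fun i => genParity_of_mem h (hv i)) hU hU]
  simp only [mul_one, Int.negOnePow_one, Units.val_neg, Units.val_one, neg_smul, one_smul,
    sub_neg_eq_add]
  rw [two_smul]
  suffices jacobiator 𝒱 v a (truncation t (n + 4)) (truncation t (n + 4)) = _ from
    congrArg₂ (· + ·) this this
  refine Finset.sum_congr rfl fun S _ => ?_
  have hS : S.card ≤ n := by simpa using S.card_le_univ
  have hSc : Sᶜ.card ≤ n := by simpa using Sᶜ.card_le_univ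
  rw [← linearPart_iadList_truncation ht (N := n + 4) (by omega),
    ← linearPart_iadList_truncation ht (N := n + 4) (by omega), List.ofFn_succ]
  simp only [Fin.cons_zero, Fin.cons_succ, iadList_cons, ofFn_orderEmbOfFin]

end BigAlgebra
-- Weights of iterated contractions, and uniqueness of the structure elements
theorem HomogeneousBasis.mem_of_euler {K : Type*} [Field K] [CharZero K] {X : Type*}
    [AddCommGroup X] [Module K X] {gr : ℤ → Submodule K X} {ι : Type*} [Fintype ι]
    (b : HomogeneousBasis gr ι) {a : ℤ} {x : X} (hx : b.euler x = (a : K) • x) : x ∈ gr a := by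
  have hsum : b.euler x = ∑ i, (b.vec.repr x i * b.deg i) • b.vec i := by
    conv_lhs => rw [← b.vec.sum_repr x]
    simp only [map_sum, map_smul, b.euler_vec, smul_smul]
  rw [← b.vec.sum_repr x]
  refine Submodule.sum_mem _ fun i _ => ?_
  by_cases hi : b.deg i = a
  · exact hi ▸ Submodule.smul_mem _ _ (b.mem i)
  · have h1 := congrArg (fun y => b.vec.repr y i) hx
    simp only [hsum, b.vec.repr_sum_self, map_smul, Finsupp.smul_apply, smul_eq_mul] at h1
    have h2 : b.vec.repr x i * ((b.deg i : K) - a) = 0 := by linear_combination h1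
    rw [(mul_eq_zero.1 h2).resolve_right (sub_ne_zero.2 (by exact_mod_cast hi)), zero_smul]
    exact zero_mem _

theorem isInternal_range {K : Type*} [Field K] {X Y : Type*} [AddCommGroup X] [Module K X]
    [AddCommGroup Y] [Module K Y]
    {gr : ℤ → Submodule K X} {gr' : ℤ → Submodule K Y} (h : DirectSum.IsInternal gr)
    (f : X →ₗ[K] Y) (hf : Function.Injective f) (hgr : ∀ a x, f x ∈ gr' a ↔ x ∈ gr a) :
    DirectSum.IsInternal (inducedGrading gr' (LinearMap.range f)) := by
  refine isInternal_of_map h (LinearEquiv.ofInjective f hf) fun a => ?_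
  ext ⟨_, y, rfl⟩
  rw [inducedGrading, Submodule.mem_comap, Submodule.subtype_apply, hgr, Submodule.mem_map]
  refine ⟨fun ⟨x, hx, hxy⟩ => ?_, fun hy => ⟨y, hy, rfl⟩⟩
  rwa [← hf (congrArg Subtype.val hxy)]

namespace BigAlgebra

variable {K : Type*} [Field K] {V : Type*} [AddCommGroup V] [Module K V]
  {𝒱 : ℤ → Submodule K V}

/-- On an antidiagonal `k` determines `l`, so the terms lie in eigenspaces of a single derivation
for different eigenvalues and cannot cancel. -/
theorem eq_zero_of_sum_antidiagonal {w : Double K V →ₗ[K] Double K V} {c : K}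
    {hw : IsWeight 𝒱 w c} {m : ℕ} {s : ℕ → ℕ → BigAlgebra 𝒱} {μ : ℕ → K}
    (hμ : Function.Injective μ) (hs : ∀ k l, s k l ∈ weightSpace hw (μ k))
    (h0 : ∑ x ∈ Finset.HasAntidiagonal.antidiagonal m, s x.1 x.2 = 0) {k l : ℕ}
    (hkl : k + l = m) : s k l = 0 := by
  have hind := (Module.End.eigenspaces_iSupIndep (weightDer hw)).comp hμ
  rw [Finset.Nat.sum_antidiagonal_eq_sum_range_succ] at h0
  have := (iSupIndep_iff_finsetSum_eq_zero_imp_eq_zero _).1 hind (Finset.range m.succ)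
    (fun k => s k (m - k)) (fun k _ => hs _ _) h0 k (by simp; omega)
  rwa [← hkl, Nat.add_sub_cancel_left] at this

/-- The part of `∑ t k l` that gives the bracket in `n` arguments. -/
noncomputable def levelSum (t : ℕ → ℕ → BigAlgebra 𝒱) (n : ℕ) : BigAlgebra 𝒱 :=
  ∑ x ∈ Finset.HasAntidiagonal.antidiagonal (n + 1), t x.1 x.2

theorem levelSum_mem {t : ℕ → ℕ → BigAlgebra 𝒱} {d : ℤ}
    (ht : ∀ k l, t k l ∈ homogeneousComponent 𝒱 k l d) (n : ℕ) :
    levelSum t n ∈ polySpace 𝒱 (n + 1) := by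
  refine sum_mem fun x hx => ?_
  rw [← Finset.HasAntidiagonal.mem_antidiagonal.1 hx]
  exact_mod_cast homogeneousComponent_le_polySpace (ht x.1 x.2)

variable [CharZero K]

theorem iadList_mem_weightSpace {w : Double K V →ₗ[K] Double K V} {c : K} {hw : IsWeight 𝒱 w c}
    {n : ℕ} {v : Fin n → Double K V} {s : Fin n → K} (hv : ∀ i, w (v i) = s i • v i) {r : K}
    {b : BigAlgebra 𝒱} (hb : b ∈ weightSpace hw r) :
    iadList 𝒱 (List.ofFn v) b ∈ weightSpace hw (r + ∑ i, s i - n * c) := by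
  induction n generalizing r b with
  | zero => simpa using hb
  | succ n ih =>
    rw [List.ofFn_succ, iadList_cons]
    have := ih (fun i => hv i.succ) (ad_mem_weightSpace hb (hv 0))
    convert this using 2
    rw [Fin.sum_univ_succ]
    push_cast
    ring

theorem iadList_swap {n : ℕ} {v : Fin n → Double K V} {p : Fin n → ℤ}
    (hv : ∀ i, GenParity 𝒱 (p i) (v i)) {i j : Fin n} (hij : (i : ℕ) + 1 = j)
    (b : BigAlgebra 𝒱) : iadList 𝒱 (List.ofFn (v ∘ Equiv.swap i j)) b =
      ((p i * p j).negOnePow : ℤ) • iadList 𝒱 (List.ofFn v) b := by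
  induction n generalizing b with
  | zero => exact i.elim0
  | succ n ih =>
    induction j using Fin.cases with
    | zero => simp at hij
    | succ j =>
      induction i using Fin.cases with
      | zero =>
        obtain ⟨n, rfl⟩ : ∃ m, n = m + 1 := Nat.exists_eq_succ_of_ne_zero fun h => by
          subst h; exact j.elim0
        obtain rfl : j = 0 := Fin.ext (by simpa using hij.symm)
        have h2 : ∀ k : Fin n, Equiv.swap (0 : Fin (n + 2)) (Fin.succ 0) k.succ.succ =
            k.succ.succ := fun k => Equiv.swap_apply_of_ne_of_ne (Fin.succ_ne_zero _)
              fun h => Fin.succ_ne_zero _ (Fin.succ_injective _ h)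
        rw [List.ofFn_succ, List.ofFn_succ, List.ofFn_succ, List.ofFn_succ]
        simp only [Function.comp_apply, iadList_cons, h2, Equiv.swap_apply_left,
          Equiv.swap_apply_right]
        rw [ad_comm (hv 0) (hv (Fin.succ 0)), map_zsmul]
      | succ i =>
        have h0 : Equiv.swap i.succ j.succ 0 = 0 :=
          Equiv.swap_apply_of_ne_of_ne (Fin.succ_ne_zero i).symm (Fin.succ_ne_zero j).symm
        have h1 : ∀ k, Equiv.swap i.succ j.succ k.succ = (Equiv.swap i j k).succ := fun k =>
          ((Fin.succ_injective n).map_swap i j k).symm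
        rw [List.ofFn_succ, List.ofFn_succ]
        simp only [Function.comp_apply, h0, h1, iadList_cons]
        exact ih (v := fun k => v k.succ) (fun k => hv k.succ) (by simpa using hij) _

section Level

variable {t : ℕ → ℕ → BigAlgebra 𝒱} {d : ℤ}

/-- The contributing components have polynomial degree `n + 1`, so after `n` contractions they are
already linear and the projection loses nothing. -/
theorem gen_derivedBrackets [FiniteDimensional K V] (h : DirectSum.IsInternal 𝒱)
    (ht : ∀ k l, t k l ∈ homogeneousComponent 𝒱 k l d) {n : ℕ} (v : Fin n → Double K V) :
    gen 𝒱 (derivedBrackets 𝒱 t n v) = iadList 𝒱 (List.ofFn v) (levelSum t n) := by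
  rw [derivedBrackets_apply]
  refine gen_linearPart h (iadList_mem_polySpace _ ?_)
  rw [List.length_ofFn, add_comm]
  exact levelSum_mem ht n

theorem algebraMap_pairing_derivedBrackets [FiniteDimensional K V] (h : DirectSum.IsInternal 𝒱)
    (ht : ∀ k l, t k l ∈ homogeneousComponent 𝒱 k l d) {n : ℕ} (v : Fin n → Double K V)
    (y : Double K V) : algebraMap K _ (pairing 𝒱 (derivedBrackets 𝒱 t n v) y) =
      ad 𝒱 y (iadList 𝒱 (List.ofFn v) (levelSum t n)) := by
  rw [← ad_gen, gen_derivedBrackets h ht]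

theorem iadList_ofFn_snoc {n : ℕ} (v : Fin n → Double K V) (y : Double K V) (b : BigAlgebra 𝒱) :
    iadList 𝒱 (List.ofFn (Fin.snoc (α := fun _ => Double K V) v y)) b =
      ad 𝒱 y (iadList 𝒱 (List.ofFn v) b) := by
  rw [List.ofFn_succ', List.concat_eq_append, iadList_append]
  simp

/-- Linear parts of contractions detect the sum over each antidiagonal, and the number of factors
from `V*` separates its terms. Every bracket involves `k + l = n + 1 ≥ 1`, so `t 0 0` is invisible
and has to be compared separately. -/
theorem eq_of_derivedBrackets_eq [FiniteDimensional K V] (h : DirectSum.IsInternal 𝒱)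
    {t' : ℕ → ℕ → BigAlgebra 𝒱} (ht : ∀ k l, t k l ∈ homogeneousComponent 𝒱 k l d)
    (ht' : ∀ k l, t' k l ∈ homogeneousComponent 𝒱 k l d) (h0 : t 0 0 = t' 0 0)
    (heq : ∀ n, derivedBrackets 𝒱 t n = derivedBrackets 𝒱 t' n) : t = t' := by
  obtain ⟨n, ⟨e⟩⟩ := exists_homogeneousBasis h
  have hlev : ∀ n, levelSum t n = levelSum t' n := fun n => by
    rw [← sub_eq_zero]
    refine eq_zero_of_linearPart_iadList e h (sub_mem (levelSum_mem ht n) (levelSum_mem ht' n))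
      fun u => ?_
    rw [map_sub, ← gen_derivedBrackets h ht, ← gen_derivedBrackets h ht', heq, sub_self, map_zero]
  ext k l
  rcases Nat.eq_zero_or_pos (k + l) with hkl | hkl
  · obtain ⟨rfl, rfl⟩ : k = 0 ∧ l = 0 := by omega
    exact h0
  · obtain ⟨m, hm⟩ : ∃ m, k + l = m + 1 := ⟨k + l - 1, by omega⟩
    have := hlev m
    rw [levelSum, levelSum, ← sub_eq_zero, ← Finset.sum_sub_distrib] at this
    exact sub_eq_zero.1 (eq_zero_of_sum_antidiagonal (s := fun k l => t k l - t' k l)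
      Nat.cast_injective (fun k l => sub_mem (homogeneousComponent_le_minus (ht k l))
        (homogeneousComponent_le_minus (ht' k l))) this hm)

end Level

end BigAlgebra

open BigAlgebra

variable {K : Type*} [Field K] {V : Type*} [AddCommGroup V] [Module K V]
  {𝒱 : ℤ → Submodule K V}

theorem inl_mem_doubleGrading {a : ℤ} {v : V} :
    LinearMap.inl K V (Module.Dual K V) v ∈ doubleGrading 𝒱 a ↔ v ∈ 𝒱 a := by
  simp [doubleGrading]

theorem inr_mem_doubleGrading {a : ℤ} {ξ : Module.Dual K V} :
    LinearMap.inr K V (Module.Dual K V) ξ ∈ doubleGrading 𝒱 a ↔ ξ ∈ dualGrading 𝒱 a := by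
  simp [doubleGrading]

theorem isInternal_plus (h : DirectSum.IsInternal 𝒱) : DirectSum.IsInternal
    (inducedGrading (doubleGrading 𝒱) (LinearMap.range (LinearMap.inl K V (Module.Dual K V)))) :=
  isInternal_range h _ LinearMap.inl_injective fun _ _ => inl_mem_doubleGrading

theorem isInternal_minus [CharZero K] [FiniteDimensional K V] (h : DirectSum.IsInternal 𝒱) :
    DirectSum.IsInternal (inducedGrading (doubleGrading 𝒱)
      (LinearMap.range (LinearMap.inr K V (Module.Dual K V)))) :=
  isInternal_range (Y := Double K V) (gr' := doubleGrading 𝒱) (isInternal_dualGrading h)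
    (LinearMap.inr K V (Module.Dual K V)) LinearMap.inr_injective
    fun _ _ => inr_mem_doubleGrading

variable [CharZero K]

/-! ### From bialgebras to Manin triples -/

section Forward

variable {t : ℕ → ℕ → BigAlgebra 𝒱}

theorem IsLInftyBialgebra.squareComponent_eq_zero (ht : IsLInftyBialgebra 𝒱 t) {p q : ℕ} :
    squareComponent t p q = 0 := by
  rcases p with _ | p
  · simp [squareComponent, ht.zero_left]
  rcases q with _ | q
  · simp [squareComponent, ht.zero_right]
  exact ht.maurer_cartan p q

theorem IsLInftyBialgebra.isLInfty [FiniteDimensional K V] (h : DirectSum.IsInternal 𝒱)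
    (ht : IsLInftyBialgebra 𝒱 t) :
    IsLInfty (doubleGrading 𝒱) (derivedBrackets 𝒱 t) where
  -- A bracket without arguments could only come from `t 0 1` and `t 1 0`.
  zero := by
    ext1 v
    rw [derivedBrackets_apply]
    simp [Finset.Nat.antidiagonal_succ, ht.zero_left, ht.zero_right]
  -- Homogeneity is read off from the Euler operator: on components of total degree `1` with `k + l
  -- = n + 1` it has eigenvalue `1 - (n + 1 - 2) = 2 - n`.
  degree n v a hv := by
    obtain ⟨N, ⟨e⟩⟩ := exists_homogeneousBasis h
    refine e.double.mem_of_euler ?_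
    rw [derivedBrackets_apply]
    refine weight_linearPart (hw := isWeight_euler h e) ?_
    have hT : ∑ x ∈ Finset.HasAntidiagonal.antidiagonal (n + 1), t x.1 x.2 ∈
        weightSpace (isWeight_euler h e) (2 - n : K) := by
      refine sum_mem fun x hx => ?_
      have := homogeneousComponent_le_euler h e (ht.degree x.1 x.2)
      have hx' : (x.1 : ℤ) + x.2 = n + 1 := by
        exact_mod_cast Finset.HasAntidiagonal.mem_antidiagonal.1 hx
      rw [hx'] at this
      convert this using 2
      push_cast; ring
    have := iadList_mem_weightSpace (fun i => e.double.euler_of_mem (hv i)) hT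
    convert this using 2
    push_cast; ring
  symm n v a hv i j hij := by
    rw [derivedBrackets_apply, derivedBrackets_apply,
      iadList_swap (fun i => genParity_of_mem h (hv i)) hij, map_zsmul]
  jacobi n v a hv := by
    have := linearPart_iadList_squareComponent h ht.degree hv
    rw [Finset.sum_eq_zero fun z _ => ht.squareComponent_eq_zero, map_zero, map_zero] at this
    exact (smul_eq_zero.1 this.symm).resolve_left two_ne_zero

/-- Each contraction with an element of `V` removes a factor from `V*`. A component in `V*` can
remain only if `k = n + 1`, that is `l = 0`, and `t k 0` vanishes. -/
theorem IsLInftyBialgebra.plus_closed (ht : IsLInftyBialgebra 𝒱 t)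
    {n : ℕ} {v : Fin n → Double K V}
    (hv : ∀ i, v i ∈ LinearMap.range (LinearMap.inl K V (Module.Dual K V))) :
    derivedBrackets 𝒱 t n v ∈ LinearMap.range (LinearMap.inl K V (Module.Dual K V)) := by
  rw [derivedBrackets_apply, map_sum, map_sum]
  refine sum_mem fun x hx => ?_
  have hx' := Finset.HasAntidiagonal.mem_antidiagonal.1 hx
  rcases Nat.eq_zero_or_pos x.2 with h2 | h2
  · rw [h2, ht.zero_right, map_zero, map_zero]; exact zero_mem _
  have hv' : ∀ i, projMinus K V (v i) = (0 : K) • v i := fun i => by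
    obtain ⟨y, hy⟩ := hv i
    rw [← hy, zero_smul]; simp [projMinus]
  have hw := weight_linearPart
    (iadList_mem_weightSpace hv' (homogeneousComponent_le_minus (ht.degree x.1 x.2)))
  set y := linearPart 𝒱 (iadList 𝒱 (List.ofFn v) (t x.1 x.2))
  have hy : y.2 = ((x.1 : K) - n) • y.2 := by
    simpa [projMinus] using congrArg Prod.snd hw
  refine ⟨y.1, Prod.ext rfl (eq_zero_of_eq_smul (fun hc => ?_) hy).symm⟩
  have : (x.1 : K) = (n + 1 : ℕ) := by push_cast; linear_combination hc
  have : x.1 = n + 1 := by exact_mod_cast this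
  omega

theorem IsLInftyBialgebra.minus_closed (ht : IsLInftyBialgebra 𝒱 t)
    {n : ℕ} {v : Fin n → Double K V}
    (hv : ∀ i, v i ∈ LinearMap.range (LinearMap.inr K V (Module.Dual K V))) :
    derivedBrackets 𝒱 t n v ∈ LinearMap.range (LinearMap.inr K V (Module.Dual K V)) := by
  rw [derivedBrackets_apply, map_sum, map_sum]
  refine sum_mem fun x hx => ?_
  have hx' := Finset.HasAntidiagonal.mem_antidiagonal.1 hx
  rcases Nat.eq_zero_or_pos x.1 with h1 | h1
  · rw [h1, ht.zero_left, map_zero, map_zero]; exact zero_mem _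
  have hv' : ∀ i, projPlus K V (v i) = (0 : K) • v i := fun i => by
    obtain ⟨y, hy⟩ := hv i
    rw [← hy, zero_smul]; simp [projPlus]
  have hw := weight_linearPart
    (iadList_mem_weightSpace hv' (homogeneousComponent_le_plus (ht.degree x.1 x.2)))
  set y := linearPart 𝒱 (iadList 𝒱 (List.ofFn v) (t x.1 x.2))
  have hy : y.1 = ((x.2 : K) - n) • y.1 := by
    simpa [projPlus] using congrArg Prod.fst hw
  refine ⟨y.2, Prod.ext (eq_zero_of_eq_smul (fun hc => ?_) hy).symm rfl⟩
  have : (x.2 : K) = (n + 1 : ℕ) := by push_cast; linear_combination hc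
  have : x.2 = n + 1 := by exact_mod_cast this
  omega

/-- On the double, all axioms of Manin triples that do not involve the brackets hold. -/
theorem isManinTriple_doubleTriple [FiniteDimensional K V] (h : DirectSum.IsInternal 𝒱)
    {lam : (n : ℕ) → MultilinearMap K (fun _ : Fin n => Double K V) (Double K V)}
    (hL : IsLInfty (doubleGrading 𝒱) lam)
    (hplus : ∀ (n : ℕ) (v : Fin n → Double K V),
      (∀ i, v i ∈ LinearMap.range (LinearMap.inl K V (Module.Dual K V))) →
        lam n v ∈ LinearMap.range (LinearMap.inl K V (Module.Dual K V)))
    (hminus : ∀ (n : ℕ) (v : Fin n → Double K V),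
      (∀ i, v i ∈ LinearMap.range (LinearMap.inr K V (Module.Dual K V))) →
        lam n v ∈ LinearMap.range (LinearMap.inr K V (Module.Dual K V)))
    (hinv : ∀ (n : ℕ) (v : Fin n → Double K V) (a b : ℤ), ∀ x ∈ doubleGrading 𝒱 a,
      ∀ y ∈ doubleGrading 𝒱 b,
        pairing 𝒱 (lam (n + 1) (Fin.snoc (α := fun _ => Double K V) v x)) y =
          (((a - 1) * (b - 1)).negOnePow : ℤ) •
            pairing 𝒱 (lam (n + 1) (Fin.snoc (α := fun _ => Double K V) v y)) x) :
    IsManinTriple (doubleTriple 𝒱 lam) where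
  graded := isInternal_doubleGrading h
  lInfty := hL
  isCompl := LinearMap.isCompl_range_inl_inr
  plus_graded := isInternal_plus h
  minus_graded := isInternal_minus h
  plus_closed := hplus
  minus_closed := hminus
  form_degree _ _ hab _ hx _ hy := pairing_degree h hab hx hy
  form_symm _ _ _ hx _ hy := pairing_symm h hx hy
  form_nondegenerate := pairing_nondegenerate 𝒱
  plus_isotropic := by
    rintro _ ⟨x, rfl⟩ _ ⟨y, rfl⟩
    simp [doubleTriple, pairing_apply]
  minus_isotropic := by
    rintro _ ⟨x, rfl⟩ _ ⟨y, rfl⟩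
    simp [doubleTriple, pairing_apply]
  invariant := hinv

theorem IsLInftyBialgebra.isManinTriple [FiniteDimensional K V] (h : DirectSum.IsInternal 𝒱)
    (ht : IsLInftyBialgebra 𝒱 t) : IsManinTriple (doubleTriple 𝒱 (derivedBrackets 𝒱 t)) := by
  refine isManinTriple_doubleTriple h (ht.isLInfty h) (fun _ _ hv => ht.plus_closed hv)
    (fun _ _ hv => ht.minus_closed hv) fun n v a b x hx y hy => algebraMap_injective 𝒱 ?_
  -- Pairing with `y` is one more contraction, so invariance is the exchange of the last two
  -- contractions.
  rw [map_zsmul, algebraMap_pairing_derivedBrackets h ht.degree,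
    algebraMap_pairing_derivedBrackets h ht.degree, iadList_ofFn_snoc, iadList_ofFn_snoc,
    ad_comm (genParity_of_mem h hy) (genParity_of_mem h hx), mul_comm (b - 1)]

end Forward

open BigAlgebra

variable {K : Type*} [Field K] {V : Type*} [AddCommGroup V] [Module K V]
  {𝒱 : ℤ → Submodule K V}

/-! ### From Manin triples to bialgebras -/

/-- Full contractions are scalars, of weight `0`, so a term can contribute only if its weight is the
number of arguments outside `s`. The term `x₀` of weight `0` is seen only when all arguments lie in
`s`, and there the other terms contribute nothing; so its contraction equals that of the whole sum,
which vanishes by assumption. -/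
theorem eq_zero_of_extreme_weight [CharZero K] (h : DirectSum.IsInternal 𝒱) {ι : Type*} [Fintype ι]
    [DecidableEq ι] (e : HomogeneousBasis 𝒱 ι) {w : Double K V →ₗ[K] Double K V}
    {hw : IsWeight 𝒱 w 1} {s : ι ⊕ ι → Prop} [DecidablePred s]
    (hs : ∀ j, w (e.double.vec j) = (if s j then (1 : K) else 0) • e.double.vec j)
    {m : ℕ} {A : Finset (ℕ × ℕ)} {τ : ℕ × ℕ → BigAlgebra 𝒱} {g : ℕ × ℕ → ℕ}
    (hτ : ∀ x ∈ A, τ x ∈ polySpace 𝒱 m) (hg : ∀ x ∈ A, τ x ∈ weightSpace hw (g x : K))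
    {x₀ : ℕ × ℕ} (hx₀ : x₀ ∈ A) (h0 : g x₀ = 0) (hne : ∀ x ∈ A, x ≠ x₀ → g x ≠ 0)
    (hvanish : ∀ u : Fin m → ι ⊕ ι, (∀ i, s (u i)) →
      iadList 𝒱 (List.ofFn fun i => e.double.vec (u i)) (∑ x ∈ A, τ x) = 0) : τ x₀ = 0 := by
  refine eq_zero_of_iadList e h (hτ x₀ hx₀) fun u => ?_
  have hscalar : ∀ x ∈ A,
      iadList 𝒱 (List.ofFn fun i => e.double.vec (u i)) (τ x) ∈ weightSpace hw (0 : K) := by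
    intro x hx
    obtain ⟨r, hr⟩ := exists_algebraMap_of_mem
      (iadList_mem_polySpace (m := 0) (List.ofFn fun i => e.double.vec (u i))
        (b := τ x) (by simpa using hτ x hx))
    rw [← hr]
    exact algebraMap_mem_weightSpace r
  have hweight := fun x hx => iadList_mem_weightSpace (fun i => hs (u i)) (hg x hx)
  have hsum : ∑ i, (if s (u i) then (1 : K) else 0) =
      ((Finset.univ.filter fun i => s (u i)).card : K) := by simp
  simp only [hsum, mul_one] at hweight
  by_cases hu : ∀ i, s (u i)
  · have := hvanish u hu
    rw [map_sum, Finset.sum_eq_single_of_mem x₀ hx₀] at this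
    · exact this
    · intro x hx hxx
      refine eq_zero_of_mem_weightSpace (hscalar x hx) (hweight x hx) ?_
      simpa [hu, eq_comm] using hne x hx hxx
  · refine eq_zero_of_mem_weightSpace (hscalar x₀ hx₀) (hweight x₀ hx₀) fun hc => hu ?_
    have hc' : (m : K) = ((Finset.univ.filter fun i => s (u i)).card : K) := by
      rw [h0] at hc; push_cast at hc; linear_combination hc
    have hcard : (Finset.univ.filter fun i => s (u i)).card = (Finset.univ : Finset (Fin m)).card := by
      rw [Finset.card_univ, Fintype.card_fin]; exact_mod_cast hc'.symm
    simpa [Finset.filter_eq_self] using Finset.eq_of_subset_of_card_le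
      (Finset.filter_subset _ _) hcard.ge

section Backward

variable {lam : (n : ℕ) → MultilinearMap K (fun _ : Fin n => Double K V) (Double K V)}

/-- The multilinear form given by a bracket and the pairing. -/
noncomputable def bracketForm (𝒱 : ℤ → Submodule K V)
    (lam : (n : ℕ) → MultilinearMap K (fun _ : Fin n => Double K V) (Double K V)) (n : ℕ) :
    MultilinearMap K (fun _ : Fin (n + 1) => Double K V) K :=
  MultilinearMap.uncurryRight (M := fun _ : Fin (n + 1) => Double K V)
    ((pairing 𝒱).compMultilinearMap (lam n))

theorem bracketForm_apply {n : ℕ} (v : Fin (n + 1) → Double K V) :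
    bracketForm 𝒱 lam n v = pairing 𝒱 (lam n (Fin.init v)) (v (Fin.last n)) := rfl

/-- Exchanging the last two arguments is invariance of the form; exchanging earlier neighbours is
symmetry of the bracket. -/
theorem gradedSymm_bracketForm (hM : IsManinTriple (doubleTriple 𝒱 lam)) (n : ℕ) :
    GradedSymm 𝒱 (bracketForm 𝒱 lam n) := by
  intro v a hv i j hij
  rw [bracketForm_apply, bracketForm_apply]
  induction j using Fin.lastCases with
  | last =>
    obtain ⟨n, rfl⟩ : ∃ m, n = m + 1 := ⟨i, by simpa using hij.symm⟩
    obtain rfl : i = (Fin.last n).castSucc := Fin.ext (by simpa using hij)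
    have h1 := hM.invariant n (fun k => v k.castSucc.castSucc) _ _ _ (hv (Fin.last (n + 1)))
      _ (hv (Fin.last n).castSucc)
    have h2 : ∀ x : Double K V, ∀ u : Fin (n + 1) → Double K V,
        (∀ k : Fin n, u k.castSucc = v k.castSucc.castSucc) → u (Fin.last n) = x →
        u = Fin.snoc (α := fun _ => Double K V) (fun k : Fin n => v k.castSucc.castSucc) x := by
      intro x u hu hx
      ext1 k
      induction k using Fin.lastCases with
      | last => rw [hx, Fin.snoc_last]
      | cast k => rw [hu, Fin.snoc_castSucc]
    have hswap : ∀ k : Fin n, Fin.init (v ∘ Equiv.swap (Fin.last n).castSucc (Fin.last (n + 1)))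
        k.castSucc = v k.castSucc.castSucc := fun k => by
      simp only [Fin.init, Function.comp_apply]
      rw [Equiv.swap_apply_of_ne_of_ne]
      · exact fun hk => (Fin.castSucc_lt_last k).ne (Fin.castSucc_injective _ hk)
      · exact (Fin.castSucc_lt_last _).ne
    rw [h2 (v (Fin.last n).castSucc) (Fin.init v) (fun k => rfl) rfl,
      h2 (v (Fin.last (n + 1))) (Fin.init (v ∘ _)) hswap (by simp [Fin.init]),
      Function.comp_apply, Equiv.swap_apply_right, mul_comm (a _ - 1)]
    exact h1
  | cast j =>
    obtain ⟨i, rfl⟩ : ∃ i' : Fin n, i = i'.castSucc :=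
      ⟨⟨i, by have := j.2; simp at hij; omega⟩, rfl⟩
    have h1 := hM.lInfty.symm n (Fin.init v) (fun k => a k.castSucc) (fun k => hv k.castSucc) i j
      (by simpa using hij)
    have h2 : Fin.init (v ∘ Equiv.swap i.castSucc j.castSucc) = Fin.init v ∘ Equiv.swap i j := by
      ext1 k
      simp only [Fin.init, Function.comp_apply]
      rw [(Fin.castSucc_injective n).map_swap i j k]
    rw [h2, Function.comp_apply, Equiv.swap_apply_of_ne_of_ne (Fin.castSucc_lt_last _).ne'
      (Fin.castSucc_lt_last _).ne']
    rw [show lam n (Fin.init v ∘ Equiv.swap i j) = _ from h1, map_zsmul, LinearMap.smul_apply]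
    rfl

theorem hasDegree_bracketForm (h : DirectSum.IsInternal 𝒱)
    (hM : IsManinTriple (doubleTriple 𝒱 lam)) (n : ℕ) :
    HasDegree 𝒱 (bracketForm 𝒱 lam n) (n - 2) := by
  intro v a hv hs
  rw [bracketForm_apply]
  refine pairing_degree h ?_ (hM.lInfty.degree n (Fin.init v) (fun k => a k.castSucc)
    (fun k => hv k.castSucc)) (hv (Fin.last n))
  rw [Fin.sum_univ_castSucc] at hs
  omega

variable [CharZero K]

/-- The Jacobi identities annihilate all linear parts of `n`-fold contractions of the sum over `p +
q = n + 3`, hence the sum itself. Its terms are separated by their number `p - 1` of factors from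
`V*`. -/
theorem squareComponent_eq_zero_of_isLInfty [FiniteDimensional K V]
    (h : DirectSum.IsInternal 𝒱) {t : ℕ → ℕ → BigAlgebra 𝒱}
    (ht : ∀ k l, t k l ∈ homogeneousComponent 𝒱 k l 1)
    (hL : IsLInfty (doubleGrading 𝒱) (derivedBrackets 𝒱 t)) {n p q : ℕ} (hpq : p + q = n + 3) :
    squareComponent t p q = 0 := by
  obtain ⟨N, ⟨e⟩⟩ := exists_homogeneousBasis h
  refine eq_zero_of_sum_antidiagonal (hw := isWeight_projMinus 𝒱) (s := squareComponent t)
    (μ := fun k => (k : K) - 1) (fun k l hkl => Nat.cast_injective (sub_left_injective hkl))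
    (fun k l => ?_) ?_ hpq
  · refine sum_mem fun x hx => sum_mem fun y _ => ?_
    have := bigBracket_mem_weightSpace (homogeneousComponent_le_minus (ht x.1 y.1))
      (homogeneousComponent_le_minus (ht x.2 y.2))
    convert this using 2
    rw [← Finset.HasAntidiagonal.mem_antidiagonal.1 hx]
    push_cast; ring
  · refine eq_zero_of_linearPart_iadList (m := n) e h ?_ fun u => ?_
    · refine sum_mem fun z hz => sum_mem fun x hx => sum_mem fun y hy => ?_
      have := bigBracket_mem_polySpace (ht x.1 y.1) (ht x.2 y.2)
      convert this using 2
      rw [Finset.HasAntidiagonal.mem_antidiagonal.1 hx,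
        Finset.HasAntidiagonal.mem_antidiagonal.1 hy, Finset.HasAntidiagonal.mem_antidiagonal.1 hz]
      push_cast; ring
    · rw [linearPart_iadList_squareComponent h ht (fun i => e.double.mem (u i)),
        hL.jacobi n _ _ (fun i => e.double.mem (u i)), smul_zero]

theorem exists_isLInftyBialgebra [FiniteDimensional K V] (h : DirectSum.IsInternal 𝒱)
    (hM : IsManinTriple (doubleTriple 𝒱 lam)) :
    ∃ t, IsLInftyBialgebra 𝒱 t ∧ derivedBrackets 𝒱 t = lam := by
  obtain ⟨N, ⟨e⟩⟩ := exists_homogeneousBasis h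
  have hex : ∀ n : ℕ, ∃ τ : ℕ → ℕ → BigAlgebra 𝒱,
      (∀ k l, τ k l ∈ homogeneousComponent 𝒱 k l 1) ∧ ∀ v, iadList 𝒱 (List.ofFn v)
        (levelSum τ n) = algebraMap K _ (bracketForm 𝒱 lam n v) := by
    intro n
    obtain ⟨b, hb, hbf⟩ := exists_iadList_eq h (bracketForm 𝒱 lam n) (gradedSymm_bracketForm hM n)
      (hasDegree_bracketForm h hM n)
    rw [show ((n + 1 : ℕ) : ℤ) - 2 - (n - 2) = 1 by push_cast; ring] at hb
    obtain ⟨τ, hτ, rfl⟩ := exists_of_mem_polyComponent hb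
    exact ⟨τ, hτ, hbf⟩
  choose τ hτ hτf using hex
  -- Each pair `(k, l)` takes its value from the bracket in `k + l - 1` arguments. The pair `(0, 0)`
  -- belongs to no bracket, and there the subtraction would be truncated.
  set t : ℕ → ℕ → BigAlgebra 𝒱 := fun k l => if k + l = 0 then 0 else τ (k + l - 1) k l with ht
  have hdeg : ∀ k l, t k l ∈ homogeneousComponent 𝒱 k l 1 := fun k l => by
    simp only [ht]
    split_ifs
    · exact zero_mem _
    · exact hτ _ _ _
  have hlev : ∀ n, levelSum t n = levelSum (τ n) n := fun n =>
    Finset.sum_congr rfl fun x hx => by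
      have := Finset.HasAntidiagonal.mem_antidiagonal.1 hx
      simp only [ht, this, Nat.succ_ne_zero, if_false, Nat.add_sub_cancel]
  have hlam : derivedBrackets 𝒱 t = lam := by
    ext1 n
    ext1 v
    rw [← sub_eq_zero]
    refine (pairing_nondegenerate 𝒱).1 _ fun y => ?_
    rw [map_sub, LinearMap.sub_apply, sub_eq_zero]
    refine algebraMap_injective 𝒱 ?_
    rw [algebraMap_pairing_derivedBrackets h hdeg, ← iadList_ofFn_snoc, hlev, hτf,
      bracketForm_apply, Fin.init_snoc, Fin.snoc_last]
  have hpoly : ∀ n, ∀ x ∈ Finset.HasAntidiagonal.antidiagonal (n + 1),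
      t x.1 x.2 ∈ polySpace 𝒱 (n + 1) := fun n x hx => by
    rw [← Finset.HasAntidiagonal.mem_antidiagonal.1 hx]
    exact_mod_cast homogeneousComponent_le_polySpace (hdeg x.1 x.2)
  -- Contractions with `V*` alone see only `t 0 l`, and they vanish because `V*` is closed under the
  -- brackets and isotropic.
  have hleft : ∀ l, t 0 l = 0 := fun l => by
    rcases l with _ | n
    · simp [ht]
    refine eq_zero_of_extreme_weight h e (hw := isWeight_projMinus 𝒱)
      (s := fun j => j.isRight) ?_ (hpoly n)
      (g := Prod.fst) (fun x _ => homogeneousComponent_le_minus (hdeg x.1 x.2)) (x₀ := (0, n + 1))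
      (by simp) rfl (fun x hx hxx hc => hxx ?_) fun u hu => ?_
    · rintro (i | i) <;> simp [e.double_inl, e.double_inr, projMinus]
    · have := Finset.HasAntidiagonal.mem_antidiagonal.1 hx
      exact Prod.ext hc (by simp only; omega)
    · change iadList 𝒱 _ (levelSum t n) = 0
      have hmem : ∀ i, e.double.vec (u i) ∈
          LinearMap.range (LinearMap.inr K V (Module.Dual K V)) := fun i => by
        obtain ⟨j, hj⟩ := Sum.isRight_iff.1 (hu i)
        rw [hj, e.double_inr]; exact ⟨_, rfl⟩
      rw [hlev, hτf, bracketForm_apply]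
      have := hM.minus_isotropic _ (hM.minus_closed n _ fun i => hmem i.castSucc) _
        (hmem (Fin.last n))
      exact (congrArg _ this).trans (map_zero _)
  have hright : ∀ k, t k 0 = 0 := fun k => by
    rcases k with _ | n
    · simp [ht]
    refine eq_zero_of_extreme_weight h e (hw := isWeight_projPlus 𝒱)
      (s := fun j => j.isLeft) ?_ (hpoly n)
      (g := Prod.snd) (fun x _ => homogeneousComponent_le_plus (hdeg x.1 x.2)) (x₀ := (n + 1, 0))
      (by simp) rfl (fun x hx hxx hc => hxx ?_) fun u hu => ?_
    · rintro (i | i) <;> simp [e.double_inl, e.double_inr, projPlus]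
    · have := Finset.HasAntidiagonal.mem_antidiagonal.1 hx
      exact Prod.ext (by simp only; omega) hc
    · change iadList 𝒱 _ (levelSum t n) = 0
      have hmem : ∀ i, e.double.vec (u i) ∈
          LinearMap.range (LinearMap.inl K V (Module.Dual K V)) := fun i => by
        obtain ⟨j, hj⟩ := Sum.isLeft_iff.1 (hu i)
        rw [hj, e.double_inl]; exact ⟨_, rfl⟩
      rw [hlev, hτf, bracketForm_apply]
      have := hM.plus_isotropic _ (hM.plus_closed n _ fun i => hmem i.castSucc) _
        (hmem (Fin.last n))
      exact (congrArg _ this).trans (map_zero _)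
  refine ⟨t, ⟨hdeg, hleft, hright, fun p q => ?_⟩, hlam⟩
  change squareComponent t (p + 1) (q + 1) = 0
  -- The Jacobi identities reach only components with `p + q ≥ 1`. For `p = q = 0` every term
  -- contains some `t 0 l`.
  rcases Nat.eq_zero_or_pos (p + q) with hpq | hpq
  · obtain ⟨rfl, rfl⟩ : p = 0 ∧ q = 0 := by omega
    simp [squareComponent, Finset.Nat.antidiagonal_succ, hleft]
  · exact squareComponent_eq_zero_of_isLInfty h hdeg (hlam ▸ hM.lInfty) (n := p + q - 1)
      (by omega)

end Backward

/-- Bialgebra structures correspond to brackets on the double. -/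
theorem bijOn_derivedBrackets [CharZero K] [FiniteDimensional K V] (h : DirectSum.IsInternal 𝒱) :
    Set.BijOn (derivedBrackets 𝒱) {t | IsLInftyBialgebra 𝒱 t}
      {lam | IsManinTriple (doubleTriple 𝒱 lam)} :=
  ⟨fun _ ht => IsLInftyBialgebra.isManinTriple h ht,
    fun _ ht _ ht' heq => eq_of_derivedBrackets_eq h ht.degree ht'.degree
      (by rw [ht.zero_left, ht'.zero_left]) (fun n => congrFun heq n),
    fun _ hM => exists_isLInftyBialgebra h hM⟩

open BigAlgebra

variable {K : Type*} [Field K]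

/-! ### Manin triples as doubles -/

section Transport

variable {X Y : Type*} [AddCommGroup X] [Module K X] [AddCommGroup Y] [Module K Y]

theorem map_equiv_eq {S : Submodule K X} {T : Submodule K Y} (F : X ≃ₗ[K] Y)
    (h : ∀ x, F x ∈ T ↔ x ∈ S) :
    S.map (F : X →ₗ[K] Y) = T := by
  ext y
  rw [Submodule.mem_map_equiv, ← h, LinearEquiv.apply_symm_apply]

theorem mem_of_map_equiv_eq {S : Submodule K X} {T : Submodule K Y} {F : X ≃ₗ[K] Y}
    (h : S.map (F : X →ₗ[K] Y) = T) {x : X} : F x ∈ T ↔ x ∈ S := by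
  rw [← h, Submodule.mem_map_equiv, LinearEquiv.symm_apply_apply]

theorem map_eq_of_forall_mem {gr : ℤ → Submodule K X} {gr' : ℤ → Submodule K Y}
    (h : DirectSum.IsInternal gr) (h' : DirectSum.IsInternal gr') (F : X ≃ₗ[K] Y)
    (hF : ∀ a, ∀ x ∈ gr a, F x ∈ gr' a) (a : ℤ) : (gr a).map (F : X →ₗ[K] Y) = gr' a :=
  map_eq_of_map_le h h' F (fun b => Submodule.map_le_iff_le_comap.2 (hF b)) a

theorem IsLInfty.of_equiv {gr : ℤ → Submodule K X} {gr' : ℤ → Submodule K Y}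
    {lam : (n : ℕ) → MultilinearMap K (fun _ : Fin n => X) X}
    {lam' : (n : ℕ) → MultilinearMap K (fun _ : Fin n => Y) Y} (h : IsLInfty gr' lam')
    (F : X ≃ₗ[K] Y) (hgr : ∀ a x, F x ∈ gr' a ↔ x ∈ gr a)
    (hbr : ∀ n v, F (lam n v) = lam' n fun i => F (v i)) : IsLInfty gr lam where
  zero := by
    ext1 v
    refine F.injective ?_
    rw [hbr, h.zero]
    simp
  degree n v a hv := by
    rw [← hgr, hbr]
    exact h.degree n _ a fun i => (hgr _ _).2 (hv i)
  symm n v a hv i j hij := by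
    refine F.injective ?_
    rw [map_zsmul, hbr, hbr]
    exact h.symm n _ a (fun i => (hgr _ _).2 (hv i)) i j hij
  jacobi n v a hv := by
    have hcons : ∀ {n : ℕ} (x : X) (v : Fin n → X),
        (fun i => F (Fin.cons (α := fun _ => X) x v i)) =
          Fin.cons (α := fun _ => Y) (F x) (fun i => F (v i)) := fun x v => by
      ext1 i; induction i using Fin.cases <;> simp
    refine F.injective ?_
    simp only [map_sum, map_zsmul, hbr, hcons, map_zero]
    exact h.jacobi n _ a fun i => (hgr _ _).2 (hv i)

theorem IsManinTriple.invariant_of_equiv {N : TripleData K Y} (hN : IsManinTriple N)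
    {gr : ℤ → Submodule K X} {lam : (n : ℕ) → MultilinearMap K (fun _ : Fin n => X) X}
    {form : LinearMap.BilinForm K X} (F : X ≃ₗ[K] Y) (hgr : ∀ a x, F x ∈ N.grading a ↔ x ∈ gr a)
    (hbr : ∀ n v, F (lam n v) = N.bracket n fun i => F (v i))
    (hform : ∀ x y, N.form (F x) (F y) = form x y) (n : ℕ) (v : Fin n → X) (a b : ℤ) (x : X)
    (hx : x ∈ gr a) (y : X) (hy : y ∈ gr b) :
    form (lam (n + 1) (Fin.snoc (α := fun _ => X) v x)) y =
      (((a - 1) * (b - 1)).negOnePow : ℤ) •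
        form (lam (n + 1) (Fin.snoc (α := fun _ => X) v y)) x := by
  have hsnoc : ∀ x : X, (fun i => F (Fin.snoc (α := fun _ => X) v x i)) =
      Fin.snoc (α := fun _ => Y) (fun i => F (v i)) (F x) := fun x => by
    ext1 i; induction i using Fin.lastCases <;> simp
  rw [← hform, ← hform, hbr, hbr, hsnoc, hsnoc]
  exact hN.invariant n _ a b _ ((hgr _ _).2 hx) _ ((hgr _ _).2 hy)

end Transport

/-! ### The duality of the two summands of a Manin triple -/

section Polarization

variable {g : Type*} [AddCommGroup g] [Module K g] {M : TripleData K g}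

theorem IsManinTriple.form_comm (hM : IsManinTriple M) {a : ℤ} {x : g} (hx : x ∈ M.grading a)
    (y : g) : M.form x y = (a.negOnePow : ℤ) • M.form y x := by
  induction y using iSup_induction_top hM.graded.submodule_iSup_eq_top with
  | h0 => simp
  | ha y z hy hz => rw [map_add, hy, hz, map_add, LinearMap.add_apply, smul_add]
  | hm b y hy =>
    by_cases hab : a + b = 0
    · obtain rfl : b = -a := by omega
      rw [hM.form_symm a (-a) x hx y hy, mul_neg, Int.negOnePow_neg]
      congr 2
      rcases Int.even_or_odd a with ha | ha
      · rw [Int.negOnePow_even _ ha, Int.negOnePow_even _ (ha.mul_left a)]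
      · rw [Int.negOnePow_odd _ ha, Int.negOnePow_odd _ (ha.mul ha)]
    · rw [hM.form_degree a b hab x hx y hy, hM.form_degree b a (by omega) y hy x hx, smul_zero]

theorem IsManinTriple.form_plus (hM : IsManinTriple M) (x : M.plus) (y : g) :
    M.form x y = M.form y (parity (inducedGrading M.grading M.plus) x) := by
  induction x using iSup_induction_top hM.plus_graded.submodule_iSup_eq_top with
  | h0 => simp
  | ha x z hx hz => simp only [Submodule.coe_add, map_add, LinearMap.add_apply, hx, hz]
  | hm a x hx =>
    rw [parity_of_mem hM.plus_graded hx, hM.form_comm (x := (x : g)) (a := a) hx,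
      Submodule.coe_smul_of_tower, map_zsmul]

/-- The map from `g₋` to the dual of `g₊` given by the form. -/
def minusToDual (M : TripleData K g) : M.minus →ₗ[K] Module.Dual K M.plus :=
  M.form.domRestrict₁₂ M.minus M.plus

/-- An element of `g₋` orthogonal to `g₊` is orthogonal to everything, since `g₋` is isotropic. -/
theorem IsManinTriple.minusToDual_injective (hM : IsManinTriple M) :
    Function.Injective (minusToDual M) := by
  refine (injective_iff_map_eq_zero _).2 fun y hy => Subtype.ext ?_
  refine hM.form_nondegenerate.1 _ fun z => ?_
  have hz : z ∈ M.plus ⊔ M.minus := by rw [hM.isCompl.sup_eq_top]; trivial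
  obtain ⟨p, hp, m, hm, rfl⟩ := Submodule.mem_sup.1 hz
  rw [map_add, hM.minus_isotropic _ y.2 _ hm, add_zero]
  exact LinearMap.congr_fun hy ⟨p, hp⟩

theorem IsManinTriple.plusToDual_injective (hM : IsManinTriple M) :
    Function.Injective (M.form.domRestrict₁₂ M.plus M.minus) := by
  refine (injective_iff_map_eq_zero _).2 fun x hx => Subtype.ext ?_
  refine hM.form_nondegenerate.1 _ fun z => ?_
  have hz : z ∈ M.plus ⊔ M.minus := by rw [hM.isCompl.sup_eq_top]; trivial
  obtain ⟨p, hp, m, hm, rfl⟩ := Submodule.mem_sup.1 hz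
  rw [map_add, hM.plus_isotropic _ x.2 _ hp, zero_add]
  exact LinearMap.congr_fun hx ⟨m, hm⟩

variable [FiniteDimensional K g]

/-- The form identifies `g₋` with the dual of `g₊`. -/
noncomputable def IsManinTriple.minusEquiv (hM : IsManinTriple M) :
    M.minus ≃ₗ[K] Module.Dual K M.plus :=
  -- The injections of `g₋` into the dual of `g₊` and of `g₊` into the dual of `g₋` force equal
  -- dimensions.
  LinearEquiv.ofInjectiveOfFinrankEq (minusToDual M) hM.minusToDual_injective (le_antisymm
    (LinearMap.finrank_le_finrank_of_injective hM.minusToDual_injective)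
    (Subspace.dual_finrank_eq.trans_le ((LinearMap.finrank_le_finrank_of_injective
      hM.plusToDual_injective).trans_eq Subspace.dual_finrank_eq)))

theorem IsManinTriple.minusEquiv_apply (hM : IsManinTriple M) (y : M.minus) (x : M.plus) :
    hM.minusEquiv y x = M.form y x := rfl

theorem IsManinTriple.form_minusEquiv_symm (hM : IsManinTriple M) (ξ : Module.Dual K M.plus)
    (x : M.plus) : M.form (hM.minusEquiv.symm ξ) x = ξ x := by
  rw [← hM.minusEquiv_apply, LinearEquiv.apply_symm_apply]

/-- The identification of the double of `g₊` with `g`. -/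
noncomputable def IsManinTriple.doubleEquivTriple (hM : IsManinTriple M) :
    Double K M.plus ≃ₗ[K] g :=
  ((LinearEquiv.refl K M.plus).prodCongr hM.minusEquiv.symm).trans
    (Submodule.prodEquivOfIsCompl M.plus M.minus hM.isCompl)

theorem IsManinTriple.doubleEquivTriple_apply (hM : IsManinTriple M) (x : Double K M.plus) :
    hM.doubleEquivTriple x = x.1 + hM.minusEquiv.symm x.2 := rfl

/-- The brackets on the double of `g₊`. -/
noncomputable def IsManinTriple.transportedBracket (hM : IsManinTriple M) (n : ℕ) :
    MultilinearMap K (fun _ : Fin n => Double K M.plus) (Double K M.plus) :=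
  hM.doubleEquivTriple.symm.toLinearMap.compMultilinearMap
    ((M.bracket n).compLinearMap fun _ => hM.doubleEquivTriple.toLinearMap)

theorem IsManinTriple.doubleEquivTriple_transportedBracket (hM : IsManinTriple M) (n : ℕ)
    (v : Fin n → Double K M.plus) : hM.doubleEquivTriple (hM.transportedBracket n v) =
      M.bracket n fun i => hM.doubleEquivTriple (v i) := by
  simp [IsManinTriple.transportedBracket]

theorem IsManinTriple.form_doubleEquivTriple (hM : IsManinTriple M) (x y : Double K M.plus) :
    M.form (hM.doubleEquivTriple x) (hM.doubleEquivTriple y) =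
      pairing (inducedGrading M.grading M.plus) x y := by
  simp only [hM.doubleEquivTriple_apply, map_add, LinearMap.add_apply, pairing_apply,
    hM.form_minusEquiv_symm, hM.plus_isotropic _ x.1.2 _ y.1.2, hM.form_plus,
    hM.minus_isotropic _ (hM.minusEquiv.symm x.2).2 _ (hM.minusEquiv.symm y.2).2]
  ring

theorem IsManinTriple.doubleEquivTriple_mem_plus (hM : IsManinTriple M) {x : Double K M.plus} :
    hM.doubleEquivTriple x ∈ M.plus ↔
      x ∈ LinearMap.range (LinearMap.inl K M.plus (Module.Dual K M.plus)) := by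
  rw [LinearMap.mem_range, hM.doubleEquivTriple_apply]
  constructor
  · intro hx
    have h1 : (hM.minusEquiv.symm x.2 : g) ∈ M.plus := by
      simpa using sub_mem hx x.1.2
    have h2 := Submodule.disjoint_def.1 hM.isCompl.disjoint _ h1 (hM.minusEquiv.symm x.2).2
    have h3 : x.2 = 0 := by simpa using h2
    exact ⟨x.1, Prod.ext rfl h3.symm⟩
  · rintro ⟨y, rfl⟩
    simp

theorem IsManinTriple.doubleEquivTriple_mem_minus (hM : IsManinTriple M) {x : Double K M.plus} :
    hM.doubleEquivTriple x ∈ M.minus ↔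
      x ∈ LinearMap.range (LinearMap.inr K M.plus (Module.Dual K M.plus)) := by
  rw [LinearMap.mem_range, hM.doubleEquivTriple_apply]
  constructor
  · intro hx
    have h1 : (x.1 : g) ∈ M.minus := by
      simpa using sub_mem hx (hM.minusEquiv.symm x.2).2
    have h2 := Submodule.disjoint_def.1 hM.isCompl.disjoint _ x.1.2 h1
    exact ⟨x.2, Prod.ext (Subtype.ext h2.symm) rfl⟩
  · rintro ⟨y, rfl⟩
    simp

/-- An element of `g₋` is determined by its pairing with `g₊`, and `F` preserves the form and fixes
`g₊`, so there is no freedom on the dual summand. -/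
theorem IsManinTriple.eq_doubleEquivTriple (hM : IsManinTriple M)
    {lam : (n : ℕ) → MultilinearMap K (fun _ : Fin n => Double K M.plus) (Double K M.plus)}
    {F : Double K M.plus ≃ₗ[K] g} (hF : ∀ x : M.plus, F (x, 0) = x)
    (hiso : IsTripleIso (doubleTriple (inducedGrading M.grading M.plus) lam) M F) :
    F = hM.doubleEquivTriple := by
  ext1 x
  have hmem : F (0, x.2) ∈ M.minus := (mem_of_map_equiv_eq hiso.minus).2 ⟨x.2, rfl⟩
  have h1 : hM.minusEquiv ⟨F (0, x.2), hmem⟩ = x.2 := by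
    ext y
    rw [hM.minusEquiv_apply, ← hF y]
    refine (hiso.form (0, x.2) (y, 0)).trans ?_
    simp [doubleTriple, pairing_apply]
  rw [hM.doubleEquivTriple_apply, ← h1, LinearEquiv.symm_apply_apply, ← hF x.1, ← map_add]
  simp

variable [CharZero K]

/-- That the form has degree `0` gives one inclusion in each degree; as both sides are gradings of
the whole space, this suffices. -/
theorem IsManinTriple.map_minusEquiv (hM : IsManinTriple M) (a : ℤ) :
    (inducedGrading M.grading M.minus a).map (hM.minusEquiv : M.minus →ₗ[K] Module.Dual K M.plus) =
      dualGrading (inducedGrading M.grading M.plus) a := by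
  refine map_eq_of_map_le hM.minus_graded (isInternal_dualGrading hM.plus_graded) _ (fun a => ?_) a
  rintro _ ⟨y, hy, rfl⟩ b hb x hx
  exact hM.form_degree a b (by omega) _ hy _ hx

theorem IsManinTriple.minusEquiv_symm_mem (hM : IsManinTriple M) {a : ℤ}
    {ξ : Module.Dual K M.plus} (hξ : ξ ∈ dualGrading (inducedGrading M.grading M.plus) a) :
    (hM.minusEquiv.symm ξ : g) ∈ M.grading a := by
  rw [← hM.map_minusEquiv, Submodule.mem_map_equiv] at hξ
  exact hξ

theorem IsManinTriple.doubleEquivTriple_mem_grading (hM : IsManinTriple M) (a : ℤ)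
    (x : Double K M.plus) (hx : x ∈ doubleGrading (inducedGrading M.grading M.plus) a) :
    hM.doubleEquivTriple x ∈ M.grading a := by
  rw [hM.doubleEquivTriple_apply]
  exact add_mem hx.1 (hM.minusEquiv_symm_mem hx.2)

theorem IsManinTriple.map_doubleEquivTriple (hM : IsManinTriple M) (a : ℤ) :
    (doubleGrading (inducedGrading M.grading M.plus) a).map
      (hM.doubleEquivTriple : Double K M.plus →ₗ[K] g) = M.grading a :=
  map_eq_of_forall_mem (X := Double K M.plus) (Y := g)
    (gr := doubleGrading (inducedGrading M.grading M.plus)) (gr' := M.grading)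
    (isInternal_doubleGrading hM.plus_graded) hM.graded hM.doubleEquivTriple
    hM.doubleEquivTriple_mem_grading a
theorem IsManinTriple.isTripleIso (hM : IsManinTriple M) :
    IsTripleIso (doubleTriple (inducedGrading M.grading M.plus) hM.transportedBracket) M
      hM.doubleEquivTriple where
  grading := hM.map_doubleEquivTriple
  plus := map_equiv_eq _ fun _ => hM.doubleEquivTriple_mem_plus
  minus := map_equiv_eq _ fun _ => hM.doubleEquivTriple_mem_minus
  form := hM.form_doubleEquivTriple
  bracket n v := (hM.doubleEquivTriple_transportedBracket n v).symm

theorem IsManinTriple.transported (hM : IsManinTriple M) :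
    IsManinTriple (doubleTriple (inducedGrading M.grading M.plus) hM.transportedBracket) := by
  have hgr : ∀ a x, hM.doubleEquivTriple x ∈ M.grading a ↔
      x ∈ doubleGrading (inducedGrading M.grading M.plus) a := fun a x =>
    mem_of_map_equiv_eq (hM.map_doubleEquivTriple a)
  have hbr := hM.doubleEquivTriple_transportedBracket
  refine isManinTriple_doubleTriple hM.plus_graded
    (hM.lInfty.of_equiv hM.doubleEquivTriple hgr hbr) ?_ ?_
    (hM.invariant_of_equiv hM.doubleEquivTriple hgr hbr hM.form_doubleEquivTriple)
  · intro n v hv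
    rw [← hM.doubleEquivTriple_mem_plus, hbr]
    exact hM.plus_closed n _ fun i => hM.doubleEquivTriple_mem_plus.2 (hv i)
  · intro n v hv
    rw [← hM.doubleEquivTriple_mem_minus, hbr]
    exact hM.minus_closed n _ fun i => hM.doubleEquivTriple_mem_minus.2 (hv i)

theorem IsManinTriple.existsUnique_isLInftyBialgebra (hM : IsManinTriple M) :
    ∃! t : ℕ → ℕ → BigAlgebra (inducedGrading M.grading M.plus),
      IsLInftyBialgebra (inducedGrading M.grading M.plus) t ∧
      ∃ F : Double K M.plus ≃ₗ[K] g, (∀ x : M.plus, F (x, 0) = x) ∧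
        IsTripleIso (doubleTriple (inducedGrading M.grading M.plus)
          (derivedBrackets (inducedGrading M.grading M.plus) t)) M F := by
  obtain ⟨t, ht, hlam⟩ := exists_isLInftyBialgebra hM.plus_graded hM.transported
  refine ⟨t, ⟨ht, hM.doubleEquivTriple, fun x => ?_, hlam ▸ hM.isTripleIso⟩, ?_⟩
  · simp [hM.doubleEquivTriple_apply]
  · rintro t' ⟨ht', F, hF, hiso⟩
    -- With the isomorphism forced, the brackets of `t'` are the transported ones, and these
    -- determine `t'`.
    obtain rfl := hM.eq_doubleEquivTriple hF hiso
    refine eq_of_derivedBrackets_eq hM.plus_graded ht'.degree ht.degree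
      (by rw [ht.zero_left, ht'.zero_left]) fun n => ?_
    ext1 v
    refine hM.doubleEquivTriple.injective ?_
    rw [hlam, hM.doubleEquivTriple_transportedBracket]
    exact (hiso.bracket n v).symm

end Polarization

open BigAlgebra

variable {K : Type*} [Field K] {V V' : Type*} [AddCommGroup V] [Module K V]
  [AddCommGroup V'] [Module K V'] {𝒱 : ℤ → Submodule K V} {𝒱' : ℤ → Submodule K V'}

/-! ### Functoriality of the double and of the big bracket -/

section DoubleEquiv

variable {f : V ≃ₗ[K] V'}

theorem doubleEquiv_apply (f : V ≃ₗ[K] V') (x : Double K V) :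
    doubleEquiv f x = (f x.1, f.dualMap.symm x.2) := rfl

theorem dualMap_symm_apply (f : V ≃ₗ[K] V') (ξ : Module.Dual K V) (v : V') :
    f.dualMap.symm ξ v = ξ (f.symm v) := rfl

theorem parity_map (h : DirectSum.IsInternal 𝒱) (h' : DirectSum.IsInternal 𝒱')
    (hf : ∀ a, (𝒱 a).map (f : V →ₗ[K] V') = 𝒱' a) (v : V) :
    parity 𝒱' (f v) = f (parity 𝒱 v) := by
  induction v using iSup_induction_top h.submodule_iSup_eq_top with
  | h0 => simp
  | ha x y hx hy => simp only [map_add, hx, hy]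
  | hm a x hx =>
    rw [parity_of_mem h hx, parity_of_mem h' ((mem_of_map_equiv_eq (hf a)).2 hx), map_zsmul]

theorem doubleParity_doubleEquiv (h : DirectSum.IsInternal 𝒱) (h' : DirectSum.IsInternal 𝒱')
    (hf : ∀ a, (𝒱 a).map (f : V →ₗ[K] V') = 𝒱' a) (x : Double K V) :
    doubleParity 𝒱' (doubleEquiv f x) = doubleEquiv f (doubleParity 𝒱 x) := by
  refine Prod.ext (parity_map h h' hf x.1) (LinearMap.ext fun v => ?_)
  obtain ⟨v, rfl⟩ := f.surjective v
  change x.2 (f.symm (parity 𝒱' (f v))) = x.2 (parity 𝒱 (f.symm (f v)))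
  rw [parity_map h h' hf, f.symm_apply_apply, f.symm_apply_apply]

theorem pairing_doubleEquiv (h : DirectSum.IsInternal 𝒱) (h' : DirectSum.IsInternal 𝒱')
    (hf : ∀ a, (𝒱 a).map (f : V →ₗ[K] V') = 𝒱' a) (x y : Double K V) :
    pairing 𝒱' (doubleEquiv f x) (doubleEquiv f y) = pairing 𝒱 x y := by
  simp only [pairing_apply, doubleEquiv_apply, dualMap_symm_apply, parity_map h h' hf,
    f.symm_apply_apply]

theorem dualMap_symm_mem (hf : ∀ a, (𝒱 a).map (f : V →ₗ[K] V') = 𝒱' a) {a : ℤ}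
    {ξ : Module.Dual K V} (hξ : ξ ∈ dualGrading 𝒱 a) : f.dualMap.symm ξ ∈ dualGrading 𝒱' a := by
  intro b hb v hv
  rw [← hf b, Submodule.mem_map_equiv] at hv
  exact hξ b hb _ hv

theorem doubleEquiv_mem (hf : ∀ a, (𝒱 a).map (f : V →ₗ[K] V') = 𝒱' a) (a : ℤ)
    (x : Double K V) (hx : x ∈ doubleGrading 𝒱 a) : doubleEquiv f x ∈ doubleGrading 𝒱' a :=
  ⟨(mem_of_map_equiv_eq (hf a)).2 hx.1, dualMap_symm_mem hf hx.2⟩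

end DoubleEquiv

namespace BigAlgebra

section Functoriality

variable {F : Double K V →ₗ[K] Double K V'} {φ : BigAlgebra 𝒱 →ₐ[K] BigAlgebra 𝒱'}

theorem exists_algHom (hF : ∀ x, doubleParity 𝒱' (F x) = F (doubleParity 𝒱 x)) :
    ∃ φ : BigAlgebra 𝒱 →ₐ[K] BigAlgebra 𝒱', ∀ x, φ (gen 𝒱 x) = gen 𝒱' (F x) :=
  ⟨lift (gen 𝒱' ∘ₗ F) (fun x y hx hy => gen_odd (by rw [hF, hx]) (by rw [hF, hy]))
    (fun x y hx => gen_even (by rw [hF, hx, map_neg]) _), fun x => by simp⟩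

theorem map_invol (hF : ∀ x, doubleParity 𝒱' (F x) = F (doubleParity 𝒱 x))
    (hφ : ∀ x, φ (gen 𝒱 x) = gen 𝒱' (F x)) (b : BigAlgebra 𝒱) :
    φ (invol 𝒱 b) = invol 𝒱' (φ b) := by
  induction b using induction with
  | hs r => simp
  | hg x => simp [hφ, hF]
  | hm a b h₁ h₂ => simp [h₁, h₂]
  | ha a b h₁ h₂ => simp [h₁, h₂]

theorem map_signInvol (hF : ∀ x, doubleParity 𝒱' (F x) = F (doubleParity 𝒱 x))
    (hφ : ∀ x, φ (gen 𝒱 x) = gen 𝒱' (F x)) (p : ℤ) (b : BigAlgebra 𝒱) :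
    φ (signInvol 𝒱 p b) = signInvol 𝒱' p (φ b) := by
  rcases Int.even_or_odd p with hp | hp
  · rw [signInvol_even hp, signInvol_even hp]
  · rw [signInvol_odd hp, signInvol_odd hp, map_invol hF hφ]

theorem augmentation_map (hφ : ∀ x, φ (gen 𝒱 x) = gen 𝒱' (F x)) (b : BigAlgebra 𝒱) :
    augmentation 𝒱' (φ b) = augmentation 𝒱 b := by
  induction b using induction with
  | hs r => simp
  | hg x => simp [hφ, augmentation]
  | hm a b h₁ h₂ => simp [h₁, h₂]
  | ha a b h₁ h₂ => simp [h₁, h₂]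

theorem linearPart_map (hφ : ∀ x, φ (gen 𝒱 x) = gen 𝒱' (F x)) (b : BigAlgebra 𝒱) :
    linearPart 𝒱' (φ b) = F (linearPart 𝒱 b) := by
  induction b using induction with
  | hs r => simp [linearPart_algebraMap]
  | hg x => simp [hφ, linearPart_gen]
  | hm a b h₁ h₂ =>
    rw [map_mul, linearPart_mul, linearPart_mul, augmentation_map hφ, augmentation_map hφ, h₁, h₂,
      map_add, map_smul, map_smul]
  | ha a b h₁ h₂ => simp [h₁, h₂]

variable [CharZero K]

/-- Contraction is determined by the pairing, the parities and the Leibniz rule, all of which are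
respected by `F` and `φ`. -/
theorem map_ad (hF : ∀ x, doubleParity 𝒱' (F x) = F (doubleParity 𝒱 x))
    (hpair : ∀ x y, pairing 𝒱' (F x) (F y) = pairing 𝒱 x y)
    (hφ : ∀ x, φ (gen 𝒱 x) = gen 𝒱' (F x)) (x : Double K V) (b : BigAlgebra 𝒱) :
    φ (ad 𝒱 x b) = ad 𝒱' (F x) (φ b) := by
  induction x using induction_genParity (𝒱 := 𝒱) with
  | ha x y hx hy => simp only [map_add, LinearMap.add_apply, hx, hy]
  | hC p x hx =>
    have hx' : GenParity 𝒱' p (F x) := by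
      unfold GenParity at hx ⊢
      rw [hF, hx, map_neg, map_zsmul]
    induction b using induction with
    | hs r => simp [ad_algebraMap]
    | hg y => simp [ad_gen, hφ, hpair]
    | hm b c h₁ h₂ =>
      rw [ad_mul hx, map_add, map_mul, map_mul, map_mul, ad_mul hx', h₁, h₂, map_signInvol hF hφ]
    | ha b c h₁ h₂ => simp only [map_add, h₁, h₂]

theorem map_iadList (hF : ∀ x, doubleParity 𝒱' (F x) = F (doubleParity 𝒱 x))
    (hpair : ∀ x y, pairing 𝒱' (F x) (F y) = pairing 𝒱 x y)
    (hφ : ∀ x, φ (gen 𝒱 x) = gen 𝒱' (F x)) (l : List (Double K V)) (b : BigAlgebra 𝒱) :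
    φ (iadList 𝒱 l b) = iadList 𝒱' (l.map F) (φ b) := by
  induction l generalizing b with
  | nil => simp
  | cons x l ih => simp [ih, map_ad hF hpair hφ]

theorem derivedBrackets_map (hF : ∀ x, doubleParity 𝒱' (F x) = F (doubleParity 𝒱 x))
    (hpair : ∀ x y, pairing 𝒱' (F x) (F y) = pairing 𝒱 x y)
    (hφ : ∀ x, φ (gen 𝒱 x) = gen 𝒱' (F x)) (t : ℕ → ℕ → BigAlgebra 𝒱) (n : ℕ)
    (v : Fin n → Double K V) :
    derivedBrackets 𝒱' (fun k l => φ (t k l)) n (fun i => F (v i)) =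
      F (derivedBrackets 𝒱 t n v) := by
  rw [derivedBrackets_apply, derivedBrackets_apply, ← linearPart_map hφ, map_iadList hF hpair hφ,
    List.map_ofFn, map_sum φ]
  rfl

end Functoriality

theorem map_mem_homogeneousComponent {f : V ≃ₗ[K] V'} {φ : BigAlgebra 𝒱 →ₐ[K] BigAlgebra 𝒱'}
    (hf : ∀ a, (𝒱 a).map (f : V →ₗ[K] V') = 𝒱' a)
    (hφ : ∀ x, φ (gen 𝒱 x) = gen 𝒱' (doubleEquiv f x)) {k l : ℕ} {d : ℤ} {b : BigAlgebra 𝒱}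
    (hb : b ∈ homogeneousComponent 𝒱 k l d) : φ b ∈ homogeneousComponent 𝒱' k l d := by
  unfold homogeneousComponent at hb
  induction hb using Submodule.span_induction with
  | mem b hb =>
    obtain ⟨ξ, v, a, c, hξ, hv, hd, rfl⟩ := hb
    refine Submodule.subset_span ⟨fun i => f.dualMap.symm (ξ i), fun j => f (v j), a, c,
      fun i => dualMap_symm_mem hf (hξ i), fun j => (mem_of_map_equiv_eq (hf _)).2 (hv j), hd, ?_⟩
    simp only [map_mul, map_list_prod, List.map_ofFn, Function.comp_def, hφ, doubleEquiv_apply,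
      map_zero]
  | zero => rw [map_zero]; exact zero_mem _
  | add x y _ _ hx hy => rw [map_add]; exact add_mem hx hy
  | smul r x _ hx => rw [map_smul]; exact Submodule.smul_mem _ r hx

end BigAlgebra

/-! ### Isomorphisms -/

section Isomorphisms

/-- Preserving both summands makes `F` block diagonal, and preserving the pairing makes the block on
`V*` the inverse transpose of the block on `V`. -/
theorem IsTripleIso.exists_eq_doubleEquiv {F : Double K V ≃ₗ[K] Double K V'}
    {lam : (n : ℕ) → MultilinearMap K (fun _ : Fin n => Double K V) (Double K V)}
    {lam' : (n : ℕ) → MultilinearMap K (fun _ : Fin n => Double K V') (Double K V')}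
    (hF : IsTripleIso (doubleTriple 𝒱 lam) (doubleTriple 𝒱' lam') F) :
    ∃ f : V ≃ₗ[K] V', (∀ a, (𝒱 a).map (f : V →ₗ[K] V') = 𝒱' a) ∧ F = doubleEquiv f := by
  have hplus : ∀ x, (F x).2 = 0 ↔ x.2 = 0 := fun x => by
    simpa [doubleTriple, LinearMap.range_inl] using mem_of_map_equiv_eq hF.plus (x := x)
  have hminus : ∀ x, (F x).1 = 0 ↔ x.1 = 0 := fun x => by
    simpa [doubleTriple, LinearMap.range_inr] using mem_of_map_equiv_eq hF.minus (x := x)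
  have hgr : ∀ a x, F x ∈ doubleGrading 𝒱' a ↔ x ∈ doubleGrading 𝒱 a := fun a x =>
    mem_of_map_equiv_eq (hF.grading a)
  let f₀ : V →ₗ[K] V' := LinearMap.fst K V' _ ∘ₗ F.toLinearMap ∘ₗ LinearMap.inl K V _
  have hf₀ : ∀ v, F (v, 0) = (f₀ v, 0) := fun v => Prod.ext rfl ((hplus _).2 rfl)
  let f : V ≃ₗ[K] V' := LinearEquiv.ofBijective f₀ ⟨(injective_iff_map_eq_zero _).2 fun v hv => by
      have := hf₀ v
      rw [hv] at this
      exact congrArg Prod.fst (F.injective (this.trans (map_zero F).symm)), fun w => by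
      have h2 : (F.symm (w, 0)).2 = 0 := (hplus _).1 (by simp)
      refine ⟨(F.symm (w, 0)).1, ?_⟩
      have h3 : ((F.symm (w, 0)).1, (0 : Module.Dual K V)) = F.symm (w, 0) :=
        Prod.ext rfl h2.symm
      have h4 := hf₀ (F.symm (w, 0)).1
      rw [h3, LinearEquiv.apply_symm_apply] at h4
      exact (congrArg Prod.fst h4).symm⟩
  have hf : ∀ v, F (v, 0) = (f v, 0) := hf₀
  refine ⟨f, fun a => map_equiv_eq f fun v => ?_, ?_⟩
  · have := hgr a (v, 0)
    rw [hf] at this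
    simpa [doubleGrading, Submodule.mem_prod] using this
  · ext1 x
    have h1 : F (0, x.2) = (0, f.dualMap.symm x.2) := by
      refine Prod.ext ((hminus _).2 rfl) (LinearMap.ext fun w => ?_)
      obtain ⟨v, rfl⟩ := f.surjective w
      have h2 := hF.form (0, x.2) (v, 0)
      rw [hf] at h2
      simpa [doubleTriple, pairing_apply, dualMap_symm_apply] using h2
    have h3 : x = (x.1, 0) + (0, x.2) := by simp
    rw [h3, map_add, h1, hf, doubleEquiv_apply]
    simp

variable [CharZero K] {t : ℕ → ℕ → BigAlgebra 𝒱} {t' : ℕ → ℕ → BigAlgebra 𝒱'}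

theorem IsBialgebraIso.isTripleIso [FiniteDimensional K V] [FiniteDimensional K V']
    (h : DirectSum.IsInternal 𝒱) (h' : DirectSum.IsInternal 𝒱') {f : V ≃ₗ[K] V'}
    (hf : IsBialgebraIso t t' f) :
    IsTripleIso (doubleTriple 𝒱 (derivedBrackets 𝒱 t))
      (doubleTriple 𝒱' (derivedBrackets 𝒱' t')) (doubleEquiv f) where
  grading := map_eq_of_forall_mem (X := Double K V) (Y := Double K V') (gr := doubleGrading 𝒱)
    (gr' := doubleGrading 𝒱') (isInternal_doubleGrading h) (isInternal_doubleGrading h')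
    (doubleEquiv f) (doubleEquiv_mem hf.grading)
  plus := map_equiv_eq (doubleEquiv f) fun x => by
    simp [doubleTriple, doubleEquiv_apply, LinearMap.range_inl]
  minus := map_equiv_eq (doubleEquiv f) fun x => by
    simp [doubleTriple, doubleEquiv_apply, LinearMap.range_inr]
  form := pairing_doubleEquiv h h' hf.grading
  bracket n v := by
    obtain ⟨φ, hφ, ht⟩ := hf.structures
    obtain rfl : (fun k l => φ (t k l)) = t' := funext fun k => funext fun l => ht k l
    exact derivedBrackets_map (F := (doubleEquiv f).toLinearMap)
      (doubleParity_doubleEquiv h h' hf.grading) (pairing_doubleEquiv h h' hf.grading) hφ t n v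

theorem isTripleIso_iff [FiniteDimensional K V] [FiniteDimensional K V']
    (h : DirectSum.IsInternal 𝒱) (h' : DirectSum.IsInternal 𝒱') (ht : IsLInftyBialgebra 𝒱 t)
    (ht' : IsLInftyBialgebra 𝒱' t') (F : Double K V ≃ₗ[K] Double K V') :
    IsTripleIso (doubleTriple 𝒱 (derivedBrackets 𝒱 t))
        (doubleTriple 𝒱' (derivedBrackets 𝒱' t')) F ↔
      ∃ f : V ≃ₗ[K] V', IsBialgebraIso t t' f ∧ F = doubleEquiv f := by
  constructor
  · intro hF
    obtain ⟨f, hf, rfl⟩ := hF.exists_eq_doubleEquiv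
    have hpar := doubleParity_doubleEquiv h h' hf
    obtain ⟨φ, hφ⟩ := exists_algHom (F := (doubleEquiv f).toLinearMap) hpar
    refine ⟨f, ⟨hf, φ, hφ, ?_⟩, rfl⟩
    -- The image of `t` under `φ` and the structure `t'` have the same derived brackets, because `F`
    -- respects brackets, and the brackets determine the structure.
    have heq : (fun k l => φ (t k l)) = t' := by
      refine eq_of_derivedBrackets_eq h'
        (fun k l => map_mem_homogeneousComponent hf hφ (ht.degree k l)) ht'.degree
        (by rw [ht.zero_left, ht'.zero_left, map_zero]) fun n => ?_
      ext1 v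
      obtain ⟨u, rfl⟩ : ∃ u : Fin n → Double K V, v = fun i => doubleEquiv f (u i) :=
        ⟨fun i => (doubleEquiv f).symm (v i), by simp⟩
      exact (derivedBrackets_map (F := (doubleEquiv f).toLinearMap) hpar
        (pairing_doubleEquiv h h' hf) hφ t n u).trans (hF.bracket n u).symm
    exact fun k l => congrFun (congrFun heq k) l
  · rintro ⟨f, hf, rfl⟩
    exact hf.isTripleIso h h'

end Isomorphisms

end ManinLInfty

theorem mainTheorem1 {K : Type*} [Field K] [CharZero K] :
    -- the iterated adjoint action is a bijection between the bialgebra structures on `V` and the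
    -- brackets that make `(V ⊕ V*, V, V*)` a Manin triple
    (∀ (V : Type*) [AddCommGroup V] [Module K V] [FiniteDimensional K V]
      (𝒱 : ℤ → Submodule K V), DirectSum.IsInternal 𝒱 →
      Set.BijOn (derivedBrackets 𝒱) {t | IsLInftyBialgebra 𝒱 t}
        {lam | IsManinTriple (doubleTriple 𝒱 lam)}) ∧
    -- every Manin triple comes in this way from a unique bialgebra structure on `g₊`
    (∀ (g : Type*) [AddCommGroup g] [Module K g] [FiniteDimensional K g]
      (M : TripleData K g), IsManinTriple M →
      ∃! t : ℕ → ℕ → BigAlgebra (inducedGrading M.grading M.plus),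
        IsLInftyBialgebra (inducedGrading M.grading M.plus) t ∧
        ∃ F : Double K M.plus ≃ₗ[K] g,
          (∀ x : M.plus, F (x, 0) = x) ∧
          IsTripleIso (doubleTriple (inducedGrading M.grading M.plus)
            (derivedBrackets (inducedGrading M.grading M.plus) t)) M F) ∧
    -- isomorphisms correspond to isomorphisms
    (∀ (V V' : Type*) [AddCommGroup V] [Module K V] [FiniteDimensional K V]
      [AddCommGroup V'] [Module K V'] [FiniteDimensional K V']
      (𝒱 : ℤ → Submodule K V) (𝒱' : ℤ → Submodule K V')
      (t : ℕ → ℕ → BigAlgebra 𝒱) (t' : ℕ → ℕ → BigAlgebra 𝒱'),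
      DirectSum.IsInternal 𝒱 → DirectSum.IsInternal 𝒱' →
      IsLInftyBialgebra 𝒱 t → IsLInftyBialgebra 𝒱' t' →
      ∀ F : Double K V ≃ₗ[K] Double K V',
        IsTripleIso (doubleTriple 𝒱 (derivedBrackets 𝒱 t))
            (doubleTriple 𝒱' (derivedBrackets 𝒱' t')) F ↔
          ∃ f : V ≃ₗ[K] V', IsBialgebraIso t t' f ∧ F = doubleEquiv f) :=
  ⟨fun _ _ _ _ _ h => bijOn_derivedBrackets h,
    fun _ _ _ _ _ hM => hM.existsUnique_isLInftyBialgebra,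
    fun _ _ _ _ _ _ _ _ _ _ _ _ h h' ht ht' F => isTripleIso_iff h h' ht ht' F⟩
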